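/- **Setting.** Let $n\in\mathbb N_0$, $t>0$. For $s>0$ put $d\mu_s(w)=(\pi s)^{-n}e^{-|w|^2/s}\,dw$ on $\mathbb C^n$ and $\langle g,h\rangle_s=\int g\bar h\,d\mu_s$. For $1\le p<\infty$ let $L_t^p=L^p(\mathbb C^n,\mu_{2t/p})$, let $L_t^\infty$ carry the norm $\operatorname{ess\,sup}|g|e^{-|\cdot|^2/2t}$, and let $F_t^p$ ($1\le p\le\infty$) be the space of entire functions in $L_t^p$ with the norm of $L_t^p$; $f_t^\infty$ is the space of those $g\in F_t^\infty$ with $ge^{-|\cdot|^2/2t}\in C_0(\mathbb C^n)$. Let $\mathbb F_t$ be any one of the spaces $F_t^p$ ($1\le p\le\infty$), $f_t^\infty$. Put $K_z^t(w)=e^{w\cdot\bar z/t}$, $k_z^t=K_z^t e^{-|z|^2/2t}$, $W_z^tg(w)=k_z^t(w)g(w-z)$, $\alpha_z(A)=W_z^tAW_{-z}^t$ for bounded $A$ on $\mathbb F_t$, and $\tilde f^{(s)}(z)=\langle fk_z^s,k_z^s\rangle_s$. With $e_\alpha^t(w)=(t^{|\alpha|}\alpha!)^{-1/2}w^\alpha$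 let $P_kg=\sum_{|\alpha|=k}\langle g,e_\alpha^t\rangle_te_\alpha^t$ and $T_0^{(s)}=\sum_{k\ge0}(1-t/s)^kP_k$ on $\mathbb F_t$. Let $f:\mathbb C^n\to\mathbb C$ be such that $fK_z^t\in L_t^2$ for every $z\in\mathbb C^n$. The Toeplitz operator is $T_f^tg(z)=\langle fg,K_z^t\rangle_t$, considered on an arbitrary linear subspace $D\subseteq\mathbb F_t$ that contains all $K_z^t$ (for instance $D=\mathbb F_t$, $D=\operatorname{span}\{K_z^t\}$, or $D=\{g\in\mathbb F_t: fg\in L_t^p\}$, with $p=\infty$ for $f_t^\infty$, whenever this contains the kernels, as it does for $p\le2$); $\|T_f^t\|=\sup_{0\ne g\in D}\|T_f^tg\|/\|g\|\in[0,\infty]$, in the norms of $L_t^p$. **Theorem.** 1. For every $s\in(t/2,2t)$ there is a constant $C>0$, depending only on $n,t,s$ and the choice of $\mathbb F_t$, such that for all such $f$ and $D$ the integrals defining $\tilde f^{(s)}$ converge absolutely and $$\sup_{z\in\mathbb C^n}|\tilde f^{(s)}(z)|\le C\,\|T_f^t\|.$$ 2. For every $s>t/2$ the operator $T_0^{(s)}$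 is nuclear on $\mathbb F_t$, and the series defining it converges in nuclear norm. 3. Let $s\in(t/2,t)$, and let $A$ be a bounded operator on $\mathbb F_t$ with $Ag=T_f^tg$ for all $g\in D$, for some $f$, $D$ as above. Then for every $z\in\mathbb C^n$ the operator $T_0^{(s)}\alpha_{-z}(A)$ is nuclear, its nuclear trace is well defined (the same for all nuclear representations), and $$\tilde f^{(s)}(z)=\Big(\frac ts\Big)^n\operatorname{Tr}\big(T_0^{(s)}\alpha_{-z}(A)\big).$$ -/

import Mathlib

namespace Fock

open MeasureTheory Filter Topology
open scoped ENNReal ComplexConjugate Nat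

noncomputable section

/-- `|z|²` for `z ∈ ℂⁿ` (Euclidean). The carrier `Fin n → ℂ` has its product topology and
Lebesgue measure; its sup norm is never used as the norm `|z|`. -/
def normSq {n : ℕ} (z : Fin n → ℂ) : ℝ := ∑ j, ‖z j‖ ^ 2

/-- The sesquilinear product `w · z̄ = ∑ⱼ wⱼ z̄ⱼ`. -/
def dot {n : ℕ} (w z : Fin n → ℂ) : ℂ := ∑ j, w j * conj (z j)

/-- The reproducing kernel `K_z^t(w) = exp(w · z̄ / t)`. -/
def kernel {n : ℕ} (t : ℝ) (z w : Fin n → ℂ) : ℂ := Complex.exp (dot w z / (t : ℂ))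

/-- The normalized kernel `k_z^t = K_z^t / ‖K_z^t‖`, where `‖K_z^t‖ = exp(|z|² / (2t))` in `F_t²`. -/
def nkernel {n : ℕ} (t : ℝ) (z w : Fin n → ℂ) : ℂ :=
  kernel t z w * (Real.exp (-(normSq z / (2 * t))) : ℂ)

/-- The pairing `⟨g, h⟩_t = ∫ g h̄ dμ_t`, with `dμ_t = (πt)⁻ⁿ exp(-|w|²/t) dw`. -/
def pairing {n : ℕ} (t : ℝ) (g h : (Fin n → ℂ) → ℂ) : ℂ :=
  (((Real.pi * t) ^ n)⁻¹ : ℝ) *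
    ∫ w : Fin n → ℂ, g w * conj (h w) * (Real.exp (-(normSq w / t)) : ℂ)

/-- `P_t h (z) = ⟨h, K_z^t⟩_t`. -/
def proj {n : ℕ} (t : ℝ) (h : (Fin n → ℂ) → ℂ) (z : Fin n → ℂ) : ℂ :=
  pairing t h (kernel t z)

/-- The Berezin transform `f̃^{(s)}(z) = ⟨f k_z^s, k_z^s⟩_s` of a function. -/
def berezin {n : ℕ} (s : ℝ) (f : (Fin n → ℂ) → ℂ) (z : Fin n → ℂ) : ℂ :=
  pairing s (fun w => f w * nkernel s z w) (nkernel s z)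

/-- `g(w) exp(-|w|²/(2t))`. -/
def weighted {n : ℕ} (t : ℝ) (g : (Fin n → ℂ) → ℂ) (w : Fin n → ℂ) : ℂ :=
  g w * (Real.exp (-(normSq w / (2 * t))) : ℂ)

/-- The normalizing constant of the norm of `L_t^p`: `(p / (2πt))ⁿ` for `p < ∞`, and `1` for
`p = ∞`. -/
def normConst (n : ℕ) (t : ℝ) (p : ℝ≥0∞) : ℝ≥0∞ :=
  if p = ∞ then 1 else ENNReal.ofReal ((p.toReal / (2 * Real.pi * t)) ^ n)

/-- The Lebesgue measure on `ℂⁿ`, multiplied by `normConst`. -/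
def scaledVolume (n : ℕ) (t : ℝ) (p : ℝ≥0∞) : Measure (Fin n → ℂ) := normConst n t p • volume

/-- The norm of `L_t^p`, with values in `[0, ∞]`:
`‖g‖^p = (p/(2πt))ⁿ ∫ |g(w)|^p exp(-p|w|²/(2t)) dw` for `p < ∞`, i.e. the norm of
`L^p(μ_{2t/p})`, and `‖g‖ = ess sup |g(w)| exp(-|w|²/(2t))` for `p = ∞`. -/
def eNormL {n : ℕ} (t : ℝ) (p : ℝ≥0∞) (g : (Fin n → ℂ) → ℂ) : ℝ≥0∞ :=
  eLpNorm (weighted t g) p (scaledVolume n t p)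

/-- `g ∈ L_t^p`. -/
def MemL {n : ℕ} (t : ℝ) (p : ℝ≥0∞) (g : (Fin n → ℂ) → ℂ) : Prop :=
  MemLp (weighted t g) p (scaledVolume n t p)

/-- Labels of the Fock spaces: `lp p` stands for `F_t^p`, `1 ≤ p ≤ ∞`, and `vanishing` for
`f_t^∞`. -/
inductive Kind : Type
  | lp (p : ℝ≥0∞) (hp : 1 ≤ p) : Kind
  | vanishing : Kind

/-- The exponent of the norm. -/
def Kind.exponent : Kind → ℝ≥0∞
  | .lp p _ => p
  | .vanishing => ∞

theorem Kind.one_le_exponent (X : Kind) : 1 ≤ X.exponent := by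
  cases X with
  | lp p hp => exact hp
  | vanishing => exact le_top

theorem weighted_add {n : ℕ} (t : ℝ) (g h : (Fin n → ℂ) → ℂ) :
    weighted t (g + h) = weighted t g + weighted t h := by
  funext w; simp [weighted, add_mul]

theorem weighted_smul {n : ℕ} (t : ℝ) (c : ℂ) (g : (Fin n → ℂ) → ℂ) :
    weighted t (c • g) = c • weighted t g := by
  funext w; simp [weighted, mul_assoc]

/-- The Fock space as a space of functions: entire functions in `L_t^p`, and, for `f_t^∞`, with
`g exp(-|·|²/(2t)) ∈ C₀(ℂⁿ)`. -/
def submodule (n : ℕ) (t : ℝ) (X : Kind) : Submodule ℂ ((Fin n → ℂ) → ℂ) where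
  carrier := {g | Differentiable ℂ g ∧ MemL t X.exponent g ∧
    (X = Kind.vanishing → Tendsto (weighted t g) (cocompact (Fin n → ℂ)) (𝓝 0))}
  zero_mem' := by
    have h0 : weighted t (0 : (Fin n → ℂ) → ℂ) = 0 := by funext w; simp [weighted]
    refine ⟨differentiable_const 0, ?_, fun _ => ?_⟩
    · unfold MemL; rw [h0]; exact MemLp.zero
    · rw [h0]; exact tendsto_const_nhds
  add_mem' := by
    rintro g h ⟨hg, hg1, hg2⟩ ⟨hh, hh1, hh2⟩
    refine ⟨hg.add hh, ?_, fun hX => ?_⟩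
    · unfold MemL; rw [weighted_add]; exact MemLp.add hg1 hh1
    · rw [weighted_add, ← add_zero (0 : ℂ)]; exact (hg2 hX).add (hh2 hX)
  smul_mem' := by
    rintro c g ⟨hg, hg1, hg2⟩
    refine ⟨hg.const_smul c, ?_, fun hX => ?_⟩
    · unfold MemL; rw [weighted_smul]; exact MemLp.const_smul hg1 c
    · rw [weighted_smul, ← smul_zero c]; exact (hg2 hX).const_smul c

/-- The Fock space `F_t^p` or `f_t^∞` on `ℂⁿ`. -/
def Space (n : ℕ) (t : ℝ) (X : Kind) : Type := ↥(submodule n t X)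

namespace Space

variable {n : ℕ} {t : ℝ} {X : Kind}

instance : AddCommGroup (Space n t X) := inferInstanceAs (AddCommGroup ↥(submodule n t X))
instance : Module ℂ (Space n t X) := inferInstanceAs (Module ℂ ↥(submodule n t X))

/-- The underlying function. -/
def toFun (g : Space n t X) : (Fin n → ℂ) → ℂ := (show ↥(submodule n t X) from g).1

instance : CoeFun (Space n t X) (fun _ => (Fin n → ℂ) → ℂ) := ⟨toFun⟩

theorem differentiable (g : Space n t X) : Differentiable ℂ (g : (Fin n → ℂ) → ℂ) :=
  (show ↥(submodule n t X) from g).2.1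

theorem memL (g : Space n t X) : MemL t X.exponent g := (show ↥(submodule n t X) from g).2.2.1

theorem coe_add (g h : Space n t X) : ((g + h : Space n t X) : (Fin n → ℂ) → ℂ) = g + h := rfl

theorem coe_smul (c : ℂ) (g : Space n t X) :
    ((c • g : Space n t X) : (Fin n → ℂ) → ℂ) = c • (g : (Fin n → ℂ) → ℂ) := rfl

theorem ext {g h : Space n t X} (H : (g : (Fin n → ℂ) → ℂ) = h) : g = h := Subtype.ext H

instance : Norm (Space n t X) := ⟨fun g => (eNormL t X.exponent g).toReal⟩

theorem norm_def (g : Space n t X) : ‖g‖ = (eNormL t X.exponent g).toReal := rfl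

end Space

theorem continuous_normSq {n : ℕ} : Continuous (normSq (n := n)) := by
  unfold normSq; fun_prop

theorem continuous_weighted {n : ℕ} (t : ℝ) {g : (Fin n → ℂ) → ℂ} (hg : Continuous g) :
    Continuous (weighted t g) := by
  have := continuous_normSq (n := n)
  unfold weighted; fun_prop

theorem normConst_ne_zero {n : ℕ} {t : ℝ} (ht : 0 < t) {p : ℝ≥0∞} (hp : 1 ≤ p) :
    normConst n t p ≠ 0 := by
  unfold normConst
  split_ifs with h
  · exact one_ne_zero
  · have : 0 < p.toReal := ENNReal.toReal_pos (by positivity) h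
    have : 0 < (p.toReal / (2 * Real.pi * t)) ^ n := by positivity
    simpa using this

theorem normConst_ne_top {n : ℕ} {t : ℝ} {p : ℝ≥0∞} : normConst n t p ≠ ∞ := by
  unfold normConst
  split_ifs <;> simp

theorem Space.core {n : ℕ} {t : ℝ} (ht : 0 < t) {X : Kind} :
    NormedSpace.Core ℂ (Space n t X) where
  norm_nonneg g := ENNReal.toReal_nonneg
  norm_smul c g := by
    rw [norm_def, norm_def, coe_smul, eNormL, weighted_smul, eLpNorm_const_smul,
      ENNReal.toReal_mul]
    simp [eNormL]
  norm_triangle g h := by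
    rw [norm_def, norm_def, norm_def, coe_add, eNormL, weighted_add, eNormL, eNormL,
      ← ENNReal.toReal_add g.memL.2.ne h.memL.2.ne]
    exact ENNReal.toReal_mono (ENNReal.add_ne_top.2 ⟨g.memL.2.ne, h.memL.2.ne⟩)
      (eLpNorm_add_le g.memL.1 h.memL.1 X.one_le_exponent)
  norm_eq_zero_iff g := by
    constructor
    · intro h
      rw [norm_def, ENNReal.toReal_eq_zero_iff] at h
      have h0 : eNormL t X.exponent g = 0 := h.resolve_right g.memL.2.ne
      have hc := continuous_weighted t g.differentiable.continuous
      rw [eNormL, eLpNorm_eq_zero_iff g.memL.1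
        (lt_of_lt_of_le one_pos X.one_le_exponent).ne', scaledVolume,
        Measure.ae_ennreal_smul_measure_eq (normConst_ne_zero ht X.one_le_exponent)] at h0
      have h1 := Continuous.ae_eq_iff_eq volume hc continuous_zero |>.1 h0
      apply Space.ext
      funext w
      have h2 := congrFun h1 w
      change _ = (0 : ℂ)
      simpa [weighted] using h2
    · rintro rfl
      have : weighted t ((0 : Space n t X) : (Fin n → ℂ) → ℂ) = 0 := by
        funext w
        change (0 : ℂ) * _ = 0
        simp
      rw [norm_def, eNormL, this]
      simp

instance {n : ℕ} {t : ℝ} [ht : Fact (0 < t)] {X : Kind} : NormedAddCommGroup (Space n t X) :=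
  NormedAddCommGroup.ofCore (Space.core ht.out)

instance {n : ℕ} {t : ℝ} [ht : Fact (0 < t)] {X : Kind} : NormedSpace ℂ (Space n t X) :=
  NormedSpace.ofCore (Space.core ht.out)

/-- A function bounded by `C exp(a ∑ |wⱼ|)` lies in every `L_t^p` and its weighted version vanishes
at infinity. -/
theorem weighted_norm_le {n : ℕ} {t : ℝ} (ht : 0 < t) {h : (Fin n → ℂ) → ℂ} {a C : ℝ}
    (hb : ∀ w, ‖h w‖ ≤ C * Real.exp (a * ∑ j, ‖w j‖)) (w : Fin n → ℂ) :
    ‖weighted t h w‖ ≤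
      C * Real.exp (n * (a ^ 2 * t)) * Real.exp (-(1 / (4 * t)) * normSq w) := by
  have hC : 0 ≤ C := by
    have := (norm_nonneg _).trans (hb w)
    exact nonneg_of_mul_nonneg_left this (Real.exp_pos _)
  have h1 : ‖weighted t h w‖ = ‖h w‖ * Real.exp (-(normSq w / (2 * t))) := by
    rw [weighted, norm_mul, Complex.norm_real, Real.norm_of_nonneg (Real.exp_pos _).le]
  rw [h1]
  calc ‖h w‖ * Real.exp (-(normSq w / (2 * t)))
      ≤ C * Real.exp (a * ∑ j, ‖w j‖) * Real.exp (-(normSq w / (2 * t))) := by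
        gcongr; exact hb w
    _ ≤ _ := by
        rw [mul_assoc, mul_assoc, ← Real.exp_add, ← Real.exp_add]
        refine mul_le_mul_of_nonneg_left (Real.exp_le_exp.2 ?_) hC
        have h2 : a * ∑ j, ‖w j‖ ≤ ∑ j, (a ^ 2 * t + 1 / (4 * t) * ‖w j‖ ^ 2) := by
          rw [Finset.mul_sum]
          refine Finset.sum_le_sum fun j _ => ?_
          have h3 : 0 ≤ (2 * t * a - ‖w j‖) ^ 2 / (4 * t) := by positivity
          have h4 : (2 * t * a - ‖w j‖) ^ 2 / (4 * t) =
            a ^ 2 * t + 1 / (4 * t) * ‖w j‖ ^ 2 - a * ‖w j‖ := by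
            field_simp; ring
          linarith
        rw [Finset.sum_add_distrib, Finset.sum_const, Finset.card_univ,
          Fintype.card_fin, nsmul_eq_mul] at h2
        have h5 : normSq w / (2 * t) = 2 * (1 / (4 * t) * normSq w) := by
          field_simp; ring
        have h6 : ∑ j, ‖w j‖ ^ 2 = normSq w := rfl
        rw [← Finset.mul_sum, h6] at h2
        linarith

theorem integrable_gauss {n : ℕ} {b : ℝ} (hb : 0 < b) :
    Integrable (fun w : Fin n → ℂ => Real.exp (-b * normSq w)) := by
  have h1 : Integrable (fun z : ℂ => Real.exp (-b * ‖z‖ ^ 2)) := by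
    have := (GaussianFourier.integrable_cexp_neg_mul_sq_norm_add (V := ℂ) (b := (b : ℂ))
      (by simpa using hb) 0 0).norm
    refine this.congr (Filter.Eventually.of_forall fun z => ?_)
    simp only [Complex.norm_exp]
    congr 1
    simp [← Complex.ofReal_pow]
  have h2 := Integrable.fintype_prod (f := fun (_ : Fin n) (z : ℂ) => Real.exp (-b * ‖z‖ ^ 2))
    (μ := fun _ => volume) (fun _ => h1)
  refine h2.congr (Filter.Eventually.of_forall fun w => ?_)
  simp only [normSq, Finset.mul_sum, Real.exp_sum]

theorem memLp_gauss {n : ℕ} {b : ℝ} (hb : 0 < b) {p : ℝ≥0∞} (hp : 1 ≤ p) :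
    MemLp (fun w : Fin n → ℂ => Real.exp (-b * normSq w)) p volume := by
  have hm : AEStronglyMeasurable (fun w : Fin n → ℂ => Real.exp (-b * normSq w)) volume :=
    (integrable_gauss hb).1
  by_cases h : p = ∞
  · subst h
    refine memLp_top_of_bound hm 1 (Filter.Eventually.of_forall fun w => ?_)
    rw [Real.norm_of_nonneg (Real.exp_pos _).le, Real.exp_le_one_iff]
    have : 0 ≤ normSq w := Finset.sum_nonneg fun j _ => by positivity
    nlinarith
  · have hp0 : p ≠ 0 := (lt_of_lt_of_le one_pos hp).ne'
    rw [← integrable_norm_rpow_iff hm hp0 h]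
    have hpos : 0 < p.toReal * b := mul_pos (ENNReal.toReal_pos hp0 h) hb
    refine (integrable_gauss (n := n) hpos).congr (Filter.Eventually.of_forall fun w => ?_)
    simp only [Real.norm_of_nonneg (Real.exp_pos _).le, ← Real.exp_mul]
    congr 1; ring

theorem memLp_weighted {n : ℕ} {t : ℝ} (ht : 0 < t) {h : (Fin n → ℂ) → ℂ} (hc : Continuous h)
    {a C : ℝ} (hb : ∀ w, ‖h w‖ ≤ C * Real.exp (a * ∑ j, ‖w j‖)) {p : ℝ≥0∞} (hp : 1 ≤ p) :
    MemLp (weighted t h) p volume := by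
  have hb4 : 0 < 1 / (4 * t) := by positivity
  refine MemLp.of_le ((memLp_gauss (n := n) hb4 hp).const_mul (C * Real.exp (n * (a ^ 2 * t))))
    (continuous_weighted t hc).aestronglyMeasurable (Filter.Eventually.of_forall fun w => ?_)
  exact (weighted_norm_le ht hb w).trans (le_abs_self _)

theorem tendsto_weighted {n : ℕ} {t : ℝ} (ht : 0 < t) {h : (Fin n → ℂ) → ℂ}
    {a C : ℝ} (hb : ∀ w, ‖h w‖ ≤ C * Real.exp (a * ∑ j, ‖w j‖)) :
    Tendsto (weighted t h) (cocompact (Fin n → ℂ)) (𝓝 0) := by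
  have hb4 : 0 < 1 / (4 * t) := by positivity
  have h1 : Tendsto (fun w : Fin n → ℂ => normSq w) (cocompact _) atTop := by
    have h2 : Tendsto (fun w : Fin n → ℂ => ‖w‖ ^ 2) (cocompact _) atTop :=
      (tendsto_pow_atTop two_ne_zero).comp (tendsto_norm_cocompact_atTop (E := Fin n → ℂ))
    refine tendsto_atTop_mono (fun w => ?_) h2
    have h3 : 0 ≤ normSq w := Finset.sum_nonneg fun j _ => by positivity
    have h4 : ‖w‖ ≤ Real.sqrt (normSq w) := by
      refine (pi_norm_le_iff_of_nonneg (Real.sqrt_nonneg _)).2 fun j => ?_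
      refine Real.le_sqrt_of_sq_le ?_
      exact Finset.single_le_sum (f := fun j => ‖w j‖ ^ 2) (fun i _ => by positivity)
        (Finset.mem_univ j)
    calc ‖w‖ ^ 2 ≤ Real.sqrt (normSq w) ^ 2 := by gcongr
      _ = normSq w := Real.sq_sqrt h3
  have h5 : Tendsto (fun w : Fin n → ℂ => C * Real.exp (n * (a ^ 2 * t)) *
      Real.exp (-(1 / (4 * t)) * normSq w)) (cocompact _) (𝓝 0) := by
    have h6 := Real.tendsto_exp_atBot.comp
      ((tendsto_const_mul_atBot_of_neg (r := -(1 / (4 * t))) (by linarith)).2 h1)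
    simpa using h6.const_mul (C * Real.exp (n * (a ^ 2 * t)))
  exact squeeze_zero_norm (fun w => weighted_norm_le ht hb w) h5

/-- Entire functions of at most exponential growth, as elements of the Fock spaces. -/
def Space.ofGrowth {n : ℕ} {t : ℝ} [ht : Fact (0 < t)] (X : Kind) (h : (Fin n → ℂ) → ℂ)
    (hd : Differentiable ℂ h)
    (hb : ∃ a C : ℝ, ∀ w, ‖h w‖ ≤ C * Real.exp (a * ∑ j, ‖w j‖)) : Space n t X :=
  (⟨h, hd,
    by
      obtain ⟨a, C, hb⟩ := hb
      exact (memLp_weighted ht.out hd.continuous hb X.one_le_exponent).smul_measure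
        normConst_ne_top,
    fun _ => by
      obtain ⟨a, C, hb⟩ := hb
      exact tendsto_weighted ht.out hb⟩ : ↥(submodule n t X))

theorem kernel_differentiable {n : ℕ} (t : ℝ) (z : Fin n → ℂ) :
    Differentiable ℂ (kernel t z) := by
  unfold kernel dot; fun_prop

theorem kernel_growth {n : ℕ} {t : ℝ} (ht : 0 < t) (z : Fin n → ℂ) :
    ∃ a C : ℝ, ∀ w, ‖kernel t z w‖ ≤ C * Real.exp (a * ∑ j, ‖w j‖) := by
  refine ⟨‖z‖ / t, 1, fun w => ?_⟩
  rw [kernel, Complex.norm_exp, one_mul]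
  refine Real.exp_le_exp.2 ((Complex.re_le_norm _).trans ?_)
  rw [norm_div, Complex.norm_real, Real.norm_of_nonneg ht.le, div_mul_eq_mul_div]
  refine div_le_div_of_nonneg_right ?_ ht.le
  refine (norm_sum_le _ _).trans ?_
  rw [Finset.mul_sum]
  refine Finset.sum_le_sum fun j _ => ?_
  rw [norm_mul, Complex.norm_conj, mul_comm]
  exact mul_le_mul_of_nonneg_right (norm_le_pi_norm z j) (norm_nonneg _)

/-- `K_z^t` as an element of a Fock space. -/
def kernelVec {n : ℕ} (t : ℝ) [ht : Fact (0 < t)] (X : Kind) (z : Fin n → ℂ) : Space n t X :=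
  Space.ofGrowth X (kernel t z) (kernel_differentiable t z) (kernel_growth ht.out z)

/-- The monomial `e_α^t(w) = (t^{|α|} α!)^{-1/2} w^α`. -/
def monomial {n : ℕ} (t : ℝ) (α : Fin n → ℕ) (w : Fin n → ℂ) : ℂ :=
  ((Real.sqrt (1 / (t ^ (∑ j, α j) * ∏ j, ((α j)! : ℝ))) : ℝ) : ℂ) * ∏ j, w j ^ α j

theorem monomial_differentiable {n : ℕ} (t : ℝ) (α : Fin n → ℕ) :
    Differentiable ℂ (monomial t α) := by
  unfold monomial; fun_prop

theorem monomial_growth {n : ℕ} (t : ℝ) (α : Fin n → ℕ) :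
    ∃ a C : ℝ, ∀ w, ‖monomial t α w‖ ≤ C * Real.exp (a * ∑ j, ‖w j‖) := by
  refine ⟨1, Real.sqrt (1 / (t ^ (∑ j, α j) * ∏ j, ((α j)! : ℝ))) * ∏ j, ((α j)! : ℝ),
    fun w => ?_⟩
  rw [monomial, norm_mul, Complex.norm_real, Real.norm_of_nonneg (Real.sqrt_nonneg _), mul_assoc,
    norm_prod, one_mul, Real.exp_sum, ← Finset.prod_mul_distrib]
  refine mul_le_mul_of_nonneg_left ?_ (Real.sqrt_nonneg _)
  refine Finset.prod_le_prod (fun j _ => norm_nonneg _) fun j _ => ?_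
  rw [norm_pow]
  have h1 := Real.pow_div_factorial_le_exp ‖w j‖ (norm_nonneg _) (α j)
  have h2 : (0 : ℝ) < ((α j)! : ℝ) := by positivity
  rw [div_le_iff₀ h2] at h1
  linarith

/-- `e_α^t` as an element of a Fock space. -/
def monomialVec {n : ℕ} (t : ℝ) [Fact (0 < t)] (X : Kind) (α : Fin n → ℕ) : Space n t X :=
  Space.ofGrowth X (monomial t α) (monomial_differentiable t α) (monomial_growth t α)

theorem pairing_eq {n : ℕ} {t : ℝ} (g h : (Fin n → ℂ) → ℂ) :
    pairing t g h = (((Real.pi * t) ^ n)⁻¹ : ℝ) *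
      ∫ w, (weighted t g * fun w => conj (weighted t h w)) w := by
  unfold pairing
  congr 2
  funext w
  have h1 : Real.exp (-(normSq w / t)) =
      Real.exp (-(normSq w / (2 * t))) * Real.exp (-(normSq w / (2 * t))) := by
    rw [← Real.exp_add]; congr 1; ring
  rw [h1]
  simp only [weighted, Pi.mul_apply, map_mul, Complex.conj_ofReal, Complex.ofReal_mul]
  ring

theorem memLp_volume {n : ℕ} {t : ℝ} (ht : 0 < t) {p : ℝ≥0∞} (hp : 1 ≤ p) :
    ∃ K : ℝ≥0∞, K ≠ ∞ ∧ ∀ h : (Fin n → ℂ) → ℂ,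
      eLpNorm h p volume = K * eLpNorm h p (scaledVolume n t p) := by
  have h0 : (normConst n t p)⁻¹ ≠ 0 := ENNReal.inv_ne_zero.2 normConst_ne_top
  have h1 : (normConst n t p)⁻¹ ≠ ∞ := ENNReal.inv_ne_top.2 (normConst_ne_zero ht hp)
  refine ⟨(normConst n t p)⁻¹ ^ (1 / p).toReal,
    ENNReal.rpow_ne_top_of_nonneg ENNReal.toReal_nonneg h1, fun h => ?_⟩
  have h2 : (volume : Measure (Fin n → ℂ)) = (normConst n t p)⁻¹ • scaledVolume n t p := by
    rw [scaledVolume, smul_smul, ENNReal.inv_mul_cancel (normConst_ne_zero ht hp)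
      normConst_ne_top, one_smul]
  conv_lhs => rw [h2, eLpNorm_smul_measure_of_ne_zero h0, smul_eq_mul]

theorem pairing_bound {n : ℕ} {t : ℝ} (ht : 0 < t) (X : Kind) {h : (Fin n → ℂ) → ℂ}
    (hh : ∀ p : ℝ≥0∞, 1 ≤ p → MemLp (weighted t h) p volume) :
    ∃ C : ℝ, ∀ g : Space n t X,
      Integrable (weighted t g * fun w => conj (weighted t h w)) volume ∧
        ‖pairing t g h‖ ≤ C * ‖g‖ := by
  obtain ⟨K, hK, hKe⟩ := memLp_volume (n := n) ht X.one_le_exponent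
  have hq : 1 ≤ ENNReal.conjExponent X.exponent := by
    unfold ENNReal.conjExponent; exact le_self_add
  have : ENNReal.HolderConjugate X.exponent (ENNReal.conjExponent X.exponent) :=
    .conjExponent X.one_le_exponent
  have hh2 : MemLp (fun w => conj (weighted t h w)) (ENNReal.conjExponent X.exponent) volume := by
    refine MemLp.of_le (hh _ hq) ?_ (Filter.Eventually.of_forall fun w => by simp)
    exact Complex.continuous_conj.comp_aestronglyMeasurable (hh _ hq).1
  set M := eLpNorm (fun w => conj (weighted t h w)) (ENNReal.conjExponent X.exponent) volume
  refine ⟨|((Real.pi * t) ^ n)⁻¹| * (K.toReal * M.toReal), fun g => ?_⟩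
  have hg : MemLp (weighted t g) X.exponent volume := by
    refine ⟨(continuous_weighted t g.differentiable.continuous).aestronglyMeasurable, ?_⟩
    rw [hKe]
    exact ENNReal.mul_lt_top hK.lt_top g.memL.2
  have hi := MemLp.integrable_mul hg hh2
  refine ⟨hi, ?_⟩
  rw [pairing_eq, norm_mul, Complex.norm_real, Real.norm_eq_abs, mul_assoc]
  refine mul_le_mul_of_nonneg_left ?_ (abs_nonneg _)
  refine (norm_integral_le_integral_norm _).trans ?_
  rw [integral_norm_eq_lintegral_enorm hi.1, ← eLpNorm_one_eq_lintegral_enorm]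
  have h3 := eLpNorm_smul_le_mul_eLpNorm (p := X.exponent)
    (q := ENNReal.conjExponent X.exponent) (r := 1) hh2.1 hg.1
  have h4 : K.toReal * M.toReal * ‖g‖ =
      (eLpNorm (weighted t g) X.exponent volume * M).toReal := by
    rw [hKe, ENNReal.toReal_mul, ENNReal.toReal_mul, Space.norm_def, eNormL]; ring
  rw [h4]
  exact ENNReal.toReal_mono (ENNReal.mul_ne_top hg.2.ne hh2.2.ne) h3

theorem monomial_memLp {n : ℕ} {t : ℝ} (ht : 0 < t) (α : Fin n → ℕ) (p : ℝ≥0∞) (hp : 1 ≤ p) :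
    MemLp (weighted t (monomial t α)) p volume := by
  obtain ⟨a, C, hb⟩ := monomial_growth t α
  exact memLp_weighted ht (monomial_differentiable t α).continuous hb hp

/-- The bounded functional `g ↦ ⟨g, e_α^t⟩_t`. -/
def coeffFunctional {n : ℕ} (t : ℝ) [ht : Fact (0 < t)] (X : Kind) (α : Fin n → ℕ) :
    StrongDual ℂ (Space n t X) :=
  LinearMap.mkContinuousOfExistsBound
    { toFun := fun g => pairing t g (monomial t α)
      map_add' := fun g h => by
        obtain ⟨C, hC⟩ := pairing_bound ht.out X (monomial_memLp ht.out α)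
        rw [pairing_eq, pairing_eq, pairing_eq, ← mul_add, ← integral_add' (hC g).1 (hC h).1,
          Space.coe_add, weighted_add, add_mul]
      map_smul' := fun c g => by
        rw [pairing_eq, pairing_eq, Space.coe_smul, weighted_smul, smul_mul_assoc]
        simp only [Pi.smul_apply, smul_eq_mul, RingHom.id_apply, integral_const_mul]
        ring }
    (by
      obtain ⟨C, hC⟩ := pairing_bound ht.out X (monomial_memLp ht.out α)
      exact ⟨C, fun g => (hC g).2⟩)

/-- `P_k = ∑_{|α| = k} e_α^t ⊗ e_α^t`. -/
def homProj (n : ℕ) (t : ℝ) [Fact (0 < t)] (X : Kind) (k : ℕ) :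
    Space n t X →L[ℂ] Space n t X :=
  ∑ α ∈ Finset.piAntidiag (Finset.univ : Finset (Fin n)) k,
    (coeffFunctional t X α).smulRight (monomialVec t X α)

/-- `T_0^{(s)} = ∑_k (1 - t/s)^k P_k`, the sum being taken in operator norm. -/
def opT0 (n : ℕ) (t : ℝ) [Fact (0 < t)] (X : Kind) (s : ℝ) : Space n t X →L[ℂ] Space n t X :=
  ∑' k : ℕ, (((1 - t / s) ^ k : ℝ) : ℂ) • homProj n t X k

/-- `(W_z^t g)(w) = k_z^t(w) g(w - z)`, on functions. -/
def weylFun {n : ℕ} (t : ℝ) (z : Fin n → ℂ) (g : (Fin n → ℂ) → ℂ) (w : Fin n → ℂ) : ℂ :=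
  nkernel t z w * g (w - z)

theorem norm_weighted_weylFun {n : ℕ} (t : ℝ) (z : Fin n → ℂ) (g : (Fin n → ℂ) → ℂ)
    (w : Fin n → ℂ) : ‖weighted t (weylFun t z g) w‖ = ‖weighted t g (w - z)‖ := by
  have hsq : normSq (w - z) = normSq w + normSq z - 2 * (dot w z).re := by
    simp only [normSq, dot, Complex.re_sum, Finset.mul_sum, ← Finset.sum_add_distrib,
      ← Finset.sum_sub_distrib]
    refine Finset.sum_congr rfl fun j _ => ?_
    rw [← Complex.normSq_eq_norm_sq, ← Complex.normSq_eq_norm_sq, ← Complex.normSq_eq_norm_sq,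
      Pi.sub_apply, Complex.normSq_sub]
  simp only [weighted, weylFun, nkernel, kernel, norm_mul, Complex.norm_exp, Complex.norm_real,
    Real.norm_of_nonneg (Real.exp_pos _).le, Complex.div_ofReal_re]
  have h1 : Real.exp (-(normSq (w - z) / (2 * t))) =
      Real.exp ((dot w z).re / t) * Real.exp (-(normSq z / (2 * t))) *
        Real.exp (-(normSq w / (2 * t))) := by
    rw [← Real.exp_add, ← Real.exp_add, hsq]
    congr 1
    ring
  rw [h1]; ring

theorem measurePreserving_sub {n : ℕ} (t : ℝ) (p : ℝ≥0∞) (z : Fin n → ℂ) :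
    MeasurePreserving (fun w => w - z) (scaledVolume n t p) (scaledVolume n t p) :=
  (measurePreserving_sub_right volume z).smul_measure _

/-- `W_z^t g` as an element of the Fock space. -/
def weylVec {n : ℕ} {t : ℝ} {X : Kind} (z : Fin n → ℂ) (g : Space n t X) : Space n t X :=
  (⟨weylFun t z g, by
      have h1 := kernel_differentiable t z
      have h2 := g.differentiable
      have h3 : Differentiable ℂ (fun w => g (w - z)) :=
        h2.comp (differentiable_id.sub_const z)
      unfold weylFun nkernel
      exact (h1.mul_const _).mul h3,
    by
      have hc : Continuous (weylFun t z g) := by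
        have h1 := (kernel_differentiable t z).continuous
        have h2 := g.differentiable.continuous
        unfold weylFun nkernel
        fun_prop
      exact MemLp.of_le (g.memL.comp_measurePreserving (measurePreserving_sub t _ z))
        (continuous_weighted t hc).aestronglyMeasurable
        (Filter.Eventually.of_forall fun w => (norm_weighted_weylFun t z g w).le),
    fun hX => by
      have h1 := (show ↥(submodule n t X) from g).2.2.2 hX
      have h2 := h1.comp (Homeomorph.subRight z).isClosedEmbedding.tendsto_cocompact
      exact squeeze_zero_norm (fun w => (norm_weighted_weylFun t z g w).le)
        (tendsto_zero_iff_norm_tendsto_zero.1 h2)⟩ :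
    ↥(submodule n t X))

theorem norm_weylVec {n : ℕ} {t : ℝ} {X : Kind} (z : Fin n → ℂ) (g : Space n t X) :
    ‖weylVec z g‖ = ‖g‖ := by
  rw [Space.norm_def, Space.norm_def, eNormL, eNormL,
    ← eLpNorm_comp_measurePreserving g.memL.1 (measurePreserving_sub t _ z)]
  congr 1
  exact eLpNorm_congr_norm_ae
    (Filter.Eventually.of_forall fun w => norm_weighted_weylFun t z g w)

/-- The Weyl operator `W_z^t`. -/
def weyl {n : ℕ} (t : ℝ) [Fact (0 < t)] (X : Kind) (z : Fin n → ℂ) :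
    Space n t X →L[ℂ] Space n t X :=
  LinearMap.mkContinuous
    { toFun := weylVec z
      map_add' := fun g h => Space.ext (funext fun w => mul_add _ (g (w - z)) (h (w - z)))
      map_smul' := fun c g => Space.ext (funext fun w => mul_left_comm _ c (g (w - z))) }
    1 (fun g => by rw [one_mul]; exact (norm_weylVec z g).le)

/-- `α_z(A) = W_z^t A W_{-z}^t`. -/
def shift {n : ℕ} {t : ℝ} [Fact (0 < t)] {X : Kind} (z : Fin n → ℂ)
    (A : Space n t X →L[ℂ] Space n t X) : Space n t X →L[ℂ] Space n t X :=
  weyl t X z ∘L A ∘L weyl t X (-z)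

/-- The symbols under consideration: `f K_z^t ∈ L_t^2` for all `z`. -/
def Admissible {n : ℕ} (t : ℝ) (f : (Fin n → ℂ) → ℂ) : Prop :=
  ∀ z : Fin n → ℂ, MemL t 2 (fun w => f w * kernel t z w)

/-- The Toeplitz operator `T_f^t g = P_t(f g)`. -/
def toeplitz {n : ℕ} (t : ℝ) (f g : (Fin n → ℂ) → ℂ) : (Fin n → ℂ) → ℂ :=
  proj t (fun w => f w * g w)

/-- The operator norm in `[0, ∞]` of `T_f^t` on the domain `D`, with respect to the norm of the
Fock space `X`. -/
def toeplitzNorm {n : ℕ} {t : ℝ} [Fact (0 < t)] {X : Kind} (f : (Fin n → ℂ) → ℂ)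
    (D : Submodule ℂ (Space n t X)) : ℝ≥0∞ :=
  ⨆ g ∈ D, eNormL t X.exponent (toeplitz t f g) / ENNReal.ofReal ‖g‖

section Nuclear

variable {E : Type*} [NormedAddCommGroup E] [NormedSpace ℂ E]

/-- `A = ∑ⱼ xⱼ ⊗ ξⱼ` with `∑ⱼ ‖xⱼ‖ ‖ξⱼ‖ < ∞`. -/
structure IsNuclearRep (A : E →L[ℂ] E) (x : ℕ → E) (ξ : ℕ → StrongDual ℂ E) : Prop where
  summable : Summable fun j => ‖x j‖ * ‖ξ j‖
  hasSum : ∀ v, HasSum (fun j => ξ j v • x j) (A v)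

/-- Nuclear operators. -/
def IsNuclear (A : E →L[ℂ] E) : Prop := ∃ x ξ, IsNuclearRep A x ξ

/-- The nuclear norm, the infimum of `∑ⱼ ‖xⱼ‖ ‖ξⱼ‖` over all nuclear representations (so `∞` if
there is none). -/
def nuclearNorm (A : E →L[ℂ] E) : ℝ≥0∞ :=
  ⨅ (x : ℕ → E) (ξ : ℕ → StrongDual ℂ E) (_ : IsNuclearRep A x ξ),
    ∑' j, ENNReal.ofReal (‖x j‖ * ‖ξ j‖)

/-- `A` is nuclear, its nuclear trace is well defined, and `Tr A = τ`: every nuclear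
representation satisfies `∑ⱼ ξⱼ(xⱼ) = τ`. -/
def HasNuclearTrace (A : E →L[ℂ] E) (τ : ℂ) : Prop :=
  IsNuclear A ∧ ∀ x ξ, IsNuclearRep A x ξ → HasSum (fun j => ξ j (x j)) τ

end Nuclear

end

end Fock

/-!
Everything rests on one Gaussian computation. If `ab = 1 - t/s` and `(a + b)² < 2`, then Fubini
and the Gaussian integral with linear terms give, for `f ∈ L_t^2`, `∫ (T_f K_{aζ})(bζ) dμ_t(ζ) =
(s/t)ⁿ f̃^{(s)}(0)` (`integral_toeplitz_kernel`). Translating the symbol conjugates `T_f` with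
Weyl operators (`toeplitz_shift_kernel`), so that the value of `f̃^{(s)}` at any point `z` is
obtained from the symbol `f(· + z)`.

*The estimate.* Point evaluations on the Fock spaces satisfy `|g(w)| ≤ C ‖g‖ exp(|w|²/(2t))`, and
`‖K_w‖` is a multiple of `exp(|w|²/(2t))`. Since the Weyl operators are isometric, the integrand
above is at most `C ‖T_f‖ exp((a² + b²)|ζ|²/(2t))`, uniformly over all translates of `f`. For `t/2
< s < 2t` the parameters can be chosen with `a² + b² < 2`, and the integral converges
(`exists_berezin_le`).

*Nuclearity.* Writing `T_0^{(s)} = ∑_α x^{|α|} e_α ⊗ e_α` with `x = 1 - t/s`, `|x| < 1`, it is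
enough that `‖e_α‖` and the norm of `g ↦ ⟨g, e_α⟩_t` are bounded by `C l^{-|α|}` for every `l <
1`. This follows from the elementary inequality `r^k / k! ≤ exp r` in each coordinate
(`norm_weighted_monomial_le`).

*The trace formula.* Put `B = α_{-z}(A)`. The series above gives a nuclear representation of
`T_0^{(s)} B` with trace `∑_α x^{|α|} ⟨B e_α, e_α⟩_t`. Since `e_α = ∫ e_α(w) K_w dμ_t(w)` as a
Bochner integral, and since `T_0^{(s)}` is the dilation by `x`, this equals `∫ (B K_w)(xw)
dμ_t(w)` (`hasSum_trace_monomial`), which is the key identity with `a = 1`, `b = x`.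

That the trace does not depend on the representation is a consequence of a bounded approximation
property: if the `S_m` are uniformly bounded, converge to the identity on the vectors that occur,
and have the property that `∑ⱼ ξⱼ(S_m xⱼ)` depends only on the operator represented, then so does
the limit `∑ⱼ ξⱼ(xⱼ)` (`HasTraceApproximation.trace_eq`). For `F_t^p` with `p < ∞` and for `f_t^∞`
one takes for `S` the projection `P_t` of a truncation, `S g = ∫_E g(w) K_w dμ_t(w)` with `E` of
finite measure. In `F_t^∞` truncations do not converge in norm, and `S` is instead `P_t` of a step
function that samples `g` at finitely many points (`hasTraceApproximation_top`). Both are bounded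
because `P_t` is bounded on `L_t^p` for `1 ≤ p ≤ ∞` (`exists_eNormL_proj_le`).
-/

namespace Fock

open MeasureTheory Filter Topology
open scoped ENNReal ComplexConjugate Nat

noncomputable section

/-! ### Algebra of the sesquilinear product -/

section Algebra

variable {n : ℕ}

theorem normSq_nonneg (z : Fin n → ℂ) : 0 ≤ normSq z :=
  Finset.sum_nonneg fun j _ => by positivity

theorem normSq_neg (z : Fin n → ℂ) : normSq (-z) = normSq z := by simp [normSq]

theorem dot_add_left (v w z : Fin n → ℂ) : dot (v + w) z = dot v z + dot w z := by
  simp [dot, add_mul, Finset.sum_add_distrib]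

theorem dot_add_right (v w z : Fin n → ℂ) : dot v (w + z) = dot v w + dot v z := by
  simp [dot, mul_add, Finset.sum_add_distrib]

theorem dot_smul_left (c : ℂ) (w z : Fin n → ℂ) : dot (c • w) z = c * dot w z := by
  simp [dot, mul_assoc, Finset.mul_sum]

theorem dot_smul_right (c : ℂ) (w z : Fin n → ℂ) : dot w (c • z) = conj c * dot w z := by
  simp [dot, Finset.mul_sum, mul_left_comm]

theorem dot_neg_left (w z : Fin n → ℂ) : dot (-w) z = -dot w z := by simp [dot]

theorem dot_neg_right (w z : Fin n → ℂ) : dot w (-z) = -dot w z := by simp [dot]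

theorem dot_zero_left (z : Fin n → ℂ) : dot 0 z = 0 := by simp [dot]

theorem dot_zero_right (z : Fin n → ℂ) : dot z 0 = 0 := by simp [dot]

theorem conj_dot (w z : Fin n → ℂ) : conj (dot w z) = dot z w := by
  simp [dot, mul_comm]

theorem dot_re_comm (w z : Fin n → ℂ) : (dot w z).re = (dot z w).re := by
  rw [← conj_dot, Complex.conj_re]

theorem dot_self (z : Fin n → ℂ) : dot z z = (normSq z : ℂ) := by
  simp [dot, normSq, Complex.mul_conj, Complex.normSq_eq_norm_sq]

theorem normSq_add (w z : Fin n → ℂ) :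
    normSq (w + z) = normSq w + normSq z + 2 * (dot w z).re := by
  have h : (normSq (w + z) : ℂ) = dot (w + z) (w + z) := (dot_self _).symm
  rw [dot_add_left, dot_add_right, dot_add_right, dot_self, dot_self] at h
  have h2 := congrArg Complex.re h
  simp only [Complex.add_re, Complex.ofReal_re] at h2
  rw [h2, dot_re_comm z w]; ring

theorem normSq_smul (c : ℂ) (z : Fin n → ℂ) : normSq (c • z) = ‖c‖ ^ 2 * normSq z := by
  simp [normSq, mul_pow, Finset.mul_sum]

@[fun_prop]
theorem continuous_dot_right (w : Fin n → ℂ) : Continuous fun z => dot w z := by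
  unfold dot; fun_prop

theorem norm_dot_le (w z : Fin n → ℂ) : ‖dot w z‖ ≤ ‖z‖ * ∑ j, ‖w j‖ := by
  refine (norm_sum_le _ _).trans ?_
  rw [Finset.mul_sum]
  refine Finset.sum_le_sum fun j _ => ?_
  rw [norm_mul, Complex.norm_conj, mul_comm]
  exact mul_le_mul_of_nonneg_right (norm_le_pi_norm z j) (norm_nonneg _)

theorem norm_kernel (t : ℝ) (z w : Fin n → ℂ) :
    ‖kernel t z w‖ = Real.exp ((dot w z).re / t) := by
  rw [kernel, Complex.norm_exp, Complex.div_ofReal_re]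

theorem conj_kernel (t : ℝ) (z w : Fin n → ℂ) : conj (kernel t z w) = kernel t w z := by
  rw [kernel, kernel, ← Complex.exp_conj, map_div₀, conj_dot, Complex.conj_ofReal]

theorem kernel_zero_left (t : ℝ) (w : Fin n → ℂ) : kernel t 0 w = 1 := by
  simp [kernel, dot_zero_right]

theorem norm_weighted (t : ℝ) (g : (Fin n → ℂ) → ℂ) (w : Fin n → ℂ) :
    ‖weighted t g w‖ = ‖g w‖ * Real.exp (-(normSq w / (2 * t))) := by
  rw [weighted, norm_mul, Complex.norm_real, Real.norm_of_nonneg (Real.exp_pos _).le]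

theorem weighted_sub (t : ℝ) (g h : (Fin n → ℂ) → ℂ) :
    weighted t (g - h) = weighted t g - weighted t h := by
  funext w; simp [weighted, sub_mul]

theorem exp_neg_normSq (t : ℝ) (w : Fin n → ℂ) : Real.exp (-(normSq w / t)) =
    Real.exp (-(normSq w / (2 * t))) * Real.exp (-(normSq w / (2 * t))) := by
  rw [← Real.exp_add]; congr 1; ring

end Algebra

/-! ### Gaussian integrals -/

section Gaussian

/-- The Gaussian integral with linear terms on `ℂ`, as a product of two integrals over `ℝ`. -/
theorem integrable_and_integral_cexp_complex {t : ℝ} (ht : 0 < t) (a b : ℂ) :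
    Integrable (fun z : ℂ => Complex.exp (z * conj a + b * conj z - (‖z‖ ^ 2 : ℝ) / t)) ∧
      ∫ z : ℂ, Complex.exp (z * conj a + b * conj z - (‖z‖ ^ 2 : ℝ) / t) =
        Real.pi * t * Complex.exp (t * (b * conj a)) := by
  set p : ℝ → ℂ := fun x => Complex.exp (-(1 / t : ℂ) * x ^ 2 + (conj a + b) * x + 0)
  set q : ℝ → ℂ := fun x =>
    Complex.exp (-(1 / t : ℂ) * x ^ 2 + Complex.I * (conj a - b) * x + 0)
  have hre : (-(1 / t : ℂ)).re < 0 := by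
    have : (-(1 / t : ℂ)) = ((-(1 / t) : ℝ) : ℂ) := by push_cast; rfl
    rw [this, Complex.ofReal_re]
    have : 0 < 1 / t := by positivity
    linarith
  have hp : Integrable p := integrable_cexp_quadratic' hre _ _
  have hq : Integrable q := integrable_cexp_quadratic' hre _ _
  have hpq : (fun z : ℂ => Complex.exp (z * conj a + b * conj z - (‖z‖ ^ 2 : ℝ) / t)) =
      (fun y : ℝ × ℝ => p y.1 * q y.2) ∘ Complex.measurableEquivRealProd := by
    funext z
    simp only [Function.comp_apply, Complex.measurableEquivRealProd_apply, p, q,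
      ← Complex.exp_add]
    congr 1
    have h1 : ((‖z‖ ^ 2 : ℝ) : ℂ) = (z.re : ℂ) ^ 2 + (z.im : ℂ) ^ 2 := by
      rw [← Complex.normSq_eq_norm_sq, Complex.normSq_apply]; push_cast; ring
    have h2 : conj z = z.re - z.im * Complex.I := by
      apply Complex.ext <;> simp
    rw [h1, h2]
    conv_lhs => enter [1, 1, 1]; rw [← Complex.re_add_im z]
    ring
  have hmp := Complex.volume_preserving_equiv_real_prod
  constructor
  · rw [hpq]
    exact (hmp.integrable_comp_emb Complex.measurableEquivRealProd.measurableEmbedding).2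
      (hp.mul_prod hq)
  · rw [hpq]
    change ∫ z, (fun y : ℝ × ℝ => p y.1 * q y.2) (Complex.measurableEquivRealProd z) = _
    rw [hmp.integral_comp Complex.measurableEquivRealProd.measurableEmbedding
      (fun y : ℝ × ℝ => p y.1 * q y.2)]
    rw [Measure.volume_eq_prod, integral_prod_mul]
    rw [integral_cexp_quadratic hre, integral_cexp_quadratic hre]
    have ht' : (t : ℂ) ≠ 0 := by exact_mod_cast ht.ne'
    have h3 : (Real.pi / -(-(1 / t : ℂ))) = ((Real.pi * t : ℝ) : ℂ) := by
      push_cast; field_simp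
    have hpt : (0 : ℝ) < Real.pi * t := by positivity
    have h4 : (((Real.pi * t : ℝ) : ℂ) ^ (1 / 2 : ℂ)) * (((Real.pi * t : ℝ) : ℂ) ^ (1 / 2 : ℂ))
        = Real.pi * t := by
      rw [← Complex.cpow_add _ _ (by exact_mod_cast hpt.ne')]
      norm_num
    rw [h3, mul_mul_mul_comm, h4, ← Complex.exp_add]
    congr 2
    rw [mul_pow Complex.I, Complex.I_sq]
    field_simp
    ring

variable {n : ℕ}

/-- `∫ exp((w · ā + b · w̄) - |w|² / t) dw = (πt)ⁿ exp(t b · ā)` on `ℂⁿ`, with absolute convergence;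
the integrand factors over the coordinates. -/
theorem integrable_and_integral_cexp {t : ℝ} (ht : 0 < t) (a b : Fin n → ℂ) :
    Integrable (fun w : Fin n → ℂ => Complex.exp (dot w a + dot b w - (normSq w : ℂ) / t)) ∧
      ∫ w : Fin n → ℂ, Complex.exp (dot w a + dot b w - (normSq w : ℂ) / t) =
        ((Real.pi * t) ^ n : ℝ) * Complex.exp (t * dot b a) := by
  have h1 : (fun w : Fin n → ℂ => Complex.exp (dot w a + dot b w - (normSq w : ℂ) / t)) =
      fun w => ∏ j, Complex.exp (w j * conj (a j) + b j * conj (w j) - (‖w j‖ ^ 2 : ℝ) / t) := by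
    funext w
    rw [← Complex.exp_sum]
    congr 1
    simp only [dot, normSq, Finset.sum_sub_distrib, Finset.sum_add_distrib, Finset.sum_div,
      Complex.ofReal_sum]
  constructor
  · rw [h1]
    exact Integrable.fintype_prod_dep
      (f := fun (j : Fin n) (z : ℂ) =>
        Complex.exp (z * conj (a j) + b j * conj z - (‖z‖ ^ 2 : ℝ) / t))
      (fun j => (integrable_and_integral_cexp_complex ht (a j) (b j)).1)
  · rw [h1, integral_fintype_prod_volume_eq_prod
      (fun (j : Fin n) (z : ℂ) =>
        Complex.exp (z * conj (a j) + b j * conj z - (‖z‖ ^ 2 : ℝ) / t))]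
    simp only [fun j => (integrable_and_integral_cexp_complex ht (a j) (b j)).2]
    rw [Finset.prod_mul_distrib, ← Complex.exp_sum, Finset.prod_const, Finset.card_univ,
      Fintype.card_fin, dot, Finset.mul_sum]
    push_cast
    rfl

theorem integral_gauss {t : ℝ} (ht : 0 < t) :
    ∫ w : Fin n → ℂ, Real.exp (-(normSq w / t)) = (Real.pi * t) ^ n := by
  have h := (integrable_and_integral_cexp (n := n) ht 0 0).2
  simp only [dot_zero_left, dot_zero_right, mul_zero, Complex.exp_zero, mul_one, zero_add,
    zero_sub] at h
  have h2 : ∀ w : Fin n → ℂ, Complex.exp (-((normSq w : ℂ) / t)) =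
      ((Real.exp (-(normSq w / t)) : ℝ) : ℂ) := fun w => by push_cast; rfl
  simp only [h2] at h
  rw [integral_complex_ofReal] at h
  exact_mod_cast h

theorem measurePreserving_smul {c : ℂ} (hc : ‖c‖ = 1) :
    MeasurePreserving (fun u : Fin n → ℂ => c • u) volume volume := by
  refine volume_preserving_pi (f := fun (_ : Fin n) (z : ℂ) => c * z) fun _ => ?_
  have := (rotation ⟨c, by simp [Submonoid.unitSphere, hc]⟩).measurePreserving
  exact this

/-- The Gaussian mean value property of entire functions. Averaging over the rotations
`u ↦ exp(iθ) u`, which preserve the Gaussian, reduces it to the one on circles. -/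
theorem integral_mul_gauss_of_differentiable {t : ℝ} (ht : 0 < t) {g : (Fin n → ℂ) → ℂ}
    (hg : Differentiable ℂ g)
    (hi : Integrable fun u => g u * (Real.exp (-(normSq u / t)) : ℂ)) :
    ∫ u, g u * (Real.exp (-(normSq u / t)) : ℂ) = ((Real.pi * t) ^ n : ℝ) * g 0 := by
  set G : (Fin n → ℂ) → ℂ := fun u => g u * (Real.exp (-(normSq u / t)) : ℂ) with hG
  have hns := continuous_normSq (n := n)
  have hgc := hg.continuous
  have hGc : Continuous G := by simp only [hG]; fun_prop
  have hc1 : ∀ θ : ℝ, ‖circleMap 0 1 θ‖ = 1 := fun θ => by simp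
  have hmp := fun θ : ℝ => measurePreserving_smul (n := n) (hc1 θ)
  have hemb : ∀ θ : ℝ, MeasurableEmbedding (fun u : Fin n → ℂ => circleMap 0 1 θ • u) := fun θ =>
    (Homeomorph.smulOfNeZero (circleMap 0 1 θ)
      (norm_ne_zero_iff.1 (by rw [hc1]; exact one_ne_zero))).measurableEmbedding
  set μ : Measure ℝ := volume.restrict (Set.Ioc 0 (2 * Real.pi))
  have hint : ∀ θ : ℝ, ∫ u, G (circleMap 0 1 θ • u) = ∫ u, G u := fun θ =>
    (hmp θ).integral_comp (hemb θ) G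
  have hprod : Integrable (Function.uncurry fun (θ : ℝ) (u : Fin n → ℂ) =>
      G (circleMap 0 1 θ • u)) (μ.prod volume) := by
    rw [integrable_prod_iff]
    · refine ⟨Eventually.of_forall fun θ => ?_, ?_⟩
      · exact ((hmp θ).integrable_comp_emb (hemb θ)).2 hi
      · have : (fun θ : ℝ => ∫ u, ‖Function.uncurry (fun (θ : ℝ) (u : Fin n → ℂ) =>
            G (circleMap 0 1 θ • u)) (θ, u)‖) = fun _ => ∫ u, ‖G u‖ := by
          funext θ
          exact (hmp θ).integral_comp (hemb θ) (fun u => ‖G u‖)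
        rw [this]
        exact integrable_const _
    · have : Continuous (Function.uncurry fun (θ : ℝ) (u : Fin n → ℂ) =>
          G (circleMap 0 1 θ • u)) := by
        refine hGc.comp ?_
        exact ((continuous_circleMap 0 1).comp continuous_fst).smul continuous_snd
      exact this.aestronglyMeasurable
  have hswap := integral_integral_swap hprod
  simp only [hint] at hswap
  have hav : ∀ u : Fin n → ℂ, ∫ θ, G (circleMap 0 1 θ • u) ∂μ =
      (2 * Real.pi : ℝ) * (g 0 * (Real.exp (-(normSq u / t)) : ℂ)) := by
    intro u
    have h1 : Real.circleAverage (fun l : ℂ => g (l • u)) 0 1 = g 0 := by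
      have h2 : Differentiable ℂ (fun l : ℂ => g (l • u)) :=
        hg.comp (differentiable_id.smul_const u)
      have := h2.diffContOnCl (s := Metric.ball 0 |1|)
      simpa using DiffContOnCl.circleAverage this
    rw [Real.circleAverage_def, intervalIntegral.integral_of_le (by positivity)] at h1
    have h3 : ∀ θ : ℝ, G (circleMap 0 1 θ • u) =
        g (circleMap 0 1 θ • u) * (Real.exp (-(normSq u / t)) : ℂ) := fun θ => by
      simp only [hG, normSq_smul, hc1]; norm_num
    simp only [h3]
    rw [integral_mul_const, ← h1]
    have hpi : (2 * Real.pi : ℝ) ≠ 0 := by positivity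
    rw [Complex.real_smul]
    push_cast
    have : (2 * Real.pi : ℂ) ≠ 0 := by exact_mod_cast hpi
    field_simp
    rfl
  simp only [hav] at hswap
  rw [integral_const, integral_const_mul, integral_const_mul, integral_complex_ofReal,
    integral_gauss ht] at hswap
  have hμ : μ.real Set.univ = 2 * Real.pi := by
    simp [μ, Measure.real, Real.pi_pos.le]
  rw [hμ, Complex.real_smul] at hswap
  have hpi : ((2 * Real.pi : ℝ) : ℂ) ≠ 0 := by exact_mod_cast (by positivity : 2 * Real.pi ≠ 0)
  have := mul_left_cancel₀ hpi hswap
  rw [this, mul_comm]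

end Gaussian

/-! ### Weyl operators and kernels -/

section Weyl

variable {n : ℕ}

theorem nkernel_eq (t : ℝ) (z w : Fin n → ℂ) :
    nkernel t z w = Complex.exp ((dot w z - dot z z / 2) / t) := by
  rw [nkernel, kernel, Complex.ofReal_exp, ← Complex.exp_add, dot_self z]
  congr 1
  push_cast
  ring

theorem gauss_eq (t : ℝ) (w : Fin n → ℂ) :
    ((Real.exp (-(normSq w / t)) : ℝ) : ℂ) = Complex.exp (-dot w w / t) := by
  rw [Complex.ofReal_exp, dot_self w]
  congr 1
  push_cast
  ring

theorem norm_pairing_le {t : ℝ} (ht : 0 < t) (g h : (Fin n → ℂ) → ℂ) :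
    ‖pairing t g h‖ ≤
      ((Real.pi * t) ^ n)⁻¹ * ∫ w, ‖weighted t g w‖ * ‖weighted t h w‖ := by
  rw [pairing_eq, norm_mul, Complex.norm_real, Real.norm_of_nonneg (by positivity)]
  refine mul_le_mul_of_nonneg_left ?_ (by positivity)
  refine (norm_integral_le_integral_norm _).trans (le_of_eq ?_)
  simp

/-- `P_t` commutes with the Weyl operators. -/
theorem proj_weylFun (t : ℝ) (z : Fin n → ℂ) (h : (Fin n → ℂ) → ℂ) :
    proj t (weylFun t z h) = weylFun t z (proj t h) := by
  funext v
  simp only [proj, pairing, weylFun]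
  rw [mul_left_comm]
  congr 1
  rw [← integral_const_mul]
  symm
  rw [← integral_sub_right_eq_self _ z]
  refine integral_congr_ae (Eventually.of_forall fun u => ?_)
  obtain ⟨u, rfl⟩ : ∃ u', u = u' + z := ⟨u - z, by simp⟩
  simp only [add_sub_cancel_right]
  have h1 : nkernel t z (u + z) * conj (kernel t v (u + z)) *
        (Real.exp (-(normSq (u + z) / t)) : ℂ) =
      nkernel t z v * conj (kernel t (v - z) u) * (Real.exp (-(normSq u / t)) : ℂ) := by
    rw [conj_kernel, conj_kernel, nkernel_eq, nkernel_eq, gauss_eq, gauss_eq, kernel, kernel]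
    simp only [← Complex.exp_add]
    congr 1
    rw [sub_eq_add_neg v z]
    simp only [dot_add_left, dot_add_right, dot_neg_left]
    ring
  linear_combination -(h u) * h1

theorem weylFun_neg_apply_zero (t : ℝ) (w : Fin n → ℂ) (g : (Fin n → ℂ) → ℂ) :
    weylFun t (-w) g 0 = weighted t g w := by
  simp only [weylFun, nkernel, kernel, dot_zero_left, weighted, normSq_neg]
  simp [mul_comm]

theorem weylVec_apply {t : ℝ} {X : Kind} (z : Fin n → ℂ) (g : Space n t X) (w : Fin n → ℂ) :
    weylVec z g w = weylFun t z g w := rfl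

variable {t : ℝ} [ht : Fact (0 < t)] {X : Kind}

theorem kernelVec_apply (z w : Fin n → ℂ) : kernelVec t X z w = kernel t z w := rfl

theorem monomialVec_apply (α : Fin n → ℕ) (w : Fin n → ℂ) :
    monomialVec t X α w = monomial t α w := rfl

/-- `W_z K_w` is a multiple of `K_{w + z}`. -/
theorem weylVec_kernelVec (z w : Fin n → ℂ) :
    weylVec z (kernelVec t X w) =
      Complex.exp (-(dot z w + dot z z / 2) / t) • kernelVec t X (w + z) := by
  refine Space.ext (funext fun u => ?_)
  rw [weylVec_apply, Space.coe_smul, Pi.smul_apply, smul_eq_mul]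
  simp only [weylFun, kernelVec_apply]
  rw [nkernel_eq, kernel, kernel, ← Complex.exp_add, ← Complex.exp_add, sub_eq_add_neg u z]
  congr 1
  simp only [dot_add_left, dot_add_right, dot_neg_left]
  ring

theorem norm_kernelVec (w : Fin n → ℂ) :
    ‖kernelVec t X w‖ = Real.exp (normSq w / (2 * t)) * ‖kernelVec t X (0 : Fin n → ℂ)‖ := by
  have h := congrArg norm (weylVec_kernelVec (t := t) (X := X) w 0)
  rw [norm_weylVec, norm_smul, zero_add, dot_zero_right, zero_add, Complex.norm_exp, dot_self] at h
  rw [h, ← mul_assoc, ← Real.exp_add]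
  have : normSq w / (2 * t) + (-((normSq w : ℂ) / 2) / (t : ℂ)).re = 0 := by
    have h2 : (-((normSq w : ℂ) / 2) / (t : ℂ)) = ((-(normSq w / 2) / t : ℝ) : ℂ) := by
      push_cast; rfl
    rw [h2, Complex.ofReal_re]
    field_simp
    ring
  rw [this, Real.exp_zero, one_mul]

theorem kernelVec_ne_zero (w : Fin n → ℂ) : kernelVec t X w ≠ 0 := by
  intro h
  have : kernel t w w = 0 := congrArg (fun g : Space n t X => g w) h
  exact Complex.exp_ne_zero _ this

end Weyl

/-! ### Point evaluations and the reproducing property -/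

section Reproducing

variable {n : ℕ}

theorem MemL.memLp_volume {t : ℝ} (ht : 0 < t) {p : ℝ≥0∞} (hp : 1 ≤ p) {h : (Fin n → ℂ) → ℂ}
    (hh : MemL t p h) : MemLp (weighted t h) p volume := by
  have h1 : (normConst n t p)⁻¹ ≠ ∞ := ENNReal.inv_ne_top.2 (normConst_ne_zero ht hp)
  have h2 : (volume : Measure (Fin n → ℂ)) = (normConst n t p)⁻¹ • scaledVolume n t p := by
    rw [scaledVolume, smul_smul, ENNReal.inv_mul_cancel (normConst_ne_zero ht hp)
      normConst_ne_top, one_smul]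
  rw [h2]
  exact hh.smul_measure h1

/-- Elements of `L_t^p` are integrable against functions of exponential growth. -/
theorem MemL.integrable_mul {t : ℝ} (ht : 0 < t) {p : ℝ≥0∞} (hp : 1 ≤ p)
    {h k : (Fin n → ℂ) → ℂ} (hh : MemL t p h) (hk : Continuous k)
    (hb : ∃ a C : ℝ, ∀ w, ‖k w‖ ≤ C * Real.exp (a * ∑ j, ‖w j‖)) :
    Integrable fun w => h w * k w * (Real.exp (-(normSq w / t)) : ℂ) := by
  obtain ⟨a, C, hb⟩ := hb
  have hq : 1 ≤ ENNReal.conjExponent p := by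
    unfold ENNReal.conjExponent; exact le_self_add
  have : ENNReal.HolderConjugate p (ENNReal.conjExponent p) := .conjExponent hp
  have hi := MemLp.integrable_mul (hh.memLp_volume ht hp) (memLp_weighted ht hk hb hq)
  refine hi.congr (Eventually.of_forall fun w => ?_)
  simp only [Pi.mul_apply, weighted, exp_neg_normSq t w]
  push_cast
  ring

theorem conj_kernel_growth {t : ℝ} (ht : 0 < t) (z : Fin n → ℂ) :
    ∃ a C : ℝ, ∀ w, ‖conj (kernel t z w)‖ ≤ C * Real.exp (a * ∑ j, ‖w j‖) := by
  simpa only [Complex.norm_conj] using kernel_growth ht z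

theorem continuous_conj_kernel (t : ℝ) (z : Fin n → ℂ) :
    Continuous fun w => conj (kernel t z w) :=
  Complex.continuous_conj.comp (kernel_differentiable t z).continuous

/-- The integral defining `P_t h (z)` converges absolutely for `h ∈ L_t^p`. -/
theorem MemL.integrable_proj {t : ℝ} (ht : 0 < t) {p : ℝ≥0∞} (hp : 1 ≤ p)
    {h : (Fin n → ℂ) → ℂ} (hh : MemL t p h) (z : Fin n → ℂ) :
    Integrable fun w => h w * conj (kernel t z w) * (Real.exp (-(normSq w / t)) : ℂ) :=
  hh.integrable_mul ht hp (continuous_conj_kernel t z) (conj_kernel_growth ht z)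

variable {t : ℝ} [ht : Fact (0 < t)] {X : Kind}

/-- The reproducing property. At `0` it is the Gaussian mean value property; the Weyl operators,
which commute with `P_t`, carry it to the other points. -/
theorem Space.proj_eq (g : Space n t X) : proj t g = g := by
  have h0 : ∀ h : Space n t X, proj t h 0 = h 0 := fun h => by
    have hi := h.memL.integrable_proj ht.out X.one_le_exponent 0
    simp only [kernel_zero_left, map_one, mul_one] at hi
    rw [proj, pairing]
    simp only [kernel_zero_left, map_one, mul_one]
    rw [integral_mul_gauss_of_differentiable ht.out h.differentiable hi, ← mul_assoc,
      ← Complex.ofReal_mul, inv_mul_cancel₀, Complex.ofReal_one, one_mul]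
    have := ht.out
    positivity
  funext w
  have h1 := h0 (weylVec (-w) g)
  have h2 : proj t (weylVec (-w) g) = weylFun t (-w) (proj t g) := proj_weylFun t (-w) g
  rw [h2, weylVec_apply, weylFun_neg_apply_zero, weylFun_neg_apply_zero, weighted, weighted] at h1
  exact mul_right_cancel₀ (by exact_mod_cast (Real.exp_pos _).ne') h1

/-- Point evaluations on the Fock spaces are bounded, with the optimal growth in the point. It
suffices to bound the evaluation at `0` and to move it by Weyl operators. -/
theorem exists_norm_weighted_le (n : ℕ) (t : ℝ) [ht : Fact (0 < t)] (X : Kind) :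
    ∃ C : ℝ, 0 < C ∧ ∀ (g : Space n t X) (w : Fin n → ℂ), ‖weighted t g w‖ ≤ C * ‖g‖ := by
  obtain ⟨C, hC⟩ := pairing_bound ht.out X (h := kernel t (0 : Fin n → ℂ)) fun p hp => by
    obtain ⟨a, C, hb⟩ := kernel_growth (n := n) ht.out 0
    exact memLp_weighted ht.out (kernel_differentiable t 0).continuous hb hp
  refine ⟨max C 1, lt_of_lt_of_le one_pos (le_max_right _ _), fun g w => ?_⟩
  rw [← weylFun_neg_apply_zero, ← weylVec_apply, ← norm_weylVec (-w) g, ← Space.proj_eq]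
  exact ((hC _).2).trans (mul_le_mul_of_nonneg_right (le_max_left _ _) (norm_nonneg _))

theorem norm_apply_le_of_weighted {t : ℝ} {g : (Fin n → ℂ) → ℂ} {w : Fin n → ℂ} {C : ℝ}
    (h : ‖weighted t g w‖ ≤ C) : ‖g w‖ ≤ C * Real.exp (normSq w / (2 * t)) := by
  rw [norm_weighted, Real.exp_neg, ← div_eq_mul_inv, div_le_iff₀ (Real.exp_pos _)] at h
  exact h

/-- Evaluation at a point, as a bounded functional. -/
def evalCLM (t : ℝ) [Fact (0 < t)] (X : Kind) (w : Fin n → ℂ) : StrongDual ℂ (Space n t X) :=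
  LinearMap.mkContinuousOfExistsBound
    { toFun := fun g => g w
      map_add' := fun _ _ => rfl
      map_smul' := fun _ _ => rfl }
    (by
      obtain ⟨C, -, hC⟩ := exists_norm_weighted_le n t X
      refine ⟨C * Real.exp (normSq w / (2 * t)), fun g => ?_⟩
      refine (norm_apply_le_of_weighted (hC g w)).trans (le_of_eq ?_)
      ring)

theorem evalCLM_apply (w : Fin n → ℂ) (g : Space n t X) : evalCLM t X w g = g w := rfl

/-- Entire functions in `L_t^p` as elements of `F_t^p`. -/
def Space.ofMemL {t : ℝ} (p : ℝ≥0∞) (hp : 1 ≤ p) (g : (Fin n → ℂ) → ℂ) (hd : Differentiable ℂ g)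
    (hg : MemL t p g) : Space n t (.lp p hp) :=
  (⟨g, hd, hg, fun h => by cases h⟩ : ↥(submodule n t (.lp p hp)))

theorem exp_sum_norm_growth (a : ℝ) : ∃ b C : ℝ, ∀ w : Fin n → ℂ,
    ‖((Real.exp (a * ∑ j, ‖w j‖) : ℝ) : ℂ)‖ ≤ C * Real.exp (b * ∑ j, ‖w j‖) :=
  ⟨a, 1, fun w => by rw [Complex.norm_real, Real.norm_of_nonneg (Real.exp_pos _).le, one_mul]⟩

/-- `P_t h` is entire for `h ∈ L_t^p`, by differentiation under the integral. On the unit ball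
around `z₀` the derivative of the integrand is dominated by `|h(u)|` times the Gaussian and
`exp((‖z₀‖ + 2) / t ∑ |uⱼ|)`; one of the two extra units absorbs the factor `∑ |uⱼ| / t` which
comes from differentiating the kernel. -/
theorem MemL.differentiable_proj {t : ℝ} (ht : 0 < t) {p : ℝ≥0∞} (hp : 1 ≤ p)
    {h : (Fin n → ℂ) → ℂ} (hh : MemL t p h) : Differentiable ℂ (proj t h) := by
  intro z₀
  have hns := continuous_normSq (n := n)
  -- the functional `z ↦ z · ū`
  let L : (Fin n → ℂ) → (Fin n → ℂ) →L[ℂ] ℂ := fun u =>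
    ∑ j, conj (u j) • (ContinuousLinearMap.proj j : (Fin n → ℂ) →L[ℂ] ℂ)
  have hL : ∀ u z, L u z = dot z u := fun u z => by
    simp [L, dot, mul_comm]
  have hLn : ∀ u, ‖L u‖ ≤ ∑ j, ‖u j‖ := fun u => by
    refine ContinuousLinearMap.opNorm_le_bound _ (Finset.sum_nonneg fun j _ => norm_nonneg _)
      fun z => ?_
    rw [hL, ← conj_dot, Complex.norm_conj, mul_comm]
    exact norm_dot_le u z
  have hLc : Continuous L := by fun_prop
  set γ : (Fin n → ℂ) → ℂ := fun u => (Real.exp (-(normSq u / t)) : ℂ)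
  have hγ : Continuous γ := by fun_prop
  have hhm : AEStronglyMeasurable (fun u => h u * γ u) volume := by
    have := hh.integrable_proj ht hp 0
    simp only [kernel_zero_left, map_one, mul_one] at this
    exact this.1
  let F' : (Fin n → ℂ) → (Fin n → ℂ) → (Fin n → ℂ) →L[ℂ] ℂ := fun z u =>
    (h u * γ u * (kernel t u z / t)) • L u
  have key : HasFDerivAt (fun z => ∫ u, h u * γ u * kernel t u z) (∫ u, F' z₀ u) z₀ := by
    have hbi := (hh.integrable_mul ht hp
      (k := fun u => ((Real.exp ((‖z₀‖ + 2) / t * ∑ j, ‖u j‖) : ℝ) : ℂ))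
      (by fun_prop) (exp_sum_norm_growth _)).norm
    refine hasFDerivAt_integral_of_dominated_of_fderiv_le (Metric.ball_mem_nhds z₀ one_pos)
      (F := fun z u => h u * γ u * kernel t u z) (F' := F') (bound := fun u => _) ?_ ?_ ?_ ?_ hbi ?_
    · refine Eventually.of_forall fun z => hhm.mul ?_
      simp only [← conj_kernel t z]
      exact (continuous_conj_kernel t z).aestronglyMeasurable
    · refine (hh.integrable_proj ht hp z₀).congr (Eventually.of_forall fun u => ?_)
      simp only [conj_kernel, γ]; ring
    · refine (hhm.mul ?_).smul hLc.aestronglyMeasurable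
      simp only [← conj_kernel t z₀]
      exact ((continuous_conj_kernel t z₀).div_const _).aestronglyMeasurable
    · refine Eventually.of_forall fun u z hz => ?_
      have hz1 : ‖z‖ ≤ ‖z₀‖ + 1 := by
        have := norm_le_norm_add_norm_sub' z z₀
        rw [Metric.mem_ball, dist_eq_norm] at hz
        linarith
      set S := ∑ j, ‖u j‖ with hS
      have hS0 : 0 ≤ S := Finset.sum_nonneg fun j _ => norm_nonneg _
      have hk : ‖kernel t u z‖ ≤ Real.exp ((‖z₀‖ + 1) / t * S) := by
        rw [norm_kernel, div_mul_eq_mul_div]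
        refine Real.exp_le_exp.2 (div_le_div_of_nonneg_right ?_ ht.le)
        rw [dot_re_comm]
        exact ((Complex.re_le_norm _).trans (norm_dot_le u z)).trans
          (mul_le_mul_of_nonneg_right hz1 hS0)
      have hSe : S / t ≤ Real.exp (S / t) := (by linarith : S / t ≤ S / t + 1).trans
        (Real.add_one_le_exp _)
      have hexp : Real.exp ((‖z₀‖ + 2) / t * S) =
          Real.exp ((‖z₀‖ + 1) / t * S) * Real.exp (S / t) := by
        rw [← Real.exp_add]; congr 1; ring
      simp only [F', norm_smul, norm_mul, norm_div, Complex.norm_real,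
        Real.norm_of_nonneg ht.le]
      rw [Real.norm_of_nonneg (Real.exp_pos ((‖z₀‖ + 2) / t * S)).le, hexp]
      calc ‖h u‖ * ‖γ u‖ * (‖kernel t u z‖ / t) * ‖L u‖
          ≤ ‖h u‖ * ‖γ u‖ * (‖kernel t u z‖ / t) * S :=
            mul_le_mul_of_nonneg_left (hLn u) (by positivity)
        _ = ‖h u‖ * ‖γ u‖ * (‖kernel t u z‖ * (S / t)) := by ring
        _ ≤ ‖h u‖ * ‖γ u‖ * (Real.exp ((‖z₀‖ + 1) / t * S) * Real.exp (S / t)) := by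
            gcongr
        _ = _ := by simp only [γ, Complex.norm_real]; ring
    · refine Eventually.of_forall fun u z _ => ?_
      have h1 : HasFDerivAt (fun z => dot z u / t) ((t : ℂ)⁻¹ • L u) z := by
        have := ((L u).hasFDerivAt (x := z)).const_smul (t : ℂ)⁻¹
        refine this.congr_of_eventuallyEq (Eventually.of_forall fun y => ?_)
        simp [hL, div_eq_inv_mul]
      have h2 := (h1.cexp).const_mul (h u * γ u)
      refine h2.congr_fderiv ?_
      simp only [F', smul_smul, kernel]
      congr 1
  have : proj t h = fun z => (((Real.pi * t) ^ n)⁻¹ : ℝ) * ∫ u, h u * γ u * kernel t u z := by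
    funext z
    rw [proj, pairing]
    congr 1
    refine integral_congr_ae (Eventually.of_forall fun u => ?_)
    simp only [conj_kernel, γ]; ring
  rw [this]
  exact key.differentiableAt.const_mul _

end Reproducing

/-! ### Translated symbols -/

section Shift

variable {n : ℕ}

theorem MemL.weylFun {t : ℝ} {p : ℝ≥0∞} {g : (Fin n → ℂ) → ℂ} (hg : MemL t p g)
    (z : Fin n → ℂ) : MemL t p (weylFun t z g) := by
  have hc := hg.comp_measurePreserving (measurePreserving_sub t p z)
  refine MemLp.of_le hc ?_ (Eventually.of_forall fun w => (norm_weighted_weylFun t z g w).le)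
  have hns := continuous_normSq (n := n)
  have hk := (kernel_differentiable t z).continuous
  have h1 : weighted t (Fock.weylFun t z g) = fun w =>
      (nkernel t z w * (Real.exp (-(normSq w / (2 * t))) : ℂ) *
        (Real.exp (normSq (w - z) / (2 * t)) : ℂ)) * (weighted t g ∘ fun w => w - z) w := by
    funext w
    have : (Real.exp (normSq (w - z) / (2 * t)) : ℂ) *
        (Real.exp (-(normSq (w - z) / (2 * t))) : ℂ) = 1 := by
      rw [← Complex.ofReal_mul, ← Real.exp_add, add_neg_cancel, Real.exp_zero, Complex.ofReal_one]
    simp only [weighted, Fock.weylFun, Function.comp_apply]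
    linear_combination (-nkernel t z w * g (w - z) *
      (Real.exp (-(normSq w / (2 * t))) : ℂ)) * this
  rw [h1]
  refine AEStronglyMeasurable.mul ?_ hc.1
  refine Continuous.aestronglyMeasurable ?_
  unfold nkernel
  fun_prop

theorem MemL.const_smul {t : ℝ} {p : ℝ≥0∞} {g : (Fin n → ℂ) → ℂ} (hg : MemL t p g) (c : ℂ) :
    MemL t p (c • g) := by
  unfold MemL; rw [weighted_smul]; exact MemLp.const_smul hg c

theorem proj_smul (t : ℝ) (c : ℂ) (h : (Fin n → ℂ) → ℂ) : proj t (c • h) = c • proj t h := by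
  funext z
  simp only [proj, pairing, Pi.smul_apply, smul_eq_mul, mul_assoc, integral_const_mul]
  ring

/-- Multiplication by `f(· + z)` is conjugate under `W_z` to multiplication by `f`; the scalar comes
from `W_z K_w`. -/
theorem shift_mul_kernel (t : ℝ) (f : (Fin n → ℂ) → ℂ) (z w : Fin n → ℂ) :
    (fun u => f (u + z) * kernel t w u) = Complex.exp (-(dot z w + dot z z / 2) / t) •
      weylFun t (-z) (fun u => f u * kernel t (w + z) u) := by
  funext u
  simp only [Pi.smul_apply, smul_eq_mul, weylFun, sub_neg_eq_add]
  have h : kernel t w u = Complex.exp (-(dot z w + dot z z / 2) / t) *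
      (nkernel t (-z) u * kernel t (w + z) (u + z)) := by
    rw [nkernel_eq, kernel, kernel, ← Complex.exp_add, ← Complex.exp_add]
    congr 1
    simp only [dot_add_left, dot_add_right, dot_neg_left, dot_neg_right]
    ring
  rw [h]; ring

theorem Admissible.shift {t : ℝ} {f : (Fin n → ℂ) → ℂ} (hf : Admissible t f) (z : Fin n → ℂ) :
    Admissible t fun u => f (u + z) := fun w => by
  rw [shift_mul_kernel]
  exact ((hf (w + z)).weylFun (-z)).const_smul _

theorem Admissible.memL {t : ℝ} {f : (Fin n → ℂ) → ℂ} (hf : Admissible t f) : MemL t 2 f := by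
  simpa only [kernel_zero_left, mul_one] using hf 0

/-- Translating the symbol conjugates the Toeplitz operator with Weyl operators. -/
theorem toeplitz_shift_kernel (t : ℝ) (f : (Fin n → ℂ) → ℂ) (z w : Fin n → ℂ) :
    toeplitz t (fun u => f (u + z)) (kernel t w) =
      Complex.exp (-(dot z w + dot z z / 2) / t) •
        weylFun t (-z) (toeplitz t f (kernel t (w + z))) := by
  rw [toeplitz, shift_mul_kernel, proj_smul, proj_weylFun, toeplitz]

variable {t : ℝ} [ht : Fact (0 < t)] {X : Kind}

theorem eNormL_toeplitz_le {f : (Fin n → ℂ) → ℂ} {D : Submodule ℂ (Space n t X)}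
    {g : Space n t X} (hg : g ∈ D) (hg0 : g ≠ 0) :
    eNormL t X.exponent (toeplitz t f g) ≤ toeplitzNorm f D * ENNReal.ofReal ‖g‖ := by
  rw [← ENNReal.div_le_iff (by simpa using hg0) ENNReal.ofReal_ne_top]
  exact le_iSup₂ (f := fun (g : Space n t X) (_ : g ∈ D) =>
    eNormL t X.exponent (toeplitz t f g) / ENNReal.ofReal ‖g‖) g hg

theorem eNormL_toeplitz_kernel_le {f : (Fin n → ℂ) → ℂ} {D : Submodule ℂ (Space n t X)}
    {z : Fin n → ℂ} (hz : kernelVec t X z ∈ D) :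
    eNormL t X.exponent (toeplitz t f (kernel t z)) ≤
      toeplitzNorm f D * ENNReal.ofReal ‖kernelVec t X z‖ := by
  have h := eNormL_toeplitz_le (f := f) hz (kernelVec_ne_zero z)
  have hc : (kernelVec t X z : (Fin n → ℂ) → ℂ) = kernel t z := rfl
  rwa [hc] at h

theorem exists_norm_weighted_le_eNormL (n : ℕ) (t : ℝ) [Fact (0 < t)] {p : ℝ≥0∞} (hp : 1 ≤ p) :
    ∃ C : ℝ, 0 < C ∧ ∀ g : (Fin n → ℂ) → ℂ, Differentiable ℂ g → MemL t p g →
      ∀ w, ‖weighted t g w‖ ≤ C * (eNormL t p g).toReal := by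
  obtain ⟨C, hC0, hC⟩ := exists_norm_weighted_le n t (.lp p hp)
  exact ⟨C, hC0, fun g hd hm w => hC (Space.ofMemL p hp g hd hm) w⟩

/-- The functions `T_f K_w` are controlled by the norm of `T_f`, uniformly over all translates of
the symbol. -/
theorem exists_norm_weighted_toeplitz_le (n : ℕ) (t : ℝ) [ht : Fact (0 < t)] (X : Kind) :
    ∃ C : ℝ, 0 < C ∧ ∀ (f : (Fin n → ℂ) → ℂ), Admissible t f →
      ∀ D : Submodule ℂ (Space n t X), (∀ z, kernelVec t X z ∈ D) → toeplitzNorm f D ≠ ∞ →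
        ∀ z w v, ‖toeplitz t (fun u => f (u + z)) (kernel t w) v‖ ≤
          C * (toeplitzNorm f D).toReal *
            Real.exp (normSq w / (2 * t) + normSq v / (2 * t)) := by
  obtain ⟨C, hC0, hC⟩ := exists_norm_weighted_le_eNormL n t X.one_le_exponent
  have hK0 : 0 < ‖kernelVec t X (0 : Fin n → ℂ)‖ := norm_pos_iff.2 (kernelVec_ne_zero 0)
  refine ⟨C * ‖kernelVec t X (0 : Fin n → ℂ)‖, by positivity, fun f hf D hD hM z w v => ?_⟩
  set M := toeplitzNorm f D
  set g := toeplitz t f (kernel t (w + z)) with hgdef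
  have hle : eNormL t X.exponent g ≤ M * ENNReal.ofReal ‖kernelVec t X (w + z)‖ :=
    eNormL_toeplitz_kernel_le (hD (w + z))
  have htop : M * ENNReal.ofReal ‖kernelVec t X (w + z)‖ ≠ ∞ :=
    ENNReal.mul_ne_top hM ENNReal.ofReal_ne_top
  have hd : Differentiable ℂ g := (hf (w + z)).differentiable_proj ht.out one_le_two
  have hm : MemL t X.exponent g :=
    ⟨(continuous_weighted t hd.continuous).aestronglyMeasurable, hle.trans_lt htop.lt_top⟩
  have hGn : (eNormL t X.exponent g).toReal ≤ M.toReal * ‖kernelVec t X (w + z)‖ := by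
    refine (ENNReal.toReal_mono htop hle).trans (le_of_eq ?_)
    rw [ENNReal.toReal_mul, ENNReal.toReal_ofReal (norm_nonneg _)]
  set c := Complex.exp (-(dot z w + dot z z / 2) / t) with hc
  have hcn : ‖c‖ * ‖kernelVec t X (w + z)‖ =
      Real.exp (normSq w / (2 * t)) * ‖kernelVec t X (0 : Fin n → ℂ)‖ := by
    rw [← norm_kernelVec, ← norm_weylVec z (kernelVec t X w), weylVec_kernelVec, norm_smul]
  have hb : ‖weighted t (toeplitz t (fun u => f (u + z)) (kernel t w)) v‖ ≤
      C * ‖kernelVec t X (0 : Fin n → ℂ)‖ * M.toReal * Real.exp (normSq w / (2 * t)) := by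
    rw [toeplitz_shift_kernel, weighted_smul, Pi.smul_apply, norm_smul, norm_weighted_weylFun]
    calc ‖c‖ * ‖weighted t g (v - -z)‖ ≤ ‖c‖ * (C * (M.toReal * ‖kernelVec t X (w + z)‖)) := by
          refine mul_le_mul_of_nonneg_left ?_ (norm_nonneg _)
          exact (hC g hd hm _).trans (mul_le_mul_of_nonneg_left hGn hC0.le)
      _ = C * M.toReal * (‖c‖ * ‖kernelVec t X (w + z)‖) := by ring
      _ = _ := by rw [hcn]; ring
  refine (norm_apply_le_of_weighted hb).trans (le_of_eq ?_)
  rw [Real.exp_add]; ring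

end Shift

/-! ### The Berezin transform as a Gaussian integral of `T_f K_w` -/

section Berezin

variable {n : ℕ}

/-- `|k_z^s|² dμ_s` is the translate by `z` of the Gaussian measure. -/
theorem nkernel_mul_conj_mul_gauss (s : ℝ) (z w : Fin n → ℂ) :
    nkernel s z w * conj (nkernel s z w) * (Real.exp (-(normSq w / s)) : ℂ) =
      (Real.exp (-(normSq (w - z) / s)) : ℂ) := by
  rw [nkernel_eq, gauss_eq, gauss_eq, ← Complex.exp_conj, ← Complex.exp_add, ← Complex.exp_add]
  congr 1
  simp only [map_div₀, map_sub, conj_dot, Complex.conj_ofReal, map_ofNat, sub_eq_add_neg w z,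
    dot_add_left, dot_add_right, dot_neg_left, dot_neg_right]
  ring

theorem berezin_eq (s : ℝ) (f : (Fin n → ℂ) → ℂ) (z : Fin n → ℂ) :
    berezin s f z = (((Real.pi * s) ^ n)⁻¹ : ℝ) *
      ∫ u, f (u + z) * (Real.exp (-(normSq u / s)) : ℂ) := by
  rw [berezin, pairing]
  congr 1
  symm
  rw [← integral_sub_right_eq_self _ z]
  congr 1
  funext w
  rw [← nkernel_mul_conj_mul_gauss, sub_add_cancel]
  ring

/-- For `s < 2t` the function `exp(-|u|² / s + |u|² / (2t))` is square integrable, so that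
`L_t^2` functions are integrable with respect to `μ_s`. -/
theorem MemL.integrable_mul_gauss {t s : ℝ} (ht : 0 < t) (hs : 0 < s) (hst : s < 2 * t)
    {f : (Fin n → ℂ) → ℂ} (hf : MemL t 2 f) :
    Integrable fun u => f u * (Real.exp (-(normSq u / s)) : ℂ) := by
  have hb : 0 < 1 / s - 1 / (2 * t) := sub_pos.2 (one_div_lt_one_div_of_lt hs hst)
  have h1 : MemLp (fun u : Fin n → ℂ =>
      ((Real.exp (-(1 / s - 1 / (2 * t)) * normSq u) : ℝ) : ℂ)) 2 volume :=
    (memLp_gauss (n := n) hb one_le_two).ofReal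
  refine (MemLp.integrable_mul (hf.memLp_volume ht one_le_two) h1).congr
    (Eventually.of_forall fun u => ?_)
  simp only [Pi.mul_apply, weighted]
  rw [mul_assoc]
  congr 1
  rw [← Complex.ofReal_mul, ← Real.exp_add]
  congr 2
  field_simp
  ring

theorem Admissible.integrable_berezin {t s : ℝ} (ht : 0 < t) (hs : 0 < s) (hst : s < 2 * t)
    {f : (Fin n → ℂ) → ℂ} (hf : Admissible t f) (z : Fin n → ℂ) :
    Integrable fun w => f w * nkernel s z w * conj (nkernel s z w) *
      (Real.exp (-(normSq w / s)) : ℂ) := by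
  have h := ((hf.shift z).memL.integrable_mul_gauss ht hs hst).comp_sub_right z
  refine h.congr (Eventually.of_forall fun w => ?_)
  simp only [sub_add_cancel, ← nkernel_mul_conj_mul_gauss]
  ring

theorem integral_kernel_mul_conj_kernel {t : ℝ} (ht : 0 < t) (a b : ℝ) (u : Fin n → ℂ) :
    ∫ ζ : Fin n → ℂ, kernel t ((a : ℂ) • ζ) u * conj (kernel t ((b : ℂ) • ζ) u) *
        (Real.exp (-(normSq ζ / t)) : ℂ) =
      ((Real.pi * t) ^ n : ℝ) * (Real.exp (a * b * normSq u / t) : ℂ) := by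
  have h := (integrable_and_integral_cexp ht ((b / t : ℂ) • u) ((a / t : ℂ) • u)).2
  have ht' : (t : ℂ) ≠ 0 := by exact_mod_cast ht.ne'
  convert h using 1
  · congr 1
    funext ζ
    rw [gauss_eq, conj_kernel, kernel, kernel, ← Complex.exp_add, ← Complex.exp_add, ← dot_self]
    congr 1
    simp only [dot_smul_left, dot_smul_right, map_div₀, Complex.conj_ofReal]
    ring
  · rw [Complex.ofReal_exp]
    congr 2
    simp only [dot_smul_left, dot_smul_right, map_div₀, Complex.conj_ofReal, dot_self]
    push_cast
    field_simp

/-- Completing the square: `c Re(u · ζ̄) ≤ κ |u|² + c² / (4κ) |ζ|²`. -/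
theorem mul_re_dot_le {κ : ℝ} (hκ : 0 < κ) (c : ℝ) (u ζ : Fin n → ℂ) :
    c * (dot u ζ).re ≤ κ * normSq u + c ^ 2 / (4 * κ) * normSq ζ := by
  have h := normSq_nonneg (((2 * κ : ℝ) : ℂ) • u + ((-c : ℝ) : ℂ) • ζ)
  rw [normSq_add, normSq_smul, normSq_smul, dot_smul_left, dot_smul_right, Complex.conj_ofReal,
    Complex.re_ofReal_mul, Complex.re_ofReal_mul, Complex.norm_real, Complex.norm_real,
    Real.norm_eq_abs, Real.norm_eq_abs, sq_abs, sq_abs] at h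
  have h2 : κ * normSq u + c ^ 2 / (4 * κ) * normSq ζ - c * (dot u ζ).re =
      ((2 * κ) ^ 2 * normSq u + (-c) ^ 2 * normSq ζ + 2 * (2 * κ * (-c * (dot u ζ).re))) /
        (4 * κ) := by
    field_simp
    ring
  have h3 : 0 ≤ ((2 * κ) ^ 2 * normSq u + (-c) ^ 2 * normSq ζ +
      2 * (2 * κ * (-c * (dot u ζ).re))) / (4 * κ) := by positivity
  linarith

/-- Absolute convergence of the double integral behind the key identity. The kernels contribute
`exp((a + b) Re(u · ζ̄) / t)`, which is split by completing the square. -/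
theorem integrable_toeplitz_kernel_prod {t : ℝ} (ht : 0 < t) {a b : ℝ} (hab : (a + b) ^ 2 < 2)
    {f : (Fin n → ℂ) → ℂ} (hf : MemL t 2 f) :
    Integrable (Function.uncurry fun (ζ u : Fin n → ℂ) =>
      f u * (Real.exp (-(normSq u / t)) : ℂ) *
        (kernel t ((a : ℂ) • ζ) u * conj (kernel t ((b : ℂ) • ζ) u) *
          (Real.exp (-(normSq ζ / t)) : ℂ))) (volume.prod volume) := by
  have hns := continuous_normSq (n := n)
  -- `κ` is the midpoint of `(a + b)² / 4` and `1 / 2`: the weight `κ < 1 / 2` on `|u|²` is what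
  -- `f ∈ L_t^2` can absorb, and `(a + b)² / (4κ) < 1` leaves decay in `ζ`
  set κ : ℝ := (a + b) ^ 2 / 8 + 1 / 4 with hκdef
  have hκ : 0 < κ := by positivity
  have hκ2 : 0 < (1 / 2 - κ) / t := div_pos (by rw [hκdef]; linarith) ht
  have hκ3 : 0 < (1 - (a + b) ^ 2 / (4 * κ)) / t := by
    refine div_pos ?_ ht
    rw [sub_pos, div_lt_one (by positivity), hκdef]
    linarith
  have hfv := hf.memLp_volume ht one_le_two
  have hi1 : Integrable (fun u : Fin n → ℂ =>
      ‖weighted t f u‖ * Real.exp (-((1 / 2 - κ) / t) * normSq u)) :=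
    MemLp.integrable_mul hfv.norm (memLp_gauss hκ2 one_le_two)
  have hi := (integrable_gauss (n := n) hκ3).mul_prod hi1
  refine hi.mono' ?_ (Eventually.of_forall ?_)
  · have hm : AEStronglyMeasurable (fun u => f u * (Real.exp (-(normSq u / t)) : ℂ)) volume := by
      have := hf.integrable_proj ht one_le_two 0
      simp only [kernel_zero_left, map_one, mul_one] at this
      exact this.1
    refine AEStronglyMeasurable.mul hm.comp_snd ?_
    refine Continuous.aestronglyMeasurable ?_
    simp only [conj_kernel]
    unfold kernel dot
    fun_prop
  · rintro ⟨ζ, u⟩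
    simp only [Function.uncurry_apply_pair, norm_mul, Complex.norm_conj, norm_kernel,
      dot_smul_right, Complex.conj_ofReal, Complex.re_ofReal_mul, Complex.norm_real,
      Real.norm_of_nonneg (Real.exp_pos _).le]
    rw [norm_weighted, mul_assoc ‖f u‖, mul_assoc ‖f u‖, mul_left_comm _ ‖f u‖]
    refine mul_le_mul_of_nonneg_left ?_ (norm_nonneg _)
    simp only [← Real.exp_add]
    refine Real.exp_le_exp.2 ?_
    have h := div_le_div_of_nonneg_right (mul_re_dot_le hκ (a + b) u ζ) ht.le
    have e1 : -(normSq u / t) + (a * (dot u ζ).re / t + b * (dot u ζ).re / t + -(normSq ζ / t)) =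
        (a + b) * (dot u ζ).re / t - normSq u / t - normSq ζ / t := by ring
    have e2 : -((1 - (a + b) ^ 2 / (4 * κ)) / t) * normSq ζ + (-(normSq u / (2 * t)) +
        -((1 / 2 - κ) / t) * normSq u) =
        (κ * normSq u + (a + b) ^ 2 / (4 * κ) * normSq ζ) / t - normSq u / t - normSq ζ / t := by
      field_simp
      ring
    rw [e1, e2]
    linarith

/-- The key identity: the Gaussian integral of `T_f K_{aζ}(bζ)` over `ζ` is the Gaussian average of
`f` with variance `s`, where `1 - ab = t / s`. After Fubini, the inner integral is
`∫ exp((a u · ζ̄ + b ζ · ū - |ζ|²) / t) dζ = (πt)ⁿ exp(ab|u|² / t)`. -/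
theorem integral_toeplitz_kernel {t s : ℝ} (ht : 0 < t) (hs : 0 < s) {a b : ℝ}
    (hab : (a + b) ^ 2 < 2) (hs' : a * b = 1 - t / s) {f : (Fin n → ℂ) → ℂ} (hf : MemL t 2 f) :
    ∫ ζ, toeplitz t f (kernel t ((a : ℂ) • ζ)) ((b : ℂ) • ζ) *
        (Real.exp (-(normSq ζ / t)) : ℂ) = ((Real.pi * s) ^ n : ℝ) * berezin s f 0 := by
  have hsw := integral_integral_swap (integrable_toeplitz_kernel_prod ht hab hf)
  have hpt : (((Real.pi * t) ^ n : ℝ) : ℂ) ≠ 0 := by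
    have : 0 < (Real.pi * t) ^ n := by positivity
    exact_mod_cast this.ne'
  have hps : (((Real.pi * s) ^ n : ℝ) : ℂ) ≠ 0 := by
    have : 0 < (Real.pi * s) ^ n := by positivity
    exact_mod_cast this.ne'
  have hL : ∀ ζ : Fin n → ℂ, ∫ u, f u * (Real.exp (-(normSq u / t)) : ℂ) *
        (kernel t ((a : ℂ) • ζ) u * conj (kernel t ((b : ℂ) • ζ) u) *
          (Real.exp (-(normSq ζ / t)) : ℂ)) =
      ((Real.pi * t) ^ n : ℝ) * (toeplitz t f (kernel t ((a : ℂ) • ζ)) ((b : ℂ) • ζ) *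
        (Real.exp (-(normSq ζ / t)) : ℂ)) := fun ζ => by
    rw [toeplitz, proj, pairing, Complex.ofReal_inv, ← mul_assoc, ← mul_assoc,
      mul_inv_cancel₀ hpt, one_mul, ← integral_mul_const]
    congr 1
    funext u
    ring
  have hR : ∀ u : Fin n → ℂ, ∫ ζ, f u * (Real.exp (-(normSq u / t)) : ℂ) *
        (kernel t ((a : ℂ) • ζ) u * conj (kernel t ((b : ℂ) • ζ) u) *
          (Real.exp (-(normSq ζ / t)) : ℂ)) =
      ((Real.pi * t) ^ n : ℝ) * (f (u + 0) * (Real.exp (-(normSq u / s)) : ℂ)) := fun u => by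
    rw [integral_const_mul, integral_kernel_mul_conj_kernel ht, add_zero]
    have h1 : Real.exp (-(normSq u / s)) =
        Real.exp (-(normSq u / t)) * Real.exp (a * b * normSq u / t) := by
      rw [← Real.exp_add, hs']
      congr 1
      field_simp
      ring
    rw [h1]
    push_cast
    ring
  simp only [hL, hR] at hsw
  rw [integral_const_mul, integral_const_mul] at hsw
  rw [mul_left_cancel₀ hpt hsw, berezin_eq, Complex.ofReal_inv, ← mul_assoc, mul_inv_cancel₀ hps,
    one_mul]

theorem berezin_shift (s : ℝ) (f : (Fin n → ℂ) → ℂ) (z : Fin n → ℂ) :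
    berezin s (fun u => f (u + z)) 0 = berezin s f z := by
  rw [berezin_eq, berezin_eq]; simp

/-- The scaling parameters for the key identity: `(√x, √x)` or `(1, x)`, according to the sign of
`x = 1 - t / s`. -/
theorem exists_mul_eq_one_sub_div {t s : ℝ} (ht : 0 < t) (h1 : t / 2 < s) (h2 : s < 2 * t) :
    ∃ a b : ℝ, a * b = 1 - t / s ∧ (a + b) ^ 2 < 2 ∧ a ^ 2 + b ^ 2 < 2 := by
  have hs : 0 < s := by linarith
  have hx1 : -1 < 1 - t / s := by
    have : t / s < 2 := by rw [div_lt_iff₀ hs]; linarith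
    linarith
  have hx2 : 1 - t / s < 1 / 2 := by
    have : 1 / 2 < t / s := by rw [lt_div_iff₀ hs]; linarith
    linarith
  set x := 1 - t / s
  rcases le_total 0 x with hx | hx
  · refine ⟨Real.sqrt x, Real.sqrt x, Real.mul_self_sqrt hx, ?_, ?_⟩
    · nlinarith [Real.sq_sqrt hx]
    · nlinarith [Real.sq_sqrt hx]
  · refine ⟨1, x, one_mul x, ?_, ?_⟩ <;> nlinarith

/-- The Berezin transform is bounded by the norm of the Toeplitz operator on the kernels. In the key
identity for `f(· + z)` the integrand is at most `C ‖T_f‖ exp((a² + b²) |ζ|² / (2t) - |ζ|² / t)`,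
which is integrable as `a² + b² < 2`. -/
theorem exists_berezin_le (n : ℕ) (t : ℝ) [ht : Fact (0 < t)] (X : Kind) {s : ℝ}
    (h1 : t / 2 < s) (h2 : s < 2 * t) :
    ∃ C : ℝ, 0 < C ∧ ∀ (f : (Fin n → ℂ) → ℂ), Admissible t f →
      ∀ D : Submodule ℂ (Space n t X), (∀ z, kernelVec t X z ∈ D) →
        ⨆ z, ENNReal.ofReal ‖berezin s f z‖ ≤ ENNReal.ofReal C * toeplitzNorm f D := by
  have ht0 := ht.out
  have hs : 0 < s := by linarith
  obtain ⟨a, b, hab, hab1, hab2⟩ := exists_mul_eq_one_sub_div ht0 h1 h2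
  obtain ⟨C, hC0, hC⟩ := exists_norm_weighted_toeplitz_le n t X
  set r : ℝ := (1 - (a ^ 2 + b ^ 2) / 2) / t with hr
  have hr0 : 0 < r := div_pos (by linarith) ht0
  set I : ℝ := ∫ ζ : Fin n → ℂ, Real.exp (-r * normSq ζ) with hI
  have hI0 : 0 ≤ I := integral_nonneg fun ζ => (Real.exp_pos _).le
  -- `I + 1` rather than `I`, so that the constant is visibly positive
  refine ⟨((Real.pi * s) ^ n)⁻¹ * C * (I + 1), by positivity, fun f hf D hD => ?_⟩
  by_cases hM : toeplitzNorm f D = ∞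
  · rw [hM, ENNReal.mul_top]
    · exact le_top
    · rw [Ne, ENNReal.ofReal_eq_zero, not_le]; positivity
  set M := (toeplitzNorm f D).toReal with hMdef
  have hM0 : 0 ≤ M := ENNReal.toReal_nonneg
  refine iSup_le fun z => ?_
  rw [← ENNReal.ofReal_toReal hM, ← ENNReal.ofReal_mul (by positivity)]
  refine ENNReal.ofReal_le_ofReal ?_
  have hk := integral_toeplitz_kernel ht0 hs hab1 hab (hf.shift z).memL
  rw [berezin_shift] at hk
  have hn : ‖(((Real.pi * s) ^ n : ℝ) : ℂ) * berezin s f z‖ ≤ C * M * I := by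
    rw [← hk, hI, ← integral_const_mul]
    refine norm_integral_le_of_norm_le ((integrable_gauss hr0).const_mul _)
      (Eventually.of_forall fun ζ => ?_)
    rw [norm_mul, Complex.norm_real, Real.norm_of_nonneg (Real.exp_pos _).le]
    refine (mul_le_mul_of_nonneg_right (hC f hf D hD hM z _ _) (Real.exp_pos _).le).trans
      (le_of_eq ?_)
    rw [mul_assoc (C * M), ← Real.exp_add, normSq_smul, normSq_smul, Complex.norm_real,
      Complex.norm_real, Real.norm_eq_abs, Real.norm_eq_abs, sq_abs, sq_abs, hr]
    congr 2
    field_simp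
    ring
  rw [norm_mul, Complex.norm_real, Real.norm_of_nonneg (by positivity)] at hn
  have hps : 0 < (Real.pi * s) ^ n := by positivity
  rw [← le_div_iff₀' hps] at hn
  refine hn.trans ?_
  rw [div_eq_inv_mul]
  have : 0 ≤ ((Real.pi * s) ^ n)⁻¹ * C * M := by positivity
  nlinarith

end Berezin

/-! ### Completeness of the Fock spaces -/

section Complete

theorem Space.norm_le_of_weighted {F : Type*} [NormedAddCommGroup F] {n : ℕ} {t : ℝ} {X : Kind}
    (g : Space n t X) {c : ℝ}
    (hc : 0 ≤ c) {H : (Fin n → ℂ) → F} (hH : MemLp H X.exponent (scaledVolume n t X.exponent))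
    (h : ∀ w, ‖weighted t g w‖ ≤ c * ‖H w‖) :
    ‖g‖ ≤ c * (eLpNorm H X.exponent (scaledVolume n t X.exponent)).toReal := by
  rw [Space.norm_def, ← ENNReal.toReal_ofReal_mul _ _ hc]
  exact ENNReal.toReal_mono (ENNReal.mul_ne_top ENNReal.ofReal_ne_top hH.2.ne)
    (eLpNorm_le_mul_eLpNorm_of_ae_le_mul (Eventually.of_forall h) _)

variable {n : ℕ} {t : ℝ} [ht : Fact (0 < t)] {X : Kind}

theorem MemL.of_continuous_exp {p : ℝ≥0∞} (hp : 1 ≤ p) {h : (Fin n → ℂ) → ℂ} (hc : Continuous h)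
    (hb : ∃ a C : ℝ, ∀ w, ‖h w‖ ≤ C * Real.exp (a * ∑ j, ‖w j‖)) : MemL t p h := by
  obtain ⟨a, C, hb⟩ := hb
  exact (memLp_weighted ht.out hc hb hp).smul_measure normConst_ne_top

theorem integrable_norm_weighted_kernel (w : Fin n → ℂ) :
    Integrable fun u => ‖weighted t (kernel t w) u‖ := by
  obtain ⟨a, C, hb⟩ := kernel_growth ht.out w
  exact (memLp_one_iff_integrable.1 (memLp_weighted ht.out
    (kernel_differentiable t w).continuous hb le_rfl)).norm

/-- If `g_m → g` pointwise with a uniform bound on the weighted functions, then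
`P_t g_m → P_t g` pointwise. -/
theorem tendsto_proj {u : ℕ → (Fin n → ℂ) → ℂ} {g : (Fin n → ℂ) → ℂ} {B : ℝ}
    (hm : ∀ m, AEStronglyMeasurable (weighted t (u m)) volume)
    (hB : ∀ m w, ‖weighted t (u m) w‖ ≤ B)
    (hlim : ∀ w, Tendsto (fun m => weighted t (u m) w) atTop (𝓝 (weighted t g w)))
    (w : Fin n → ℂ) : Tendsto (fun m => proj t (u m) w) atTop (𝓝 (proj t g w)) := by
  simp only [proj, pairing_eq]
  refine Tendsto.const_mul _ ?_
  have hK : AEStronglyMeasurable (fun v => conj (weighted t (kernel t w) v)) volume :=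
    (Complex.continuous_conj.comp (continuous_weighted t
      (kernel_differentiable t w).continuous)).aestronglyMeasurable
  refine tendsto_integral_of_dominated_convergence
    (fun v => B * ‖weighted t (kernel t w) v‖) (fun m => (hm m).mul hK)
    ((integrable_norm_weighted_kernel w).const_mul B) (fun m => Eventually.of_forall fun v => ?_)
    (Eventually.of_forall fun v => (hlim v).mul_const _)
  simp only [Pi.mul_apply, norm_mul, Complex.norm_conj]
  exact mul_le_mul_of_nonneg_right (hB m v) (norm_nonneg _)

/-- The Fock spaces are complete. The pointwise limit of a Cauchy sequence inherits the reproducing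
property, hence is entire. -/
instance : CompleteSpace (Space n t X) := by
  refine Metric.complete_of_cauchySeq_tendsto fun u hu => ?_
  obtain ⟨C, hC0, hC⟩ := exists_norm_weighted_le n t X
  have hpt : ∀ w, ∃ l, Tendsto (fun m => u m w) atTop (𝓝 l) := fun w =>
    cauchySeq_tendsto_of_complete ((evalCLM t X w).uniformContinuous.comp_cauchySeq hu)
  choose g hg using hpt
  have hgw : ∀ w, Tendsto (fun m => weighted t (u m) w) atTop (𝓝 (weighted t g w)) := fun w =>
    (hg w).mul_const _
  have hcont : ∀ m, Continuous (weighted t (u m)) := fun m =>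
    continuous_weighted t (u m).differentiable.continuous
  set p := X.exponent
  set μ := scaledVolume n t p
  have hmem : ∀ m, MemLp (weighted t (u m)) p μ := fun m => (u m).memL
  -- uniform convergence of the weighted functions
  have hunif : ∀ ε > 0, ∃ N, ∀ m ≥ N, ∀ w,
      ‖weighted t (u m) w - weighted t g w‖ ≤ C * ε := fun ε hε => by
    obtain ⟨N, hN⟩ := Metric.cauchySeq_iff.1 hu ε hε
    refine ⟨N, fun m hm w => ?_⟩
    refine le_of_tendsto ((tendsto_const_nhds.sub (hgw w)).norm) ?_
    filter_upwards [eventually_ge_atTop N] with l hl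
    have h1 := hC (u m - u l) w
    have h2 : weighted t (u m - u l : Space n t X) w = weighted t (u m) w - weighted t (u l) w :=
      congrFun (weighted_sub t (u m) (u l)) w
    rw [h2] at h1
    refine h1.trans (mul_le_mul_of_nonneg_left ?_ hC0.le)
    rw [← dist_eq_norm]
    exact (hN m hm l hl).le
  -- convergence in `L_t^p`
  have hLp : ∀ ε > 0, ∃ N, ∀ m ≥ N,
      eLpNorm (weighted t (u m) - weighted t g) p μ ≤ ENNReal.ofReal ε := fun ε hε => by
    obtain ⟨N, hN⟩ := Metric.cauchySeq_iff.1 hu ε hε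
    refine ⟨N, fun m hm => ?_⟩
    refine Lp.eLpNorm_le_of_ae_tendsto (u := atTop)
      (f := fun l => weighted t (u m) - weighted t (u l)) ?_
      (fun l => ((hmem m).1.sub (hmem l).1))
      (Eventually.of_forall fun w => tendsto_const_nhds.sub (hgw w))
    filter_upwards [eventually_ge_atTop N] with l hl
    have h1 := hN m hm l hl
    rw [dist_eq_norm, Space.norm_def] at h1
    have h2 : weighted t (u m - u l : Space n t X) = weighted t (u m) - weighted t (u l) :=
      weighted_sub t (u m) (u l)
    have h3 := (u m - u l).memL.2.ne
    rw [eNormL, h2] at h1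
    rw [h2] at h3
    rw [← ENNReal.ofReal_toReal h3]
    exact ENNReal.ofReal_le_ofReal h1.le
  have hgm : AEStronglyMeasurable (weighted t g) μ :=
    aestronglyMeasurable_of_tendsto_ae atTop (fun m => (hmem m).1) (Eventually.of_forall hgw)
  have hgL : MemL t p g := by
    obtain ⟨N, hN⟩ := hLp 1 one_pos
    have h1 : MemLp (weighted t (u N) - weighted t g) p μ :=
      ⟨(hmem N).1.sub hgm, (hN N le_rfl).trans_lt ENNReal.ofReal_lt_top⟩
    have h2 := (hmem N).sub h1
    rwa [sub_sub_cancel] at h2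
  obtain ⟨R, hR⟩ : ∃ R, ∀ m, ‖u m‖ ≤ R := by
    obtain ⟨R, hR⟩ := hu.norm_bddAbove
    exact ⟨R, fun m => hR ⟨m, rfl⟩⟩
  have hproj : proj t g = g := by
    funext w
    refine tendsto_nhds_unique ?_ (hg w)
    have h1 := tendsto_proj (t := t) (u := fun m => u m) (B := C * R)
      (fun m => (hcont m).aestronglyMeasurable)
      (fun m v => (hC (u m) v).trans (mul_le_mul_of_nonneg_left (hR m) hC0.le)) hgw w
    simpa only [Space.proj_eq] using h1
  have hd : Differentiable ℂ g := hproj ▸ hgL.differentiable_proj ht.out X.one_le_exponent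
  have hv : X = Kind.vanishing → Tendsto (weighted t g) (cocompact (Fin n → ℂ)) (𝓝 0) := by
    intro hX
    rw [Metric.tendsto_nhds]
    intro ε hε
    obtain ⟨N, hN⟩ := hunif (ε / (2 * C)) (by positivity)
    have h1 := (show ↥(submodule n t X) from u N).2.2.2 hX
    filter_upwards [Metric.tendsto_nhds.1 h1 (ε / 2) (by positivity)] with w hw
    have h2 := hN N le_rfl w
    have h3 : C * (ε / (2 * C)) = ε / 2 := by field_simp
    rw [dist_zero_right] at hw ⊢
    have h4 : ‖weighted t g w‖ ≤ ‖weighted t (u N) w‖ +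
        ‖weighted t (u N) w - weighted t g w‖ := norm_le_insert _ _
    have h5 : ‖weighted t (u N) w‖ < ε / 2 := hw
    linarith
  let G : Space n t X := (⟨g, hd, hgL, hv⟩ : ↥(submodule n t X))
  refine ⟨G, Metric.tendsto_atTop.2 fun ε hε => ?_⟩
  obtain ⟨N, hN⟩ := hLp (ε / 2) (by positivity)
  refine ⟨N, fun m hm => ?_⟩
  have h2 : weighted t (u m - G : Space n t X) = weighted t (u m) - weighted t g :=
    weighted_sub t (u m) g
  rw [dist_eq_norm, Space.norm_def, eNormL, h2]
  have h3 := ENNReal.toReal_mono ENNReal.ofReal_ne_top (hN m hm)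
  rw [ENNReal.toReal_ofReal (by positivity)] at h3
  exact h3.trans_lt (by linarith)

end Complete

/-! ### Boundedness of `P_t` -/

section ProjBounded

/-- Jensen's inequality for the power `q` and the finite measure with density `γ`, in homogeneous
form. -/
theorem lintegral_mul_rpow_le {α : Type*} [MeasurableSpace α] {μ : Measure α} {H γ : α → ℝ≥0∞}
    (hH : AEMeasurable H μ) (hγ : AEMeasurable γ μ) {q : ℝ} (hq : 1 ≤ q) :
    (∫⁻ a, H a * γ a ∂μ) ^ q ≤ (∫⁻ a, H a ^ q * γ a ∂μ) * (∫⁻ a, γ a ∂μ) ^ (q - 1) := by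
  have hq0 : 0 < q := by linarith
  have h := ENNReal.lintegral_mul_norm_pow_le ((hH.pow_const q).mul hγ) hγ
    (p := 1 / q) (q := 1 - 1 / q) (by positivity)
    (by rw [sub_nonneg, div_le_one hq0]; exact hq) (by ring)
  have h1 : ∀ a, (H a ^ q * γ a) ^ (1 / q) * γ a ^ (1 - 1 / q) = H a * γ a := fun a => by
    rw [ENNReal.mul_rpow_of_nonneg _ _ (by positivity), ← ENNReal.rpow_mul,
      mul_one_div_cancel hq0.ne', ENNReal.rpow_one, mul_assoc,
      ← ENNReal.rpow_add_of_nonneg _ _ (by positivity)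
        (by rw [sub_nonneg, div_le_one hq0]; exact hq)]
    simp
  simp only [Pi.mul_apply, h1] at h
  refine (ENNReal.rpow_le_rpow h hq0.le).trans (le_of_eq ?_)
  rw [ENNReal.mul_rpow_of_nonneg _ _ hq0.le, ← ENNReal.rpow_mul, ← ENNReal.rpow_mul,
    one_div_mul_cancel hq0.ne', ENNReal.rpow_one]
  congr 2
  field_simp

variable {n : ℕ}

/-- The Gaussian `exp(-|v|² / (2t))` with values in `[0, ∞]`. -/
def egauss (t : ℝ) (v : Fin n → ℂ) : ℝ≥0∞ := ENNReal.ofReal (Real.exp (-(normSq v / (2 * t))))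

theorem continuous_egauss (t : ℝ) : Continuous (egauss (n := n) t) := by
  have hns := continuous_normSq (n := n)
  unfold egauss
  exact ENNReal.continuous_ofReal.comp (by fun_prop)

theorem lintegral_egauss_ne_top {t : ℝ} (ht : 0 < t) : ∫⁻ v : Fin n → ℂ, egauss t v ≠ ∞ := by
  have h := (integrable_gauss (n := n) (b := 1 / (2 * t)) (by positivity)).lintegral_lt_top
  have h2 : ∀ v : Fin n → ℂ, egauss t v = ENNReal.ofReal (Real.exp (-(1 / (2 * t)) * normSq v)) :=
    fun v => by rw [egauss]; congr 2; ring
  simp only [h2]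
  exact h.ne

theorem norm_weighted_kernel_mul (t : ℝ) (z u : Fin n → ℂ) :
    ‖weighted t (kernel t z) u‖ * Real.exp (-(normSq z / (2 * t))) =
      Real.exp (-(normSq (z - u) / (2 * t))) := by
  rw [norm_weighted, norm_kernel, ← Real.exp_add, ← Real.exp_add, sub_eq_add_neg z u, normSq_add,
    normSq_neg, dot_neg_right, dot_re_comm, Complex.neg_re]
  congr 1
  ring

/-- In absolute value, `P_t` is dominated by convolution with a Gaussian. -/
theorem enorm_weighted_proj_le {t : ℝ} (ht : 0 < t) (h : (Fin n → ℂ) → ℂ) (z : Fin n → ℂ) :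
    ‖weighted t (proj t h) z‖ₑ ≤ ENNReal.ofReal ((Real.pi * t) ^ n)⁻¹ *
      ∫⁻ u, ‖weighted t h u‖ₑ * egauss t (z - u) := by
  rw [weighted, proj, pairing_eq, enorm_mul, enorm_mul, mul_assoc]
  have h0 : ∀ r : ℝ, 0 ≤ r → ‖(r : ℂ)‖ₑ = ENNReal.ofReal r := fun r hr => by
    rw [← ofReal_norm, Complex.norm_real, Real.norm_of_nonneg hr]
  rw [h0 _ (by positivity), h0 _ (Real.exp_pos _).le]
  refine mul_le_mul_right ?_ _
  refine (mul_le_mul_left (enorm_integral_le_lintegral_enorm _) _).trans (le_of_eq ?_)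
  rw [← lintegral_mul_const' _ _ ENNReal.ofReal_ne_top]
  refine lintegral_congr fun u => ?_
  rw [Pi.mul_apply, enorm_mul, mul_assoc, egauss, ← norm_weighted_kernel_mul,
    ENNReal.ofReal_mul (norm_nonneg _), ofReal_norm, RCLike.enorm_conj]

/-- `P_t` is bounded on `L_t^p` for all `1 ≤ p ≤ ∞` (Schur test). -/
theorem exists_eNormL_proj_le (n : ℕ) {t : ℝ} (ht : 0 < t) {p : ℝ≥0∞} (hp : 1 ≤ p) :
    ∃ C : ℝ, 0 ≤ C ∧ ∀ h : (Fin n → ℂ) → ℂ, AEStronglyMeasurable (weighted t h) volume →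
      eNormL t p (proj t h) ≤ ENNReal.ofReal C * eNormL t p h := by
  set c := ENNReal.ofReal ((Real.pi * t) ^ n)⁻¹
  set Γ := ∫⁻ v : Fin n → ℂ, egauss t v with hΓ
  have hΓt : Γ ≠ ∞ := lintegral_egauss_ne_top ht
  have hct : c * Γ ≠ ∞ := ENNReal.mul_ne_top ENNReal.ofReal_ne_top hΓt
  refine ⟨(c * Γ).toReal, ENNReal.toReal_nonneg, fun h hh => ?_⟩
  rw [ENNReal.ofReal_toReal hct, eNormL, eNormL, scaledVolume,
    eLpNorm_smul_measure_of_ne_zero (normConst_ne_zero ht hp),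
    eLpNorm_smul_measure_of_ne_zero (normConst_ne_zero ht hp), smul_eq_mul, smul_eq_mul,
    mul_left_comm]
  refine mul_le_mul_right ?_ _
  have hΓz : ∀ z : Fin n → ℂ, ∫⁻ u, egauss t (z - u) = Γ := fun z =>
    lintegral_sub_left_eq_self (egauss t) z
  have hΓu : ∀ u : Fin n → ℂ, ∫⁻ z, egauss t (z - u) = Γ := fun u =>
    lintegral_sub_right_eq_self (egauss t) u
  have hγ := continuous_egauss (n := n) t
  by_cases hpt : p = ∞
  · subst hpt
    rw [eLpNorm_exponent_top]
    refine eLpNormEssSup_le_of_ae_enorm_bound (Eventually.of_forall fun z => ?_)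
    refine (enorm_weighted_proj_le ht h z).trans ?_
    rw [mul_assoc]
    refine mul_le_mul_right ?_ _
    have hm : AEMeasurable (fun u => egauss t (z - u)) volume :=
      (hγ.comp (continuous_const.sub continuous_id)).aemeasurable
    rw [mul_comm, ← hΓz z, ← lintegral_const_mul'' _ hm]
    refine lintegral_mono_ae ?_
    filter_upwards [enorm_ae_le_eLpNormEssSup (weighted t h) volume] with u hu
    exact mul_le_mul_left hu _
  · have hp0 : p ≠ 0 := (lt_of_lt_of_le one_pos hp).ne'
    set q := p.toReal
    have hq : 1 ≤ q := by
      have := ENNReal.toReal_mono hpt hp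
      simpa using this
    have hq0 : 0 < q := by linarith
    rw [eLpNorm_eq_lintegral_rpow_enorm_toReal hp0 hpt,
      eLpNorm_eq_lintegral_rpow_enorm_toReal hp0 hpt]
    have hkey : ∫⁻ z, ‖weighted t (proj t h) z‖ₑ ^ q ≤
        (c * Γ) ^ q * ∫⁻ u, ‖weighted t h u‖ₑ ^ q := by
      calc ∫⁻ z, ‖weighted t (proj t h) z‖ₑ ^ q
          ≤ ∫⁻ z, c ^ q * (Γ ^ (q - 1) * ∫⁻ u, ‖weighted t h u‖ₑ ^ q * egauss t (z - u)) := by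
            refine lintegral_mono fun z => ?_
            refine (ENNReal.rpow_le_rpow (enorm_weighted_proj_le ht h z) hq0.le).trans ?_
            rw [ENNReal.mul_rpow_of_nonneg _ _ hq0.le]
            refine mul_le_mul_right ?_ _
            have := lintegral_mul_rpow_le hh.enorm
              (hγ.comp (continuous_const.sub continuous_id)).aemeasurable hq
              (γ := fun u => egauss t (z - u))
            rwa [hΓz, mul_comm (∫⁻ a, _)] at this
        _ = c ^ q * (Γ ^ (q - 1) * ∫⁻ z, ∫⁻ u, ‖weighted t h u‖ₑ ^ q * egauss t (z - u)) := by
            rw [lintegral_const_mul' _ _ (by finiteness), lintegral_const_mul']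
            exact ENNReal.rpow_ne_top_of_nonneg (by linarith) hΓt
        _ = c ^ q * (Γ ^ (q - 1) * (Γ * ∫⁻ u, ‖weighted t h u‖ₑ ^ q)) := by
            rw [lintegral_lintegral_swap]
            · congr 2
              rw [← lintegral_const_mul' _ _ hΓt]
              refine lintegral_congr fun u => ?_
              have hm : AEMeasurable (fun z => egauss t (z - u)) volume :=
                (hγ.comp (continuous_id.sub continuous_const)).aemeasurable
              rw [lintegral_const_mul'' _ hm, hΓu, mul_comm]
            · refine AEMeasurable.mul ?_ ?_
              · exact (hh.enorm.pow_const q).comp_snd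
              · exact (hγ.comp (continuous_fst.sub continuous_snd)).aemeasurable
        _ = _ := by
            rw [ENNReal.mul_rpow_of_nonneg _ _ hq0.le, mul_assoc, ← mul_assoc (Γ ^ (q - 1))]
            congr 2
            conv_lhs => enter [2]; rw [← ENNReal.rpow_one Γ]
            rw [← ENNReal.rpow_add_of_nonneg _ _ (by linarith) zero_le_one, sub_add_cancel]
    refine (ENNReal.rpow_le_rpow hkey (by positivity)).trans (le_of_eq ?_)
    rw [ENNReal.mul_rpow_of_nonneg _ _ (by positivity), ← ENNReal.rpow_mul,
      mul_one_div_cancel hq0.ne', ENNReal.rpow_one]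

end ProjBounded

/-! ### Superpositions of kernels -/

section Synthesis

variable {n : ℕ} {t : ℝ} [ht : Fact (0 < t)] {X : Kind}

/-- `z ↦ K_z` is continuous into the Fock space: near `z₀`,
`|K_z(u) - K_{z₀}(u)| ≤ ‖z - z₀‖ exp(a ∑ |uⱼ|)`. -/
theorem continuous_kernelVec : Continuous (kernelVec t X : (Fin n → ℂ) → Space n t X) := by
  have ht0 := ht.out
  refine continuous_iff_continuousAt.2 fun z₀ => ?_
  set E : (Fin n → ℂ) → ℂ := fun u => ((Real.exp ((‖z₀‖ + 2) / t * ∑ j, ‖u j‖) : ℝ) : ℂ)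
    with hE
  have hEm : MemL t X.exponent E :=
    MemL.of_continuous_exp X.one_le_exponent (by fun_prop) (exp_sum_norm_growth _)
  set L := (eLpNorm (weighted t E) X.exponent (scaledVolume n t X.exponent)).toReal
  have hb : ∀ z ∈ Metric.ball z₀ 1, ‖kernelVec t X z - kernelVec t X z₀‖ ≤ ‖z - z₀‖ * L := by
    intro z hz
    rw [Metric.mem_ball, dist_eq_norm] at hz
    refine Space.norm_le_of_weighted _ (norm_nonneg _) hEm fun u => ?_
    rw [norm_weighted, norm_weighted, ← mul_assoc]
    refine mul_le_mul_of_nonneg_right ?_ (Real.exp_pos _).le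
    change ‖kernel t z u - kernel t z₀ u‖ ≤ _
    set S := ∑ j, ‖u j‖ with hS
    have hS0 : 0 ≤ S := Finset.sum_nonneg fun j _ => norm_nonneg _
    set y := dot u (z - z₀) / t with hy
    have hyn : ‖y‖ ≤ ‖z - z₀‖ * (S / t) := by
      rw [hy, norm_div, Complex.norm_real, Real.norm_of_nonneg ht0.le, ← mul_div_assoc]
      exact div_le_div_of_nonneg_right (norm_dot_le u _) ht0.le
    have h1 : kernel t z u = kernel t z₀ u * Complex.exp y := by
      rw [kernel, kernel, ← Complex.exp_add, hy, ← add_div, ← dot_add_right, add_sub_cancel]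
    have h2 : ‖Complex.exp y - 1‖ ≤ ‖y‖ * Real.exp ‖y‖ := by
      simpa using Complex.norm_exp_sub_sum_le_norm_mul_exp y 1
    have hk : ‖kernel t z₀ u‖ ≤ Real.exp (‖z₀‖ / t * S) := by
      rw [norm_kernel, div_mul_eq_mul_div]
      exact Real.exp_le_exp.2 (div_le_div_of_nonneg_right
        ((Complex.re_le_norm _).trans (norm_dot_le u z₀)) ht0.le)
    have hSe : S / t ≤ Real.exp (S / t) := (by linarith : S / t ≤ S / t + 1).trans
      (Real.add_one_le_exp _)
    have hSt : 0 ≤ S / t := by positivity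
    have hye : Real.exp ‖y‖ ≤ Real.exp (S / t) :=
      Real.exp_le_exp.2 (hyn.trans (mul_le_of_le_one_left hSt hz.le))
    have h3 : kernel t z u - kernel t z₀ u = kernel t z₀ u * (Complex.exp y - 1) := by
      rw [h1]; ring
    have hEn : ‖E u‖ = Real.exp (‖z₀‖ / t * S) * (Real.exp (S / t) * Real.exp (S / t)) := by
      rw [hE, Complex.norm_real, Real.norm_of_nonneg (Real.exp_pos _).le, ← Real.exp_add,
        ← Real.exp_add]
      congr 1
      ring
    rw [h3, norm_mul, hEn]
    calc ‖kernel t z₀ u‖ * ‖Complex.exp y - 1‖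
        ≤ Real.exp (‖z₀‖ / t * S) * (‖z - z₀‖ * Real.exp (S / t) * Real.exp (S / t)) := by
          refine mul_le_mul hk (h2.trans ?_) (norm_nonneg _) (Real.exp_pos _).le
          exact mul_le_mul (hyn.trans (mul_le_mul_of_nonneg_left hSe (norm_nonneg _))) hye
            (Real.exp_pos _).le (by positivity)
      _ = _ := by ring
  refine tendsto_iff_norm_sub_tendsto_zero.2 ?_
  have h0 : Tendsto (fun z => ‖z - z₀‖ * L) (𝓝 z₀) (𝓝 0) := by
    have : Continuous fun z : Fin n → ℂ => ‖z - z₀‖ * L := by fun_prop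
    simpa using this.tendsto z₀
  refine squeeze_zero' (Eventually.of_forall fun z => norm_nonneg _) ?_ h0
  filter_upwards [Metric.ball_mem_nhds z₀ one_pos] with z hz using hb z hz

/-- The superposition `∫ h(w) K_w dμ_t(w)`, as a Bochner integral in the Fock space. -/
def synthesis (t : ℝ) [Fact (0 < t)] (X : Kind) (h : (Fin n → ℂ) → ℂ) : Space n t X :=
  ((((Real.pi * t) ^ n)⁻¹ : ℝ) : ℂ) •
    ∫ w, (h w * (Real.exp (-(normSq w / t)) : ℂ)) • kernelVec t X w

theorem integrable_smul_kernelVec {h : (Fin n → ℂ) → ℂ} (hh : Integrable (weighted t h)) :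
    Integrable fun w => (h w * (Real.exp (-(normSq w / t)) : ℂ)) • kernelVec t X w := by
  have hns := continuous_normSq (n := n)
  have h1 : (fun w => (h w * (Real.exp (-(normSq w / t)) : ℂ)) • kernelVec t X w) = fun w =>
      weighted t h w • ((Real.exp (-(normSq w / (2 * t))) : ℂ) • kernelVec t X w) := by
    funext w
    rw [smul_smul, exp_neg_normSq, weighted]
    push_cast
    rw [mul_assoc]
  have hc : Continuous fun w : Fin n → ℂ =>
      (Real.exp (-(normSq w / (2 * t))) : ℂ) • kernelVec t X w := by
    have := continuous_kernelVec (n := n) (t := t) (X := X)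
    fun_prop
  rw [h1]
  refine (hh.norm.mul_const ‖kernelVec t X (0 : Fin n → ℂ)‖).mono'
    (hh.1.smul hc.aestronglyMeasurable) (Eventually.of_forall fun w => ?_)
  rw [norm_smul, norm_smul, Complex.norm_real, Real.norm_of_nonneg (Real.exp_pos _).le,
    norm_kernelVec, ← mul_assoc (Real.exp _), ← Real.exp_add, neg_add_cancel, Real.exp_zero,
    one_mul]

theorem apply_synthesis {h : (Fin n → ℂ) → ℂ} (hh : Integrable (weighted t h))
    (η : StrongDual ℂ (Space n t X)) :
    η (synthesis t X h) = ((((Real.pi * t) ^ n)⁻¹ : ℝ) : ℂ) *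
      ∫ w, h w * (Real.exp (-(normSq w / t)) : ℂ) * η (kernelVec t X w) := by
  rw [synthesis, map_smul, ← ContinuousLinearMap.integral_comp_comm η
    (integrable_smul_kernelVec hh), smul_eq_mul]
  simp only [map_smul, smul_eq_mul]

theorem coe_synthesis {h : (Fin n → ℂ) → ℂ} (hh : Integrable (weighted t h)) :
    (synthesis t X h : (Fin n → ℂ) → ℂ) = proj t h := by
  funext v
  rw [← evalCLM_apply, apply_synthesis hh, proj, pairing]
  congr 2
  funext w
  rw [evalCLM_apply, kernelVec_apply, conj_kernel]
  ring

end Synthesis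

/-! ### Norms of the monomials and of the coefficient functionals -/

section Monomials

variable {n : ℕ}

/-- The coordinatewise bound `(l²|wⱼ|²/t)^{αⱼ} / αⱼ! ≤ exp(l²|wⱼ|²/t)` gives a Gaussian bound for
the monomials, at the cost of a geometric factor. -/
theorem norm_weighted_monomial_le {t : ℝ} (ht : 0 < t) {l : ℝ} (hl : 0 < l) (α : Fin n → ℕ)
    (w : Fin n → ℂ) : ‖weighted t (monomial t α) w‖ ≤
      l⁻¹ ^ (∑ j, α j) * Real.exp (-((1 - l ^ 2) / (2 * t)) * normSq w) := by
  have h1 : l ^ (∑ j, α j) * ‖monomial t α w‖ ≤ Real.exp (l ^ 2 / (2 * t) * normSq w) := by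
    refine (sq_le_sq₀ (by positivity) (Real.exp_pos _).le).1 ?_
    have h2 : (l ^ (∑ j, α j) * ‖monomial t α w‖) ^ 2 =
        ∏ j, ((l ^ 2 * ‖w j‖ ^ 2 / t) ^ α j / ((α j)! : ℝ)) := by
      rw [monomial, norm_mul, Complex.norm_real, Real.norm_of_nonneg (Real.sqrt_nonneg _), mul_pow,
        mul_pow, Real.sq_sqrt (by positivity), norm_prod, ← Finset.prod_pow,
        ← Finset.prod_pow_eq_pow_sum, ← Finset.prod_pow_eq_pow_sum, ← Finset.prod_pow,
        ← Finset.prod_mul_distrib, one_div, ← Finset.prod_inv_distrib, ← Finset.prod_mul_distrib,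
        ← Finset.prod_mul_distrib]
      refine Finset.prod_congr rfl fun j _ => ?_
      rw [norm_pow, div_pow, mul_pow, ← pow_mul, ← pow_mul, ← pow_mul, ← pow_mul,
        mul_comm 2, mul_inv]
      ring
    have h3 : Real.exp (l ^ 2 / (2 * t) * normSq w) ^ 2 =
        ∏ j, Real.exp (l ^ 2 * ‖w j‖ ^ 2 / t) := by
      rw [← Real.exp_nat_mul, ← Real.exp_sum, normSq, Finset.mul_sum, Finset.mul_sum]
      congr 1
      refine Finset.sum_congr rfl fun j _ => ?_
      push_cast
      field_simp
    rw [h2, h3]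
    exact Finset.prod_le_prod (fun j _ => by positivity)
      fun j _ => Real.pow_div_factorial_le_exp _ (by positivity) _
  have h4 : ‖monomial t α w‖ ≤ l⁻¹ ^ (∑ j, α j) * Real.exp (l ^ 2 / (2 * t) * normSq w) := by
    rw [inv_pow, ← div_eq_inv_mul, le_div_iff₀ (by positivity), mul_comm]
    exact h1
  rw [norm_weighted]
  refine (mul_le_mul_of_nonneg_right h4 (Real.exp_pos _).le).trans (le_of_eq ?_)
  rw [mul_assoc, ← Real.exp_add]
  congr 2
  ring

variable {t : ℝ} [ht : Fact (0 < t)] {X : Kind}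

theorem gauss_rate_pos {t l : ℝ} (ht : 0 < t) (hl : 0 < l) (hl1 : l < 1) :
    0 < (1 - l ^ 2) / (2 * t) := by
  have : l ^ 2 < 1 := by nlinarith
  exact div_pos (by linarith) (by positivity)

theorem exists_norm_monomialVec_le (n : ℕ) (t : ℝ) [ht : Fact (0 < t)] (X : Kind) {l : ℝ}
    (hl : 0 < l) (hl1 : l < 1) :
    ∃ C : ℝ, 0 ≤ C ∧ ∀ α : Fin n → ℕ, ‖monomialVec t X α‖ ≤ C * l⁻¹ ^ (∑ j, α j) := by
  have hm := (memLp_gauss (n := n) (gauss_rate_pos ht.out hl hl1)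
    X.one_le_exponent).smul_measure (normConst_ne_top (n := n) (t := t) (p := X.exponent))
  refine ⟨(eLpNorm (fun w : Fin n → ℂ => Real.exp (-((1 - l ^ 2) / (2 * t)) * normSq w))
    X.exponent (scaledVolume n t X.exponent)).toReal, ENNReal.toReal_nonneg, fun α => ?_⟩
  rw [mul_comm]
  refine Space.norm_le_of_weighted _ (by positivity) hm fun w => ?_
  rw [Real.norm_of_nonneg (Real.exp_pos _).le]
  exact norm_weighted_monomial_le ht.out hl α w

theorem exists_norm_coeffFunctional_le (n : ℕ) (t : ℝ) [ht : Fact (0 < t)] (X : Kind) {l : ℝ}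
    (hl : 0 < l) (hl1 : l < 1) :
    ∃ C : ℝ, 0 ≤ C ∧ ∀ α : Fin n → ℕ, ‖coeffFunctional t X α‖ ≤ C * l⁻¹ ^ (∑ j, α j) := by
  have ht0 := ht.out
  obtain ⟨C, hC0, hC⟩ := exists_norm_weighted_le n t X
  have hg := integrable_gauss (n := n) (gauss_rate_pos ht0 hl hl1)
  set I := ∫ w : Fin n → ℂ, Real.exp (-((1 - l ^ 2) / (2 * t)) * normSq w)
  have hI : 0 ≤ I := integral_nonneg fun w => (Real.exp_pos _).le
  refine ⟨((Real.pi * t) ^ n)⁻¹ * C * I, by positivity, fun α => ?_⟩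
  refine ContinuousLinearMap.opNorm_le_bound _ (by positivity) fun g => ?_
  change ‖pairing t g (monomial t α)‖ ≤ _
  refine (norm_pairing_le ht0 _ _).trans ?_
  have h1 : ∫ w, ‖weighted t g w‖ * ‖weighted t (monomial t α) w‖ ≤
      C * ‖g‖ * l⁻¹ ^ (∑ j, α j) * I := by
    rw [← integral_const_mul]
    refine integral_mono_of_nonneg (Eventually.of_forall fun w => by positivity)
      (hg.const_mul _) (Eventually.of_forall fun w => ?_)
    change ‖weighted t g w‖ * ‖weighted t (monomial t α) w‖ ≤ _
    change _ ≤ C * ‖g‖ * l⁻¹ ^ (∑ j, α j) * Real.exp _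
    rw [mul_assoc (C * ‖g‖)]
    exact mul_le_mul (hC g w) (norm_weighted_monomial_le ht0 hl α w) (norm_nonneg _)
      (by positivity)
  refine (mul_le_mul_of_nonneg_left h1 (by positivity)).trans (le_of_eq ?_)
  ring

theorem summable_pow_sum {r : ℝ} (hr : 0 ≤ r) (hr1 : r < 1) :
    Summable fun α : Fin n → ℕ => r ^ (∑ j, α j) := by
  refine summable_of_sum_le (c := (1 - r)⁻¹ ^ n) (fun α => by positivity) fun u => ?_
  set N := u.sup fun α => ∑ j, α j with hN
  have hsub : u ⊆ Fintype.piFinset fun _ : Fin n => Finset.range (N + 1) := fun α hα => by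
    rw [Fintype.mem_piFinset]
    intro j
    have h1 : α j ≤ ∑ j, α j := Finset.single_le_sum (fun _ _ => Nat.zero_le _) (Finset.mem_univ j)
    have h2 : ∑ j, α j ≤ N := Finset.le_sup (f := fun α : Fin n → ℕ => ∑ j, α j) hα
    exact Finset.mem_range.2 (by omega)
  refine (Finset.sum_le_sum_of_subset_of_nonneg hsub fun α _ _ => by positivity).trans ?_
  have h3 : ∑ α ∈ Fintype.piFinset fun _ : Fin n => Finset.range (N + 1), r ^ (∑ j, α j) =
      ∏ _j : Fin n, ∑ k ∈ Finset.range (N + 1), r ^ k := by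
    rw [Finset.prod_univ_sum]
    exact Finset.sum_congr rfl fun α _ => (Finset.prod_pow_eq_pow_sum _ _ _).symm
  rw [h3, Finset.prod_const, Finset.card_univ, Fintype.card_fin]
  refine pow_le_pow_left₀ (Finset.sum_nonneg fun k _ => by positivity) ?_ n
  rw [← tsum_geometric_of_lt_one hr hr1]
  exact (summable_geometric_of_lt_one hr hr1).sum_le_tsum _ fun k _ => by positivity

/-- The nuclear norms of the terms of `∑_α x^{|α|} e_α ⊗ e_α` are summable for `|x| < 1`. The two
factors may be measured in different Fock spaces. -/
theorem summable_monomial_coeff (n : ℕ) (t : ℝ) [ht : Fact (0 < t)] (X Y : Kind) {x : ℝ}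
    (hx : |x| < 1) :
    Summable fun α : Fin n → ℕ =>
      |x| ^ (∑ j, α j) * (‖monomialVec t X α‖ * ‖coeffFunctional t Y α‖) := by
  -- any `l` with `|x| < l² < 1` works
  set l := Real.sqrt ((1 + |x|) / 2) with hl
  have hx0 := abs_nonneg x
  have hl2 : l ^ 2 = (1 + |x|) / 2 := Real.sq_sqrt (by positivity)
  have hl0 : 0 < l := Real.sqrt_pos.2 (by positivity)
  have hl1 : l < 1 := by nlinarith
  obtain ⟨C₁, hC₁, h₁⟩ := exists_norm_monomialVec_le n t X hl0 hl1
  obtain ⟨C₂, hC₂, h₂⟩ := exists_norm_coeffFunctional_le n t Y hl0 hl1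
  have hq : |x| * (l⁻¹ * l⁻¹) < 1 := by
    rw [← mul_inv, ← sq, ← div_eq_mul_inv, div_lt_one (by positivity), hl2]
    linarith
  refine Summable.of_nonneg_of_le (fun α => by positivity) (fun α => ?_)
    ((summable_pow_sum (n := n) (by positivity) hq).mul_left (C₁ * C₂))
  calc |x| ^ (∑ j, α j) * (‖monomialVec t X α‖ * ‖coeffFunctional t Y α‖)
      ≤ |x| ^ (∑ j, α j) * ((C₁ * l⁻¹ ^ (∑ j, α j)) * (C₂ * l⁻¹ ^ (∑ j, α j))) := by
        refine mul_le_mul_of_nonneg_left ?_ (by positivity)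
        exact mul_le_mul (h₁ α) (h₂ α) (norm_nonneg _) (by positivity)
    _ = _ := by rw [mul_pow, mul_pow]; ring

end Monomials

/-! ### The operators `∑ₖ cₖ Pₖ` -/

section Diagonal

variable {n : ℕ} {t : ℝ} [ht : Fact (0 < t)] {X : Kind}

/-- The rank one operator `e_α ⊗ e_α`. -/
def rankOne (t : ℝ) [Fact (0 < t)] (X : Kind) (α : Fin n → ℕ) : Space n t X →L[ℂ] Space n t X :=
  (coeffFunctional t X α).smulRight (monomialVec t X α)

theorem norm_rankOne (α : Fin n → ℕ) :
    ‖rankOne t X α‖ = ‖monomialVec t X α‖ * ‖coeffFunctional t X α‖ := by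
  rw [rankOne, ContinuousLinearMap.norm_smulRight_apply, mul_comm]

theorem preimage_sum_eq (k : ℕ) : (fun α : Fin n → ℕ => ∑ j, α j) ⁻¹' {k} =
    ↑(Finset.piAntidiag (Finset.univ : Finset (Fin n)) k) := by
  ext α; simp

/-- Summing over all multi-indices is summing over the degrees. -/
theorem hasSum_homProj {c : ℕ → ℂ}
    {T : Space n t X →L[ℂ] Space n t X}
    (hT : HasSum (fun α : Fin n → ℕ => c (∑ j, α j) • rankOne t X α) T) :
    HasSum (fun k => c k • homProj n t X k) T := by
  have h := hT.tsum_fiberwise (fun α : Fin n → ℕ => ∑ j, α j)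
  have hk : (fun k => c k • homProj n t X k) = fun k =>
      ∑' α : (fun α : Fin n → ℕ => ∑ j, α j) ⁻¹' {k}, c (∑ j, α.1 j) • rankOne t X α.1 := by
    funext k
    rw [preimage_sum_eq k, Finset.tsum_subtype' (Finset.piAntidiag Finset.univ k)
      (fun α : Fin n → ℕ => c (∑ j, α j) • rankOne t X α), homProj, Finset.smul_sum]
    refine Finset.sum_congr rfl fun α hα => ?_
    have h1 : ∑ j, α j = k := by simpa using hα
    rw [h1, rankOne]
  rw [hk]
  exact h

theorem abs_one_sub_div_lt_one {t s : ℝ} (ht : 0 < t) (hs : t / 2 < s) : |1 - t / s| < 1 := by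
  have hs0 : 0 < s := by linarith
  have h1 : t / s < 2 := by rw [div_lt_iff₀ hs0]; linarith
  have h2 : 0 < t / s := div_pos ht hs0
  rw [abs_lt]
  constructor <;> linarith

theorem summable_pow_rankOne {x : ℝ} (hx : |x| < 1) : Summable fun α : Fin n → ℕ =>
    ‖((x ^ (∑ j, α j) : ℝ) : ℂ)‖ * ‖rankOne t X α‖ := by
  refine (summable_monomial_coeff n t X X hx).congr fun α => ?_
  rw [norm_rankOne, Complex.norm_real, Real.norm_eq_abs, abs_pow]

theorem hasSum_rankOne {s : ℝ} (hs : t / 2 < s) :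
    HasSum (fun α : Fin n → ℕ => (((1 - t / s) ^ (∑ j, α j) : ℝ) : ℂ) • rankOne t X α)
      (opT0 n t X s) := by
  have hx := abs_one_sub_div_lt_one ht.out hs
  have hsum := summable_pow_rankOne (n := n) (t := t) (X := X) hx
  have h1 : Summable fun α : Fin n → ℕ =>
      (((1 - t / s) ^ (∑ j, α j) : ℝ) : ℂ) • rankOne t X α :=
    Summable.of_norm (hsum.congr fun α => (norm_smul _ _).symm)
  have h2 := hasSum_homProj (c := fun k => (((1 - t / s) ^ k : ℝ) : ℂ)) h1.hasSum
  have h3 : opT0 n t X s = ∑' α : Fin n → ℕ,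
      (((1 - t / s) ^ (∑ j, α j) : ℝ) : ℂ) • rankOne t X α := h2.tsum_eq
  rw [h3]
  exact h1.hasSum

theorem hasSum_opT0 {s : ℝ} (hs : t / 2 < s) :
    HasSum (fun k => (((1 - t / s) ^ k : ℝ) : ℂ) • homProj n t X k) (opT0 n t X s) :=
  hasSum_homProj (c := fun k => (((1 - t / s) ^ k : ℝ) : ℂ)) (hasSum_rankOne hs)

/-- The degree-`k` part of the expansion of `exp(w · ū / t)`. -/
theorem sum_monomial_mul_conj {t : ℝ} (ht : 0 < t) (k : ℕ) (w u : Fin n → ℂ) :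
    ∑ α ∈ Finset.piAntidiag (Finset.univ : Finset (Fin n)) k,
      monomial t α w * conj (monomial t α u) = (dot w u / t) ^ k / (k ! : ℂ) := by
  rw [div_pow, dot, Finset.sum_pow_eq_sum_piAntidiag, Finset.sum_div, Finset.sum_div]
  refine Finset.sum_congr rfl fun α hα => ?_
  have hk : ∑ j, α j = k := by simpa using hα
  have hsq : (((Real.sqrt (1 / (t ^ k * ∏ j, ((α j)! : ℝ))) : ℝ)) : ℂ) *
      ((Real.sqrt (1 / (t ^ k * ∏ j, ((α j)! : ℝ))) : ℝ) : ℂ) =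
      1 / ((t : ℂ) ^ k * ∏ j, ((α j)! : ℂ)) := by
    rw [← Complex.ofReal_mul, Real.mul_self_sqrt (by positivity)]
    push_cast
    rfl
  have hmul : (∏ j, ((α j)! : ℂ)) * (Nat.multinomial Finset.univ α : ℂ) = (k ! : ℂ) := by
    rw [← hk]
    exact_mod_cast congrArg (Nat.cast (R := ℂ)) (Nat.multinomial_spec Finset.univ α)
  have hfac : (∏ j, ((α j)! : ℂ)) ≠ 0 :=
    Finset.prod_ne_zero_iff.2 fun j _ => by exact_mod_cast (Nat.factorial_pos _).ne'
  have hk0 : (k ! : ℂ) ≠ 0 := by exact_mod_cast (Nat.factorial_pos _).ne'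
  have ht' : (t : ℂ) ≠ 0 := by exact_mod_cast ht.ne'
  have hm : (Nat.multinomial Finset.univ α : ℂ) = (k ! : ℂ) / ∏ j, ((α j)! : ℂ) := by
    rw [eq_div_iff hfac, mul_comm, hmul]
  simp only [monomial, hk, map_mul, Complex.conj_ofReal, map_prod, map_pow]
  rw [mul_mul_mul_comm, hsq, hm, ← Finset.prod_mul_distrib]
  simp only [← mul_pow]
  field_simp

/-- `T_0^{(s)}` is the dilation `g ↦ g((1 - t/s) ·)`: expanding the exponential in the reproducing
formula for `g((1 - t/s) w)` into its power series gives `∑ₖ (1 - t/s)^k (P_k g)(w)`. -/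
theorem opT0_apply {s : ℝ} (hs : t / 2 < s) (g : Space n t X) (w : Fin n → ℂ) :
    opT0 n t X s g w = g (((1 - t / s : ℝ) : ℂ) • w) := by
  have ht0 := ht.out
  have hx := abs_one_sub_div_lt_one ht0 hs
  set x := 1 - t / s
  have hns := continuous_normSq (n := n)
  have h1 : HasSum (fun k => ((x ^ k : ℝ) : ℂ) * homProj n t X k g w) (opT0 n t X s g w) := by
    have := (hasSum_opT0 (n := n) (X := X) hs).mapL
      ((evalCLM t X w).comp (ContinuousLinearMap.apply ℂ (Space n t X) g))
    exact this
  set γ : (Fin n → ℂ) → ℂ := fun u => (Real.exp (-(normSq u / t)) : ℂ) with hγ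
  have h2 : ∀ k, ((x ^ k : ℝ) : ℂ) * homProj n t X k g w = (((Real.pi * t) ^ n)⁻¹ : ℝ) *
      ∫ u, g u * ((dot ((x : ℂ) • w) u / t) ^ k / (k ! : ℂ)) * γ u := by
    intro k
    have h3 : homProj n t X k g w =
        ∑ α ∈ Finset.piAntidiag (Finset.univ : Finset (Fin n)) k,
          pairing t g (monomial t α) * monomial t α w := by
      rw [← evalCLM_apply, homProj, sum_apply, map_sum]
      rfl
    rw [h3]
    simp only [pairing, mul_assoc]
    rw [← Finset.mul_sum, mul_left_comm]
    congr 1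
    simp only [← integral_mul_const]
    rw [← integral_finsetSum, ← integral_const_mul]
    · refine integral_congr_ae (Eventually.of_forall fun u => ?_)
      simp only
      have h4 : (dot ((x : ℂ) • w) u / t) ^ k / (k ! : ℂ) =
          ((x ^ k : ℝ) : ℂ) * ∑ α ∈ Finset.piAntidiag (Finset.univ : Finset (Fin n)) k,
            monomial t α w * conj (monomial t α u) := by
        rw [sum_monomial_mul_conj ht0, dot_smul_left, mul_div_assoc, mul_pow, Complex.ofReal_pow,
          mul_div_assoc]
      rw [h4]
      simp only [Finset.mul_sum, Finset.sum_mul]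
      refine Finset.sum_congr rfl fun α _ => ?_
      simp only [hγ]
      ring
    · intro α _
      have := g.memL.integrable_mul ht0 X.one_le_exponent
        (k := fun u => conj (monomial t α u))
        (Complex.continuous_conj.comp (monomial_differentiable t α).continuous)
        (by simpa only [Complex.norm_conj] using monomial_growth t α)
      refine (this.mul_const (monomial t α w)).congr (Eventually.of_forall fun u => ?_)
      simp only
      ring
  simp only [h2] at h1
  have h5 : HasSum (fun k => ∫ u, g u * ((dot ((x : ℂ) • w) u / t) ^ k / (k ! : ℂ)) * γ u)
      (∫ u, g u * conj (kernel t ((x : ℂ) • w) u) * γ u) := by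
    have hgm : Continuous (g : (Fin n → ℂ) → ℂ) := g.differentiable.continuous
    have hS : ∀ u : Fin n → ℂ, 0 ≤ ∑ j, ‖u j‖ := fun u =>
      Finset.sum_nonneg fun j _ => norm_nonneg _
    have hbs : ∀ u : Fin n → ℂ, HasSum (fun k : ℕ =>
        ‖g u‖ * ((‖(x : ℂ) • w‖ / t * ∑ j, ‖u j‖) ^ k / (k ! : ℝ)) * ‖γ u‖)
        (‖g u‖ * Real.exp (‖(x : ℂ) • w‖ / t * ∑ j, ‖u j‖) * ‖γ u‖) := fun u => by
      rw [Real.exp_eq_exp_ℝ]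
      exact ((NormedSpace.expSeries_div_hasSum_exp (𝔸 := ℝ) _).mul_left _).mul_right _
    refine hasSum_integral_of_dominated_convergence (fun k u =>
      ‖g u‖ * ((‖(x : ℂ) • w‖ / t * ∑ j, ‖u j‖) ^ k / (k ! : ℝ)) * ‖γ u‖) ?_ ?_ ?_ ?_ ?_
    · intro k
      exact Continuous.aestronglyMeasurable (by fun_prop)
    · intro k
      refine Eventually.of_forall fun u => ?_
      rw [norm_mul, norm_mul, norm_div, norm_pow, norm_div, Complex.norm_real,
        Real.norm_of_nonneg ht0.le, Complex.norm_natCast]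
      gcongr
      rw [← conj_dot, Complex.norm_conj, div_mul_eq_mul_div]
      exact div_le_div_of_nonneg_right (norm_dot_le u _) ht0.le
    · exact Eventually.of_forall fun u => (hbs u).summable
    · simp only [fun u => (hbs u).tsum_eq]
      refine (g.memL.integrable_mul ht0 X.one_le_exponent (by fun_prop)
        (exp_sum_norm_growth (‖(x : ℂ) • w‖ / t))).norm.congr (Eventually.of_forall fun u => ?_)
      simp only [norm_mul, hγ, Complex.norm_real, Real.norm_of_nonneg (Real.exp_pos _).le]
    · refine Eventually.of_forall fun u => ?_
      refine HasSum.mul_right _ (HasSum.mul_left _ ?_)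
      rw [conj_kernel, kernel, Complex.exp_eq_exp_ℂ]
      exact NormedSpace.expSeries_div_hasSum_exp _
  have h6 := h1.unique (h5.mul_left _)
  rw [h6]
  exact congrFun (Space.proj_eq g) ((x : ℂ) • w)

end Diagonal

/-! ### Nuclear representations over countable index types -/

section NuclearReps

variable {E : Type*} [NormedAddCommGroup E] [NormedSpace ℂ E] {ι : Type*}

/-- Summation of `F (x i) (y i)` over a countable index type is summation over `ℕ` after extending
both families by zero. -/
theorem hasSum_extend_iff {V W M : Type*} [Zero V] [Zero W] [AddCommMonoid M] [TopologicalSpace M]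
    {e : ι → ℕ} (he : Function.Injective e) (F : V → W → M) (hF : F 0 0 = 0) (x : ι → V)
    (y : ι → W) {a : M} :
    HasSum (fun j => F (Function.extend e x 0 j) (Function.extend e y 0 j)) a ↔
      HasSum (fun i => F (x i) (y i)) a := by
  have h : (fun j => F (Function.extend e x 0 j) (Function.extend e y 0 j)) =
      Function.extend e (fun i => F (x i) (y i)) 0 := by
    funext j
    by_cases hj : ∃ i, e i = j
    · obtain ⟨i, rfl⟩ := hj
      simp only [he.extend_apply]
    · simp only [Function.extend_apply' _ _ _ hj, Pi.zero_apply, hF]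
  rw [h, hasSum_extend_zero he]

theorem isNuclearRep_extend {e : ι → ℕ} (he : Function.Injective e) {A : E →L[ℂ] E} {x : ι → E}
    {ξ : ι → StrongDual ℂ E} (hs : Summable fun i => ‖x i‖ * ‖ξ i‖)
    (hA : ∀ v, HasSum (fun i => ξ i v • x i) (A v)) :
    IsNuclearRep A (Function.extend e x 0) (Function.extend e ξ 0) where
  summable := ((hasSum_extend_iff he (fun (a : E) (b : StrongDual ℂ E) => ‖a‖ * ‖b‖)
    (by simp) x ξ).2 hs.hasSum).summable
  hasSum v := (hasSum_extend_iff he (fun (a : E) (b : StrongDual ℂ E) => b v • a)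
    (by simp) x ξ).2 (hA v)

theorem nuclearNorm_le [Countable ι] {A : E →L[ℂ] E} {x : ι → E} {ξ : ι → StrongDual ℂ E}
    (hs : Summable fun i => ‖x i‖ * ‖ξ i‖) (hA : ∀ v, HasSum (fun i => ξ i v • x i) (A v)) :
    nuclearNorm A ≤ ENNReal.ofReal (∑' i, ‖x i‖ * ‖ξ i‖) := by
  obtain ⟨e, he⟩ := exists_injective_nat ι
  refine iInf_le_of_le (Function.extend e x 0) (iInf_le_of_le (Function.extend e ξ 0)
    (iInf_le_of_le (isNuclearRep_extend he hs hA) (le_of_eq ?_)))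
  rw [ENNReal.ofReal_tsum_of_nonneg (fun i => by positivity) hs]
  exact ((hasSum_extend_iff he (fun (a : E) (b : StrongDual ℂ E) =>
    ENNReal.ofReal (‖a‖ * ‖b‖)) (by simp) x ξ).2 ENNReal.summable.hasSum).tsum_eq

end NuclearReps

/-! ### Nuclearity of `T_0^{(s)}` -/

section NuclearT0

variable {n : ℕ} {t : ℝ} [ht : Fact (0 < t)] {X : Kind}

theorem rankOne_apply (α : Fin n → ℕ) (g : Space n t X) :
    rankOne t X α g = coeffFunctional t X α g • monomialVec t X α := rfl

theorem norm_smul_monomialVec_mul (x : ℝ) (α : Fin n → ℕ) :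
    ‖((x ^ (∑ j, α j) : ℝ) : ℂ) • monomialVec t X α‖ * ‖coeffFunctional t X α‖ =
      |x| ^ (∑ j, α j) * (‖monomialVec t X α‖ * ‖coeffFunctional t X α‖) := by
  rw [norm_smul, Complex.norm_real, Real.norm_eq_abs, abs_pow, mul_assoc]

theorem isNuclear_opT0 {s : ℝ} (hs : t / 2 < s) : IsNuclear (opT0 n t X s) := by
  obtain ⟨e, he⟩ := exists_injective_nat (Fin n → ℕ)
  refine ⟨_, _, isNuclearRep_extend he
    (x := fun α => (((1 - t / s) ^ (∑ j, α j) : ℝ) : ℂ) • monomialVec t X α)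
    (ξ := fun α => coeffFunctional t X α) ?_ fun v => ?_⟩
  · simp only [norm_smul_monomialVec_mul]
    exact summable_monomial_coeff n t X X (abs_one_sub_div_lt_one ht.out hs)
  · have h := (hasSum_rankOne (n := n) (X := X) hs).mapL
      (ContinuousLinearMap.apply ℂ (Space n t X) v)
    refine h.congr_fun fun α => ?_
    simp only [ContinuousLinearMap.apply_apply, smul_apply, rankOne_apply]
    rw [smul_comm]

/-- The remainders of the series of `T_0^{(s)}` have the nuclear representations with the
multi-indices of degree at least `N`. -/
theorem hasSum_rankOne_tail {s : ℝ} (hs : t / 2 < s) (N : ℕ) :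
    HasSum (fun α : Fin n → ℕ =>
        (if N ≤ ∑ j, α j then (((1 - t / s) ^ (∑ j, α j) : ℝ) : ℂ) else 0) • rankOne t X α)
      (opT0 n t X s - ∑ k ∈ Finset.range N, (((1 - t / s) ^ k : ℝ) : ℂ) • homProj n t X k) := by
  set c : ℕ → ℂ := fun k => if N ≤ k then (((1 - t / s) ^ k : ℝ) : ℂ) else 0 with hc
  have hsm : Summable fun α : Fin n → ℕ => c (∑ j, α j) • rankOne t X α := by
    refine Summable.of_norm_bounded
      (summable_pow_rankOne (t := t) (X := X) (abs_one_sub_div_lt_one ht.out hs)) fun α => ?_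
    rw [norm_smul]
    refine mul_le_mul_of_nonneg_right ?_ (norm_nonneg _)
    simp only [hc]
    split_ifs
    · exact le_rfl
    · rw [norm_zero]; exact norm_nonneg _
  have h1 := hasSum_homProj (c := c) hsm.hasSum
  have h2 : HasSum
      (fun k : ℕ => (if k < N then (((1 - t / s) ^ k : ℝ) : ℂ) else 0) • homProj n t X k)
      (∑ k ∈ Finset.range N, (((1 - t / s) ^ k : ℝ) : ℂ) • homProj n t X k) := by
    have h3 := hasSum_sum_of_ne_finset_zero (L := SummationFilter.unconditional ℕ)
      (s := Finset.range N)
      (f := fun k => (if k < N then (((1 - t / s) ^ k : ℝ) : ℂ) else 0) • homProj n t X k)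
      fun k hk => by rw [if_neg (by simpa using hk), zero_smul]
    convert h3 using 1
    refine Finset.sum_congr rfl fun k hk => ?_
    rw [if_pos (Finset.mem_range.1 hk)]
  have h3 := (hasSum_opT0 (n := n) (X := X) hs).sub h2
  have h4 : (fun k => (((1 - t / s) ^ k : ℝ) : ℂ) • homProj n t X k -
      (if k < N then (((1 - t / s) ^ k : ℝ) : ℂ) else 0) • homProj n t X k) =
      fun k => c k • homProj n t X k := by
    funext k
    rw [← sub_smul]
    congr 1
    simp only [hc]
    by_cases hk : k < N
    · rw [if_pos hk, if_neg (by omega), sub_self]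
    · rw [if_neg hk, if_pos (by omega), sub_zero]
  rw [h4] at h3
  rw [h3.unique h1]
  exact hsm.hasSum

theorem tendsto_nuclearNorm_opT0_sub {s : ℝ} (hs : t / 2 < s) :
    Tendsto (fun N : ℕ => nuclearNorm (opT0 n t X s -
      ∑ k ∈ Finset.range N, (((1 - t / s) ^ k : ℝ) : ℂ) • homProj n t X k)) atTop (𝓝 0) := by
  set x := 1 - t / s
  set b : (Fin n → ℕ) → ℝ := fun α =>
    |x| ^ (∑ j, α j) * (‖monomialVec t X α‖ * ‖coeffFunctional t X α‖) with hb
  have hbs : Summable b := summable_monomial_coeff n t X X (abs_one_sub_div_lt_one ht.out hs)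
  have hb0 : ∀ α, 0 ≤ b α := fun α => by positivity
  set v : ℕ → (Fin n → ℕ) → Space n t X := fun N α =>
    (if N ≤ ∑ j, α j then ((x ^ (∑ j, α j) : ℝ) : ℂ) else 0) • monomialVec t X α with hv
  have hvn : ∀ N α, ‖v N α‖ * ‖coeffFunctional t X α‖ = if N ≤ ∑ j, α j then b α else 0 := by
    intro N α
    simp only [hv]
    split_ifs
    · exact norm_smul_monomialVec_mul x α
    · rw [zero_smul, norm_zero, zero_mul]
  have hvs : ∀ N, Summable fun α => ‖v N α‖ * ‖coeffFunctional t X α‖ := fun N => by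
    simp only [hvn]
    refine Summable.of_nonneg_of_le (fun α => ?_) (fun α => ?_) hbs
    · split_ifs
      exacts [hb0 α, le_rfl]
    · split_ifs
      exacts [le_rfl, hb0 α]
  have hbound : ∀ N, nuclearNorm (opT0 n t X s -
      ∑ k ∈ Finset.range N, ((x ^ k : ℝ) : ℂ) • homProj n t X k) ≤
      ENNReal.ofReal (∑' α : Fin n → ℕ, if N ≤ ∑ j, α j then b α else 0) := fun N => by
    refine (nuclearNorm_le (hvs N) fun g => ?_).trans (le_of_eq (by simp only [hvn]))
    refine ((hasSum_rankOne_tail (n := n) (X := X) hs N).mapL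
      (ContinuousLinearMap.apply ℂ (Space n t X) g)).congr_fun fun α => ?_
    simp only [hv, ContinuousLinearMap.apply_apply, smul_apply, rankOne_apply]
    rw [smul_comm]
  have hlim : Tendsto (fun N => ∑' α : Fin n → ℕ, if N ≤ ∑ j, α j then b α else 0) atTop
      (𝓝 (∑' _ : Fin n → ℕ, (0 : ℝ))) := by
    refine tendsto_tsum_of_dominated_convergence hbs (fun α => ?_)
      (Eventually.of_forall fun N α => ?_)
    · refine tendsto_const_nhds.congr' ?_
      filter_upwards [eventually_gt_atTop (∑ j, α j)] with N hN
      rw [if_neg (by omega)]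
    · split_ifs
      · rw [Real.norm_of_nonneg (hb0 α)]
      · rw [norm_zero]; exact hb0 α
  rw [tsum_zero] at hlim
  have hlim2 := ENNReal.tendsto_ofReal hlim
  rw [ENNReal.ofReal_zero] at hlim2
  exact tendsto_of_tendsto_of_tendsto_of_le_of_le tendsto_const_nhds hlim2
    (fun N => bot_le) hbound

end NuclearT0

/-! ### The trace of `T_0^{(s)} B` along the monomials -/

section MonomialTrace

variable {n : ℕ} {t : ℝ} [ht : Fact (0 < t)] {X : Kind}

theorem integrable_weighted_monomial (α : Fin n → ℕ) : Integrable (weighted t (monomial t α)) :=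
  memLp_one_iff_integrable.1 (monomial_memLp ht.out α 1 le_rfl)

theorem synthesis_monomial (α : Fin n → ℕ) :
    synthesis t X (monomial t α) = monomialVec t X α := by
  refine Space.ext ?_
  rw [coe_synthesis (integrable_weighted_monomial α)]
  exact Space.proj_eq (monomialVec t X α)

theorem exists_integral_norm_weighted_monomial_eq (n : ℕ) (t : ℝ) [ht : Fact (0 < t)] :
    ∃ K : ℝ, ∀ α : Fin n → ℕ, ∫ w, ‖weighted t (monomial t α) w‖ =
      K * ‖monomialVec t (.lp 1 le_rfl) α‖ := by
  obtain ⟨K, hK, hKe⟩ := memLp_volume (n := n) ht.out (p := 1) le_rfl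
  refine ⟨K.toReal, fun α => ?_⟩
  rw [integral_norm_eq_lintegral_enorm (integrable_weighted_monomial α).1,
    ← eLpNorm_one_eq_lintegral_enorm, hKe, ENNReal.toReal_mul]
  rfl

/-- For a bounded operator `B`, the trace of `T_0^{(s)} B` along the monomials is a Gaussian
integral over the kernels, since `e_α = ∫ e_α(w) K_w dμ_t(w)` and `T_0^{(s)}` is a dilation. -/
theorem hasSum_trace_monomial {s : ℝ} (hs : t / 2 < s) (B : Space n t X →L[ℂ] Space n t X) :
    HasSum (fun α : Fin n → ℕ => (((1 - t / s) ^ (∑ j, α j) : ℝ) : ℂ) *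
        coeffFunctional t X α (B (monomialVec t X α)))
      ((((Real.pi * t) ^ n)⁻¹ : ℝ) * ∫ w, B (kernelVec t X w) (((1 - t / s : ℝ) : ℂ) • w) *
        (Real.exp (-(normSq w / t)) : ℂ)) := by
  have hx := abs_one_sub_div_lt_one ht.out hs
  set x := 1 - t / s with hxdef
  set γ : (Fin n → ℂ) → ℂ := fun w => (Real.exp (-(normSq w / t)) : ℂ) with hγ
  set F : (Fin n → ℕ) → (Fin n → ℂ) → ℂ := fun α w => ((x ^ (∑ j, α j) : ℝ) : ℂ) *
    (monomial t α w * γ w * coeffFunctional t X α (B (kernelVec t X w))) with hF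
  have hterm : ∀ α : Fin n → ℕ, ((x ^ (∑ j, α j) : ℝ) : ℂ) *
      coeffFunctional t X α (B (monomialVec t X α)) =
      (((Real.pi * t) ^ n)⁻¹ : ℝ) * ∫ w, F α w := fun α => by
    have h := apply_synthesis (X := X) (integrable_weighted_monomial (t := t) α)
      ((coeffFunctional t X α).comp B)
    rw [synthesis_monomial] at h
    simp only [hF]
    rw [integral_const_mul, mul_left_comm]
    exact congrArg _ h
  have hpt : ∀ w, HasSum (fun α => F α w) (B (kernelVec t X w) ((x : ℂ) • w) * γ w) := fun w => by
    have h := (hasSum_rankOne (n := n) (X := X) hs).mapL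
      ((evalCLM t X w).comp (ContinuousLinearMap.apply ℂ (Space n t X) (B (kernelVec t X w))))
    have h2 : evalCLM t X w (opT0 n t X s (B (kernelVec t X w))) =
      B (kernelVec t X w) ((x : ℂ) • w) := opT0_apply hs _ w
    have h3 := h.mul_right (γ w)
    rw [ContinuousLinearMap.comp_apply, ContinuousLinearMap.apply_apply, h2] at h3
    refine h3.congr_fun fun α => ?_
    simp only [hF, ContinuousLinearMap.comp_apply, ContinuousLinearMap.apply_apply,
      rankOne_apply, map_smul, evalCLM_apply, monomialVec_apply,
      smul_eq_mul]
    ring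
  have hint : ∀ α, Integrable (F α) := fun α => by
    have h := (integrable_smul_kernelVec (X := X) (integrable_weighted_monomial (t := t) α))
    have h2 := (((coeffFunctional t X α).comp B).integrable_comp h).const_mul
      ((x ^ (∑ j, α j) : ℝ) : ℂ)
    refine h2.congr (Eventually.of_forall fun w => ?_)
    simp [hF, hγ]
  -- by `norm_kernelVec` only the norm of `e_α` in `F_t^1` enters, whatever the space `X`
  obtain ⟨K, hK⟩ := exists_integral_norm_weighted_monomial_eq n t
  have hsum : Summable fun α => ∫ w, ‖F α w‖ := by
    refine Summable.of_nonneg_of_le (fun α => integral_nonneg fun w => norm_nonneg _) (fun α => ?_)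
      ((summable_monomial_coeff n t (.lp 1 le_rfl) X hx).mul_left
        (K * (‖B‖ * ‖kernelVec t X (0 : Fin n → ℂ)‖)))
    have h1 : ∀ w, ‖F α w‖ ≤ |x| ^ (∑ j, α j) * (‖coeffFunctional t X α‖ *
        (‖B‖ * ‖kernelVec t X (0 : Fin n → ℂ)‖)) * ‖weighted t (monomial t α) w‖ := fun w => by
      have h2 : ‖coeffFunctional t X α (B (kernelVec t X w))‖ ≤ ‖coeffFunctional t X α‖ *
          (‖B‖ * (Real.exp (normSq w / (2 * t)) * ‖kernelVec t X (0 : Fin n → ℂ)‖)) := by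
        rw [← norm_kernelVec]
        exact ((coeffFunctional t X α).le_opNorm _).trans
          (mul_le_mul_of_nonneg_left (B.le_opNorm _) (norm_nonneg _))
      have h3 : Real.exp (-(normSq w / (2 * t))) * Real.exp (normSq w / (2 * t)) = 1 := by
        rw [← Real.exp_add, neg_add_cancel, Real.exp_zero]
      simp only [hF, hγ]
      rw [norm_mul, norm_mul, norm_mul, Complex.norm_real, Complex.norm_real, Real.norm_eq_abs,
        abs_pow, Real.norm_of_nonneg (Real.exp_pos _).le, norm_weighted, exp_neg_normSq t w]
      calc |x| ^ (∑ j, α j) * (‖monomial t α w‖ *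
            (Real.exp (-(normSq w / (2 * t))) * Real.exp (-(normSq w / (2 * t)))) *
            ‖coeffFunctional t X α (B (kernelVec t X w))‖)
          ≤ |x| ^ (∑ j, α j) * (‖monomial t α w‖ *
            (Real.exp (-(normSq w / (2 * t))) * Real.exp (-(normSq w / (2 * t)))) *
            (‖coeffFunctional t X α‖ * (‖B‖ * (Real.exp (normSq w / (2 * t)) *
              ‖kernelVec t X (0 : Fin n → ℂ)‖)))) := by gcongr
        _ = |x| ^ (∑ j, α j) * (‖coeffFunctional t X α‖ *
            (‖B‖ * ‖kernelVec t X (0 : Fin n → ℂ)‖)) * (‖monomial t α w‖ *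
            Real.exp (-(normSq w / (2 * t)))) *
            (Real.exp (-(normSq w / (2 * t))) * Real.exp (normSq w / (2 * t))) := by ring
        _ = _ := by rw [h3, mul_one]
    refine (integral_mono (hint α).norm
      ((integrable_weighted_monomial α).norm.const_mul _) h1).trans (le_of_eq ?_)
    rw [integral_const_mul, hK]
    ring
  have h := (hasSum_integral_of_summable_integral_norm hint hsum).mul_left
    ((((Real.pi * t) ^ n)⁻¹ : ℝ) : ℂ)
  simp only [fun w => (hpt w).tsum_eq] at h
  simpa only [hterm] using h

end MonomialTrace

/-! ### Uniqueness of the nuclear trace from approximation -/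

section TraceUniqueness

variable {E : Type*} [NormedAddCommGroup E] [NormedSpace ℂ E]

/-- The sum `∑ⱼ ξⱼ(S xⱼ)` over a nuclear representation of `A` depends only on `A`. -/
def DeterminesTrace (S : E →L[ℂ] E) : Prop :=
  ∀ (A : E →L[ℂ] E), ∃ τ : ℂ, ∀ (x : ℕ → E) (ξ : ℕ → StrongDual ℂ E),
    IsNuclearRep A x ξ → ∑' j, ξ j (S (x j)) = τ

/-- A form of the bounded approximation property: on finite sets, the identity is approximated by
uniformly bounded operators for which traces of products are well defined. -/
def HasTraceApproximation (E : Type*) [NormedAddCommGroup E] [NormedSpace ℂ E] : Prop :=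
  ∃ C : ℝ, ∀ (V : Finset E) (ε : ℝ), 0 < ε → ∃ S : E →L[ℂ] E,
    ‖S‖ ≤ C ∧ (∀ v ∈ V, ‖S v - v‖ ≤ ε) ∧ DeterminesTrace S

theorem norm_dual_apply_le {S : E →L[ℂ] E} {C : ℝ} (hS : ‖S‖ ≤ C) (x : E)
    (ξ : StrongDual ℂ E) : ‖ξ (S x)‖ ≤ C * (‖x‖ * ‖ξ‖) := by
  calc ‖ξ (S x)‖ ≤ ‖ξ‖ * (C * ‖x‖) :=
        (ξ.le_opNorm _).trans (mul_le_mul_of_nonneg_left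
          ((S.le_opNorm _).trans (mul_le_mul_of_nonneg_right hS (norm_nonneg _)))
          (norm_nonneg _))
    _ = _ := by ring

theorem IsNuclearRep.summable_trace {A : E →L[ℂ] E} {x : ℕ → E} {ξ : ℕ → StrongDual ℂ E}
    (h : IsNuclearRep A x ξ) : Summable fun j => ξ j (x j) :=
  Summable.of_norm_bounded h.summable fun j => by
    rw [mul_comm]; exact (ξ j).le_opNorm _

theorem IsNuclearRep.tendsto_trace {A : E →L[ℂ] E} {x : ℕ → E} {ξ : ℕ → StrongDual ℂ E}
    (h : IsNuclearRep A x ξ) {S : ℕ → E →L[ℂ] E} {C : ℝ} (hS : ∀ m, ‖S m‖ ≤ C)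
    (hx : ∀ j, Tendsto (fun m => S m (x j)) atTop (𝓝 (x j))) :
    Tendsto (fun m => ∑' j, ξ j (S m (x j))) atTop (𝓝 (∑' j, ξ j (x j))) :=
  tendsto_tsum_of_dominated_convergence (h.summable.mul_left C)
    (fun j => ((ξ j).continuous.tendsto _).comp (hx j))
    (Eventually.of_forall fun m j => norm_dual_apply_le (hS m) (x j) (ξ j))

/-- The sums `∑ⱼ ξⱼ(S_m xⱼ)` along approximating operators `S_m` are the same for two nuclear
representations of an operator, and converge to the traces of the two by dominated convergence. It
is enough that `S_m → 1` on the countably many vectors that occur. -/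
theorem HasTraceApproximation.trace_eq (hE : HasTraceApproximation E) {A : E →L[ℂ] E}
    {x y : ℕ → E} {ξ η : ℕ → StrongDual ℂ E} (h₁ : IsNuclearRep A x ξ)
    (h₂ : IsNuclearRep A y η) : ∑' j, ξ j (x j) = ∑' j, η j (y j) := by
  classical
  obtain ⟨C, hC⟩ := hE
  have h := fun m : ℕ => hC ((Finset.range m).image x ∪ (Finset.range m).image y)
    (1 / ((m : ℝ) + 1)) (by positivity)
  choose S hSC hSv hSd using h
  have hlim : ∀ v : E, (∃ j, ∀ m > j, ‖S m v - v‖ ≤ 1 / ((m : ℝ) + 1)) →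
      Tendsto (fun m => S m v) atTop (𝓝 v) := by
    rintro v ⟨j, hj⟩
    refine tendsto_iff_norm_sub_tendsto_zero.2 ?_
    refine squeeze_zero' (Eventually.of_forall fun m => norm_nonneg _) ?_
      tendsto_one_div_add_atTop_nhds_zero_nat
    filter_upwards [eventually_gt_atTop j] with m hm using hj m hm
  have hx := h₁.tendsto_trace hSC fun j => hlim _ ⟨j, fun m hm => hSv m _ (Finset.mem_union_left _
    (Finset.mem_image_of_mem x (Finset.mem_range.2 hm)))⟩
  have hy := h₂.tendsto_trace hSC fun j => hlim _ ⟨j, fun m hm => hSv m _ (Finset.mem_union_right _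
    (Finset.mem_image_of_mem y (Finset.mem_range.2 hm)))⟩
  refine tendsto_nhds_unique hx (hy.congr fun m => ?_)
  obtain ⟨τ, hτ⟩ := hSd m A
  rw [hτ x ξ h₁, hτ y η h₂]

theorem HasTraceApproximation.hasNuclearTrace (hE : HasTraceApproximation E) {A : E →L[ℂ] E}
    {ι : Type*} [Countable ι] {x : ι → E} {ξ : ι → StrongDual ℂ E}
    (hs : Summable fun i => ‖x i‖ * ‖ξ i‖) (hA : ∀ v, HasSum (fun i => ξ i v • x i) (A v))
    {τ : ℂ} (hτ : HasSum (fun i => ξ i (x i)) τ) : HasNuclearTrace A τ := by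
  obtain ⟨e, he⟩ := exists_injective_nat ι
  have hr := isNuclearRep_extend he hs hA
  refine ⟨⟨_, _, hr⟩, fun y η hy => ?_⟩
  have h1 := (hasSum_extend_iff he (fun (a : E) (b : StrongDual ℂ E) => b a) (by simp) x ξ).2 hτ
  rw [← h1.tsum_eq, hE.trace_eq hr hy]
  exact hy.summable_trace.hasSum

/-- If `S = ∑ᵢ yᵢ ⊗ ηᵢ` has finite rank, then `∑ⱼ ξⱼ(S xⱼ) = ∑ᵢ ηᵢ(A yᵢ)` for every nuclear
representation of `A`. -/
theorem determinesTrace_sum_smulRight {ι : Type*} (I : Finset ι) (η : ι → StrongDual ℂ E)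
    (y : ι → E) : DeterminesTrace (∑ i ∈ I, (η i).smulRight (y i)) := by
  refine fun A => ⟨∑ i ∈ I, η i (A (y i)), fun x ξ h => ?_⟩
  have h1 : HasSum (fun j => ∑ i ∈ I, η i (ξ j (y i) • x j)) (∑ i ∈ I, η i (A (y i))) :=
    hasSum_sum fun i _ => (h.hasSum (y i)).mapL (η i)
  rw [← h1.tsum_eq]
  refine tsum_congr fun j => ?_
  simp only [sum_apply, ContinuousLinearMap.smulRight_apply, map_sum, map_smul, smul_eq_mul]
  exact Finset.sum_congr rfl fun i _ => mul_comm _ _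

end TraceUniqueness

/-! ### Approximation by localized superpositions of kernels -/

theorem weighted_indicator {n : ℕ} (t : ℝ) (s : Set (Fin n → ℂ)) (g : (Fin n → ℂ) → ℂ) :
    weighted t (s.indicator g) = s.indicator (weighted t g) := by
  funext w
  by_cases hw : w ∈ s <;> simp [weighted, hw]

theorem MemL.indicator {n : ℕ} {t : ℝ} {p : ℝ≥0∞} {g : (Fin n → ℂ) → ℂ} (hg : MemL t p g)
    {s : Set (Fin n → ℂ)} (hs : MeasurableSet s) : MemL t p (s.indicator g) := by
  unfold MemL
  rw [weighted_indicator]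
  exact MemLp.indicator hs hg

section Truncation

variable {n : ℕ} {t : ℝ} [ht : Fact (0 < t)] {X : Kind}

theorem MemL.proj_sub {p : ℝ≥0∞} (hp : 1 ≤ p) {g h : (Fin n → ℂ) → ℂ} (hg : MemL t p g)
    (hh : MemL t p h) : proj t (g - h) = proj t g - proj t h := by
  funext z
  rw [Pi.sub_apply]
  simp only [proj, pairing]
  rw [← mul_sub, ← integral_sub (hg.integrable_proj ht.out hp z) (hh.integrable_proj ht.out hp z)]
  congr 2
  funext w
  simp only [Pi.sub_apply]
  ring

theorem integrable_weighted_indicator {s : Set (Fin n → ℂ)} (hs : MeasurableSet s)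
    (hsv : volume s ≠ ∞) (g : Space n t X) : Integrable (weighted t (s.indicator g)) := by
  obtain ⟨C, hC0, hC⟩ := exists_norm_weighted_le n t X
  rw [weighted_indicator, integrable_indicator_iff hs]
  exact Measure.integrableOn_of_bounded hsv
    (continuous_weighted t g.differentiable.continuous).aestronglyMeasurable
    (Eventually.of_forall (hC g))

/-- `‖P_t h‖ ≤ C ‖h‖` for the norm of the Fock space, as long as `P_t h` is an element of it. -/
theorem exists_norm_le_of_coe_eq_proj (n : ℕ) (t : ℝ) [ht : Fact (0 < t)] (X : Kind) :
    ∃ C : ℝ, 0 ≤ C ∧ ∀ (G : Space n t X) (h : (Fin n → ℂ) → ℂ), MemL t X.exponent h →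
      (G : (Fin n → ℂ) → ℂ) = proj t h → ‖G‖ ≤ C * (eNormL t X.exponent h).toReal := by
  obtain ⟨C, hC0, hC⟩ := exists_eNormL_proj_le n ht.out X.one_le_exponent
  refine ⟨C, hC0, fun G h hh hG => ?_⟩
  rw [Space.norm_def, hG, ← ENNReal.toReal_ofReal_mul _ _ hC0]
  exact ENNReal.toReal_mono (ENNReal.mul_ne_top ENNReal.ofReal_ne_top hh.2.ne)
    (hC h (hh.memLp_volume ht.out X.one_le_exponent).1)

/-- The operator `g ↦ ∫_s g(w) K_w dμ_t(w)`, that is `P_t` applied to the truncation of `g` to a set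
`s` of finite measure. -/
def truncation (t : ℝ) [Fact (0 < t)] (X : Kind) (s : Set (Fin n → ℂ)) (hs : MeasurableSet s)
    (hsv : volume s ≠ ∞) : Space n t X →L[ℂ] Space n t X :=
  LinearMap.mkContinuousOfExistsBound
    { toFun := fun g => synthesis t X (s.indicator g)
      map_add' := fun g h => by
        rw [synthesis, synthesis, synthesis, ← smul_add, ← integral_add
          (integrable_smul_kernelVec (integrable_weighted_indicator hs hsv g))
          (integrable_smul_kernelVec (integrable_weighted_indicator hs hsv h))]
        congr 2
        funext w
        rw [← add_smul, ← add_mul, Space.coe_add, Set.indicator_add', Pi.add_apply]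
      map_smul' := fun c g => by
        rw [synthesis, synthesis, RingHom.id_apply, smul_comm c, ← integral_smul c]
        congr 2
        funext w
        rw [smul_smul, ← mul_assoc, Space.coe_smul]
        congr 2
        by_cases hw : w ∈ s <;> simp [hw] }
    (by
      obtain ⟨C, hC0, hC⟩ := exists_norm_le_of_coe_eq_proj n t X
      refine ⟨C, fun g => ?_⟩
      refine (hC _ _ (g.memL.indicator hs)
        (coe_synthesis (integrable_weighted_indicator hs hsv g))).trans ?_
      refine mul_le_mul_of_nonneg_left ?_ hC0
      rw [Space.norm_def]
      refine ENNReal.toReal_mono g.memL.2.ne ?_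
      rw [eNormL, weighted_indicator]
      exact eLpNorm_indicator_le _)

variable {s : Set (Fin n → ℂ)} (hs : MeasurableSet s) (hsv : volume s ≠ ∞)

theorem coe_truncation (g : Space n t X) :
    (truncation t X s hs hsv g : (Fin n → ℂ) → ℂ) = proj t (s.indicator g) :=
  coe_synthesis (integrable_weighted_indicator hs hsv g)

theorem exists_norm_truncation_le (n : ℕ) (t : ℝ) [ht : Fact (0 < t)] (X : Kind) :
    ∃ C : ℝ, 0 ≤ C ∧ ∀ (s : Set (Fin n → ℂ)) (hs : MeasurableSet s) (hsv : volume s ≠ ∞),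
      ‖truncation t X s hs hsv‖ ≤ C ∧ ∀ g : Space n t X,
        ‖truncation t X s hs hsv g - g‖ ≤ C * (eLpNorm (sᶜ.indicator (weighted t g)) X.exponent
          (scaledVolume n t X.exponent)).toReal := by
  obtain ⟨C, hC0, hC⟩ := exists_norm_le_of_coe_eq_proj n t X
  refine ⟨C, hC0, fun s hs hsv => ⟨?_, fun g => ?_⟩⟩
  · refine ContinuousLinearMap.opNorm_le_bound _ hC0 fun g => ?_
    refine (hC _ _ (g.memL.indicator hs) (coe_truncation hs hsv g)).trans ?_
    refine mul_le_mul_of_nonneg_left ?_ hC0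
    rw [Space.norm_def]
    refine ENNReal.toReal_mono g.memL.2.ne ?_
    rw [eNormL, weighted_indicator]
    exact eLpNorm_indicator_le _
  · have h1 : (g - truncation t X s hs hsv g : Space n t X) =
        proj t (sᶜ.indicator (g : (Fin n → ℂ) → ℂ)) := by
      rw [Set.indicator_compl, MemL.proj_sub X.one_le_exponent g.memL (g.memL.indicator hs),
        Space.proj_eq, ← coe_truncation hs hsv g]
      rfl
    rw [norm_sub_rev, ← weighted_indicator]
    exact hC _ _ (g.memL.indicator hs.compl) h1

/-- For the truncation `S` to `s` and every nuclear representation of `A`, the sum `∑ⱼ ξⱼ(S xⱼ)` is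
`∫_s (A K_w)(w) dμ_t(w)`. -/
theorem determinesTrace_truncation : DeterminesTrace (truncation t X s hs hsv) := by
  intro A
  obtain ⟨C, hC0, hC⟩ := exists_norm_weighted_le n t X
  set γ : (Fin n → ℂ) → ℂ := fun w => (Real.exp (-(normSq w / t)) : ℂ) with hγ
  refine ⟨(((Real.pi * t) ^ n)⁻¹ : ℝ) * ∫ w, s.indicator (fun w => γ w * A (kernelVec t X w) w) w,
    fun x ξ h => ?_⟩
  set F : ℕ → (Fin n → ℂ) → ℂ := fun j w =>
    s.indicator (x j) w * γ w * ξ j (kernelVec t X w) with hF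
  have hterm : ∀ j, ξ j (truncation t X s hs hsv (x j)) =
      (((Real.pi * t) ^ n)⁻¹ : ℝ) * ∫ w, F j w := fun j =>
    apply_synthesis (integrable_weighted_indicator hs hsv (x j)) (ξ j)
  have hint : ∀ j, Integrable (F j) := fun j => by
    have h1 := (ξ j).integrable_comp
      (integrable_smul_kernelVec (X := X) (integrable_weighted_indicator hs hsv (x j)))
    refine h1.congr (Eventually.of_forall fun w => ?_)
    simp [hF, hγ]
  set k₀ := ‖kernelVec t X (0 : Fin n → ℂ)‖
  have hbd : ∀ j w, ‖F j w‖ ≤ s.indicator (fun _ => C * k₀ * (‖x j‖ * ‖ξ j‖)) w := fun j w => by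
    by_cases hw : w ∈ s
    · simp only [hF, Set.indicator_of_mem hw]
      have h2 : ‖ξ j (kernelVec t X w)‖ ≤ ‖ξ j‖ * (Real.exp (normSq w / (2 * t)) * k₀) := by
        rw [← norm_kernelVec]; exact (ξ j).le_opNorm _
      have h3 : Real.exp (-(normSq w / (2 * t))) * Real.exp (normSq w / (2 * t)) = 1 := by
        rw [← Real.exp_add, neg_add_cancel, Real.exp_zero]
      have h4 := hC (x j) w
      rw [norm_weighted] at h4
      rw [norm_mul, norm_mul, hγ, Complex.norm_real, Real.norm_of_nonneg (Real.exp_pos _).le,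
        exp_neg_normSq t w]
      calc ‖x j w‖ * (Real.exp (-(normSq w / (2 * t))) * Real.exp (-(normSq w / (2 * t)))) *
            ‖ξ j (kernelVec t X w)‖
          ≤ ‖x j w‖ * (Real.exp (-(normSq w / (2 * t))) * Real.exp (-(normSq w / (2 * t)))) *
            (‖ξ j‖ * (Real.exp (normSq w / (2 * t)) * k₀)) :=
            mul_le_mul_of_nonneg_left h2 (by positivity)
        _ = (‖x j w‖ * Real.exp (-(normSq w / (2 * t)))) * (‖ξ j‖ * k₀) *
            (Real.exp (-(normSq w / (2 * t))) * Real.exp (normSq w / (2 * t))) := by ring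
        _ ≤ (C * ‖x j‖) * (‖ξ j‖ * k₀) * 1 := by
            rw [h3]
            gcongr
        _ = _ := by ring
    · simp [hF, Set.indicator_of_notMem hw]
  have hsum : Summable fun j => ∫ w, ‖F j w‖ := by
    refine Summable.of_nonneg_of_le (fun j => integral_nonneg fun w => norm_nonneg _) (fun j => ?_)
      (h.summable.mul_left (volume.real s * (C * k₀)))
    have hi : Integrable (s.indicator fun _ : Fin n → ℂ => C * k₀ * (‖x j‖ * ‖ξ j‖)) :=
      (integrable_indicator_iff hs).2 (integrableOn_const hsv)
    refine (integral_mono (hint j).norm hi (hbd j)).trans (le_of_eq ?_)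
    rw [integral_indicator_const _ hs, smul_eq_mul]
    ring
  have hpt : ∀ w, ∑' j, F j w = s.indicator (fun w => γ w * A (kernelVec t X w) w) w := fun w => by
    by_cases hw : w ∈ s
    · have h5 := ((h.hasSum (kernelVec t X w)).mapL (evalCLM t X w)).mul_left (γ w)
      rw [Set.indicator_of_mem hw]
      refine (h5.congr_fun fun j => ?_).tsum_eq
      simp only [hF, Set.indicator_of_mem hw, map_smul, evalCLM_apply, smul_eq_mul]
      ring
    · simp [hF, Set.indicator_of_notMem hw]
  have h6 := (hasSum_integral_of_summable_integral_norm hint hsum).mul_left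
    ((((Real.pi * t) ^ n)⁻¹ : ℝ) : ℂ)
  simp only [hpt, ← hterm] at h6
  exact h6.tsum_eq

/-- If finitely many elements of the space are simultaneously concentrated on sets of finite
measure, truncations approximate the identity. -/
theorem hasTraceApproximation_of_tight
    (H : ∀ (V : Finset (Space n t X)) (ε : ℝ), 0 < ε → ∃ s : Set (Fin n → ℂ), MeasurableSet s ∧
      volume s ≠ ∞ ∧ ∀ v ∈ V, eLpNorm (sᶜ.indicator (weighted t v)) X.exponent
        (scaledVolume n t X.exponent) ≤ ENNReal.ofReal ε) :
    HasTraceApproximation (Space n t X) := by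
  obtain ⟨C, hC0, hC⟩ := exists_norm_truncation_le n t X
  refine ⟨C, fun V ε hε => ?_⟩
  obtain ⟨s, hs, hsv, hV⟩ := H V (ε / (C + 1)) (by positivity)
  refine ⟨truncation t X s hs hsv, (hC s hs hsv).1, fun v hv => ?_,
    determinesTrace_truncation hs hsv⟩
  refine ((hC s hs hsv).2 v).trans ?_
  have h1 := ENNReal.toReal_mono ENNReal.ofReal_ne_top (hV v hv)
  rw [ENNReal.toReal_ofReal (by positivity)] at h1
  refine (mul_le_mul_of_nonneg_left h1 hC0).trans ?_
  rw [← mul_div_assoc, div_le_iff₀ (by positivity)]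
  nlinarith

theorem volume_ne_top_of_scaledVolume {p : ℝ≥0∞} (hp : 1 ≤ p)
    {s : Set (Fin n → ℂ)} (hs : scaledVolume n t p s ≠ ∞) : volume s ≠ ∞ := by
  intro h
  refine hs ?_
  rw [scaledVolume, Measure.smul_apply, h, smul_eq_mul,
    ENNReal.mul_top (normConst_ne_zero ht.out hp)]

/-- For `p < ∞`, finite subsets of `L^p` are tight. -/
theorem hasTraceApproximation_of_ne_top {p : ℝ≥0∞} (hp : 1 ≤ p) (hpt : p ≠ ∞) :
    HasTraceApproximation (Space n t (.lp p hp)) := by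
  refine hasTraceApproximation_of_tight fun V ε hε => ?_
  have h := unifTight_finite (ι := V) (p := p) (μ := scaledVolume n t p) hpt
    (f := fun v => weighted t v.1) fun v => v.1.memL
  obtain ⟨s, hs, hsv, hV⟩ := h.exists_measurableSet_indicator (ε := ENNReal.ofReal ε)
    (by simpa using hε)
  exact ⟨s, hs, volume_ne_top_of_scaledVolume hp hsv.ne, fun v hv => hV ⟨v, hv⟩⟩

/-- In `f_t^∞`, finitely many elements are uniformly small off a compact set. -/
theorem hasTraceApproximation_vanishing : HasTraceApproximation (Space n t .vanishing) := by
  refine hasTraceApproximation_of_tight fun V ε hε => ?_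
  have h1 : ∀ᶠ w in cocompact (Fin n → ℂ), ∀ v ∈ V, ‖weighted t v w‖ < ε := by
    refine (Finset.eventually_all V).2 fun v _ => ?_
    have h2 := (show ↥(submodule n t .vanishing) from v).2.2.2 rfl
    filter_upwards [Metric.tendsto_nhds.1 h2 ε hε] with w hw
    have h3 : ‖weighted t v w‖ < ε := by
      have h4 := hw
      rw [dist_zero_right] at h4
      exact h4
    exact h3
  obtain ⟨K, hK, hKs⟩ := mem_cocompact.1 h1
  refine ⟨K, hK.measurableSet, hK.measure_lt_top.ne, fun v hv => ?_⟩
  change eLpNorm _ ∞ _ ≤ _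
  rw [eLpNorm_exponent_top]
  refine eLpNormEssSup_le_of_ae_enorm_bound (Eventually.of_forall fun w => ?_)
  rw [← ofReal_norm]
  refine ENNReal.ofReal_le_ofReal ?_
  by_cases hw : w ∈ Kᶜ
  · rw [Set.indicator_of_mem hw]
    exact (hKs hw v hv).le
  · rw [Set.indicator_of_notMem hw, norm_zero]
    exact hε.le

end Truncation

/-! ### Approximation by sampling in `F_t^∞` -/

/-- A bounded measurable map into a proper space is uniformly approximated by simple functions whose
values are values of the map itself. -/
theorem exists_finite_sampling {α F : Type*} [MeasurableSpace α] [Nonempty α] [PseudoMetricSpace F]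
    [ProperSpace F] [MeasurableSpace F] [OpensMeasurableSpace F] {H : α → F} (hm : Measurable H)
    (hb : Bornology.IsBounded (Set.range H)) {ε : ℝ} (hε : 0 < ε) :
    ∃ (N : ℕ) (p : ℕ → α) (i : α → ℕ), Measurable i ∧ (∀ u, i u < N) ∧
      ∀ u, dist (H (p (i u))) (H u) ≤ ε := by
  obtain ⟨T, hTs, hT, hcov⟩ := Metric.finite_approx_of_totallyBounded
    (hb.isCompact_closure.totallyBounded.subset subset_closure) ε hε
  have hne : T.Nonempty := by
    obtain ⟨u⟩ := ‹Nonempty α›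
    have h1 := hcov ⟨u, rfl⟩
    simp only [Set.mem_iUnion] at h1
    exact ⟨_, h1.choose_spec.choose⟩
  obtain ⟨e, rfl⟩ := hT.countable.exists_eq_range hne
  have he : ∀ k, ∃ u, H u = e k := fun k => hTs ⟨k, rfl⟩
  choose p hp using he
  choose! k hk using fun (y : F) (hy : y ∈ Set.range e) => hy
  obtain ⟨N, hN⟩ := (hT.image k).bddAbove
  refine ⟨N + 1, p, fun u => SimpleFunc.nearestPtInd e N (H u),
    (SimpleFunc.measurable _).comp hm,
    fun u => Nat.lt_succ_of_le (SimpleFunc.nearestPtInd_le e N _), fun u => ?_⟩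
  have h1 := hcov ⟨u, rfl⟩
  simp only [Set.mem_iUnion] at h1
  obtain ⟨y, hy, hyu⟩ := h1
  have h2 := SimpleFunc.edist_nearestPt_le e (H u) (hN ⟨y, hy, rfl⟩)
  rw [hk y hy, edist_dist, edist_dist, ENNReal.ofReal_le_ofReal_iff dist_nonneg] at h2
  rw [hp]
  refine h2.trans ?_
  rw [dist_comm]
  exact (Metric.mem_ball.1 hyu).le

section Sampling

variable {n : ℕ} {t : ℝ}

theorem eNormL_top_le {h : (Fin n → ℂ) → ℂ} {c : ℝ}
    (hh : ∀ w, ‖weighted t h w‖ ≤ c) : eNormL t ∞ h ≤ ENNReal.ofReal c := by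
  rw [eNormL, eLpNorm_exponent_top]
  exact eLpNormEssSup_le_of_ae_bound (Eventually.of_forall hh)

theorem memL_top_of_weighted_eq {h k : (Fin n → ℂ) → ℂ} {c : ℝ} (hk : Measurable k)
    (hkc : ∀ w, ‖k w‖ ≤ c) (hw : weighted t h = k) : MemL t ∞ h := by
  unfold MemL
  rw [hw]
  exact memLp_top_of_bound hk.aestronglyMeasurable c (Eventually.of_forall hkc)

/-- The function `k(w) e^{|w|²/(2t)}`, whose weighted version is `k`. -/
def unweighted (t : ℝ) (k : (Fin n → ℂ) → ℂ) (w : Fin n → ℂ) : ℂ :=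
  k w * (Real.exp (normSq w / (2 * t)) : ℂ)

theorem weighted_unweighted (k : (Fin n → ℂ) → ℂ) : weighted t (unweighted t k) = k := by
  funext w
  rw [weighted, unweighted, mul_assoc, ← Complex.ofReal_mul, ← Real.exp_add, add_neg_cancel,
    Real.exp_zero, Complex.ofReal_one, mul_one]

/-- For finitely many `v`, take a partition of `ℂⁿ` into finitely many sets `B_i`, with points `p_i`
such that `v(w) e^{-|w|²/(2t)}` varies little between `p_i` and the points of `B_i`. The
approximating operator is the projection of the step function
`∑_i v(p_i) e^{-|p_i|²/(2t)} 1_{B_i} e^{|·|²/(2t)}`; it has finite rank. -/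
theorem hasTraceApproximation_top (ht' : Fact (0 < t)) (h : (1 : ℝ≥0∞) ≤ ∞) :
    HasTraceApproximation (Space n t (.lp ∞ h)) := by
  have ht := ht'.out
  obtain ⟨C, hC0, hC⟩ := exists_norm_weighted_le n t (.lp ∞ h)
  obtain ⟨P, hP0, hP⟩ := exists_norm_le_of_coe_eq_proj n t (.lp ∞ h)
  refine ⟨P * C, fun V ε hε => ?_⟩
  set H : (Fin n → ℂ) → (V → ℂ) := fun w v => weighted t (v : Space n t (.lp ∞ h)) w with hH
  have hHm : Measurable H := measurable_pi_lambda _ fun v =>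
    (continuous_weighted t v.1.differentiable.continuous).measurable
  have hHb : Bornology.IsBounded (Set.range H) := by
    refine Bornology.IsBounded.subset (Metric.isBounded_closedBall (x := 0)
      (r := ∑ v : V, C * ‖(v : Space n t (.lp ∞ h))‖)) ?_
    rintro _ ⟨w, rfl⟩
    rw [mem_closedBall_zero_iff, pi_norm_le_iff_of_nonneg (by positivity)]
    intro v
    exact (hC v w).trans (Finset.single_le_sum
      (f := fun v : V => C * ‖(v : Space n t (.lp ∞ h))‖) (fun i _ => by positivity)
      (Finset.mem_univ v))
  obtain ⟨N, p, i, hi, hiN, hdist⟩ := exists_finite_sampling hHm hHb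
    (ε := ε / (P + 1)) (by positivity)
  set b : ℕ → (Fin n → ℂ) → ℂ := fun j => unweighted t ((i ⁻¹' {j}).indicator 1) with hb
  have hbm : ∀ j, MemL t ∞ (b j) := fun j => by
    refine memL_top_of_weighted_eq (c := 1)
      (measurable_one.indicator (hi (measurableSet_singleton j))) (fun w => ?_)
      (weighted_unweighted _)
    refine (norm_indicator_le_norm_self _ _).trans ?_
    simp
  set y : ℕ → Space n t (.lp ∞ h) := fun j =>
    Space.ofMemL ∞ h (proj t (b j)) ((hbm j).differentiable_proj ht h)
      ⟨by
        exact (continuous_weighted t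
          ((hbm j).differentiable_proj ht h).continuous).aestronglyMeasurable,
      by
        obtain ⟨Q, hQ0, hQ⟩ := exists_eNormL_proj_le n ht h
        exact (hQ _ ((hbm j).memLp_volume ht h).1).trans_lt
          (ENNReal.mul_lt_top ENNReal.ofReal_lt_top (hbm j).2)⟩ with hy
  set η : ℕ → StrongDual ℂ (Space n t (.lp ∞ h)) := fun j =>
    (Real.exp (-(normSq (p j) / (2 * t))) : ℂ) • evalCLM t (.lp ∞ h) (p j) with hη
  have hηg : ∀ j g, η j g = weighted t g (p j) := fun j g => by
    simp only [hη, weighted, smul_apply, evalCLM_apply, smul_eq_mul]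
    exact mul_comm _ _
  set k : Space n t (.lp ∞ h) → (Fin n → ℂ) → ℂ := fun g w => weighted t g (p (i w)) with hk
  have hkm : ∀ g, MemL t ∞ (unweighted t (k g)) := fun g =>
    memL_top_of_weighted_eq (c := C * ‖g‖)
      ((measurable_from_nat (f := fun j => weighted t g (p j))).comp hi)
      (fun w => hC g _) (weighted_unweighted _)
  set S : Space n t (.lp ∞ h) →L[ℂ] Space n t (.lp ∞ h) :=
    ∑ j ∈ Finset.range N, (η j).smulRight (y j) with hS
  have hSg : ∀ g, (S g : (Fin n → ℂ) → ℂ) = proj t (unweighted t (k g)) := fun g => by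
    funext z
    have h1 : S g z = ∑ j ∈ Finset.range N, η j g * proj t (b j) z := by
      rw [← evalCLM_apply, hS, sum_apply, map_sum]
      refine Finset.sum_congr rfl fun j _ => ?_
      rw [ContinuousLinearMap.smulRight_apply, map_smul, smul_eq_mul]
      rfl
    rw [h1]
    simp only [proj, pairing, mul_left_comm (η _ g)]
    rw [← Finset.mul_sum]
    congr 1
    simp only [← integral_const_mul]
    rw [← integral_finsetSum _ fun j _ => ((hbm j).integrable_proj ht h z).const_mul _]
    congr 1
    funext w
    rw [Finset.sum_eq_single (i w)]
    · rw [hηg]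
      simp [hb, hk, unweighted, mul_assoc]
    · intro j _ hj
      have h2 : w ∉ i ⁻¹' {j} := fun h3 => hj h3.symm
      simp [hb, unweighted, h2]
    · intro h4
      exact absurd (Finset.mem_range.2 (hiN w)) h4
  refine ⟨S, ?_, fun v hv => ?_, determinesTrace_sum_smulRight _ _ _⟩
  · refine ContinuousLinearMap.opNorm_le_bound _ (by positivity) fun g => ?_
    refine (hP _ _ (hkm g) (hSg g)).trans ?_
    rw [mul_assoc]
    refine mul_le_mul_of_nonneg_left ?_ hP0
    refine ENNReal.toReal_le_of_le_ofReal (by positivity) (eNormL_top_le fun w => ?_)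
    rw [weighted_unweighted]
    exact hC g _
  · have h1 : (S v - v : Space n t (.lp ∞ h)) =
        proj t (unweighted t (k v) - (v : (Fin n → ℂ) → ℂ)) := by
      rw [MemL.proj_sub h (hkm v) v.memL, Space.proj_eq, ← hSg v]
      rfl
    have hsub : MemL t ∞ (unweighted t (k v) - (v : (Fin n → ℂ) → ℂ)) := by
      unfold MemL
      rw [weighted_sub]
      exact MemLp.sub (hkm v) v.memL
    refine (hP _ _ hsub h1).trans ?_
    have h2 : (eNormL t ∞ (unweighted t (k v) - (v : (Fin n → ℂ) → ℂ))).toReal ≤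
        ε / (P + 1) := by
      refine ENNReal.toReal_le_of_le_ofReal (by positivity) (eNormL_top_le fun w => ?_)
      rw [weighted_sub, weighted_unweighted]
      have h3 := (dist_le_pi_dist _ _ (⟨v, hv⟩ : V)).trans (hdist w)
      rw [dist_eq_norm] at h3
      exact h3
    refine (mul_le_mul_of_nonneg_left h2 hP0).trans ?_
    rw [← mul_div_assoc, div_le_iff₀ (by positivity)]
    nlinarith

theorem hasTraceApproximation (n : ℕ) (t : ℝ) [ht : Fact (0 < t)] (X : Kind) :
    HasTraceApproximation (Space n t X) := by
  cases X with
  | vanishing => exact hasTraceApproximation_vanishing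
  | lp p hp =>
    by_cases hpt : p = ∞
    · subst hpt
      exact hasTraceApproximation_top ht hp
    · exact hasTraceApproximation_of_ne_top hp hpt

end Sampling

/-! ### The trace formula -/

section TraceFormula

variable {n : ℕ} {t : ℝ} [ht : Fact (0 < t)] {X : Kind}

/-- On the kernels, `α_{-z}(T_f)` is the Toeplitz operator with symbol `f(· + z)`. -/
theorem shift_kernelVec {f : (Fin n → ℂ) → ℂ} {D : Submodule ℂ (Space n t X)}
    (hD : ∀ z, kernelVec t X z ∈ D) {A : Space n t X →L[ℂ] Space n t X}
    (hA : ∀ g ∈ D, (A g : (Fin n → ℂ) → ℂ) = toeplitz t f g) (z w : Fin n → ℂ) :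
    (Fock.shift (-z) A (kernelVec t X w) : (Fin n → ℂ) → ℂ) =
      toeplitz t (fun u => f (u + z)) (kernel t w) := by
  have h1 : Fock.shift (-z) A (kernelVec t X w) =
      weylVec (-z) (A (weylVec (- -z) (kernelVec t X w))) := rfl
  have hc : (kernelVec t X (w + z) : (Fin n → ℂ) → ℂ) = kernel t (w + z) := rfl
  have h2 := hA _ (hD (w + z))
  rw [hc] at h2
  rw [h1, neg_neg, weylVec_kernelVec, map_smul, toeplitz_shift_kernel, ← h2]
  funext u
  rw [weylVec_apply, Pi.smul_apply, smul_eq_mul, weylFun, weylFun, Space.coe_smul, Pi.smul_apply,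
    smul_eq_mul, mul_left_comm]

/-- The trace of `T_0^{(s)} B`, computed along the monomials. -/
theorem hasNuclearTrace_opT0_comp {s : ℝ} (hs : t / 2 < s) (B : Space n t X →L[ℂ] Space n t X) :
    HasNuclearTrace (opT0 n t X s ∘L B) ((((Real.pi * t) ^ n)⁻¹ : ℝ) *
      ∫ w, B (kernelVec t X w) (((1 - t / s : ℝ) : ℂ) • w) *
        (Real.exp (-(normSq w / t)) : ℂ)) := by
  refine (hasTraceApproximation n t X).hasNuclearTrace
    (x := fun α => (((1 - t / s) ^ (∑ j, α j) : ℝ) : ℂ) • monomialVec t X α)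
    (ξ := fun α => (coeffFunctional t X α).comp B) ?_ (fun v => ?_) ?_
  · have h := (summable_monomial_coeff n t X X (abs_one_sub_div_lt_one ht.out hs)).mul_right ‖B‖
    refine Summable.of_nonneg_of_le (fun α => by positivity) (fun α => ?_) h
    rw [← norm_smul_monomialVec_mul, mul_assoc]
    exact mul_le_mul_of_nonneg_left (ContinuousLinearMap.opNorm_comp_le _ _) (norm_nonneg _)
  · have h := (hasSum_rankOne (n := n) (X := X) hs).mapL
      (ContinuousLinearMap.apply ℂ (Space n t X) (B v))
    refine h.congr_fun fun α => ?_
    simp only [ContinuousLinearMap.apply_apply, smul_apply, rankOne_apply,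
      ContinuousLinearMap.comp_apply]
    rw [smul_comm]
  · refine (hasSum_trace_monomial hs B).congr_fun fun α => ?_
    simp only [ContinuousLinearMap.comp_apply, map_smul, smul_eq_mul]

/-- For `A = T_f` on the kernels, the Gaussian integral which gives the trace of
`T_0^{(s)} α_{-z}(A)` is the key identity with `a = 1` and `b = 1 - t / s`, for the symbol
`f(· + z)`. -/
theorem exists_trace_formula {s : ℝ} (h1 : t / 2 < s) (h2 : s < t) {f : (Fin n → ℂ) → ℂ}
    (hf : Admissible t f) {D : Submodule ℂ (Space n t X)} (hD : ∀ z, kernelVec t X z ∈ D)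
    {A : Space n t X →L[ℂ] Space n t X}
    (hA : ∀ g ∈ D, (A g : (Fin n → ℂ) → ℂ) = toeplitz t f g) (z : Fin n → ℂ) :
    ∃ τ : ℂ, HasNuclearTrace (opT0 n t X s ∘L Fock.shift (-z) A) τ ∧
      berezin s f z = (((t / s) ^ n : ℝ) : ℂ) * τ := by
  refine ⟨_, hasNuclearTrace_opT0_comp h1 _, ?_⟩
  have ht0 := ht.out
  have hs : 0 < s := by linarith
  have hx := abs_lt.1 (abs_one_sub_div_lt_one ht0 h1)
  -- `s < t` makes `1 - t / s` negative, so that `(a + b)² < 1`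
  have hx0 : 1 - t / s < 0 := sub_neg.2 ((one_lt_div hs).2 h2)
  have key := integral_toeplitz_kernel ht0 hs (a := 1) (b := 1 - t / s)
    (by nlinarith) (one_mul _) (hf.shift z).memL
  rw [berezin_shift] at key
  simp only [Complex.ofReal_one, one_smul] at key
  simp only [shift_kernelVec hD hA]
  rw [key, ← mul_assoc, ← mul_assoc, ← Complex.ofReal_mul, ← Complex.ofReal_mul]
  have h3 : (t / s) ^ n * ((Real.pi * t) ^ n)⁻¹ * (Real.pi * s) ^ n = 1 := by
    rw [← inv_pow, ← mul_pow, ← mul_pow]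
    have h4 : t / s * (Real.pi * t)⁻¹ * (Real.pi * s) = 1 := by
      field_simp [Real.pi_ne_zero]
    rw [h4, one_pow]
  rw [h3, Complex.ofReal_one, one_mul]

end TraceFormula

end

end Fock

theorem mainTheorem9 (n : ℕ) (t : ℝ) [Fact (0 < t)] (X : Fock.Kind) :
    -- the estimate
    (∀ s : ℝ, t / 2 < s → s < 2 * t →
      ∃ C : ℝ, 0 < C ∧
        ∀ f : (Fin n → ℂ) → ℂ, Fock.Admissible t f →
          (∀ z, MeasureTheory.Integrable (fun w =>
            f w * Fock.nkernel s z w * (starRingEnd ℂ) (Fock.nkernel s z w) *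
              (Real.exp (-(Fock.normSq w / s)) : ℂ))) ∧
          ∀ D : Submodule ℂ (Fock.Space n t X), (∀ z, Fock.kernelVec t X z ∈ D) →
            ⨆ z, ENNReal.ofReal ‖Fock.berezin s f z‖ ≤
              ENNReal.ofReal C * Fock.toeplitzNorm f D) ∧
    -- nuclearity of `T_0^{(s)}`
    (∀ s : ℝ, t / 2 < s →
      Fock.IsNuclear (Fock.opT0 n t X s) ∧
      Filter.Tendsto (fun N : ℕ => Fock.nuclearNorm (Fock.opT0 n t X s -
          ∑ k ∈ Finset.range N, (((1 - t / s) ^ k : ℝ) : ℂ) • Fock.homProj n t X k))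
        Filter.atTop (nhds 0)) ∧
    -- the trace formula
    (∀ s : ℝ, t / 2 < s → s < t →
      ∀ f : (Fin n → ℂ) → ℂ, Fock.Admissible t f →
        ∀ D : Submodule ℂ (Fock.Space n t X), (∀ z, Fock.kernelVec t X z ∈ D) →
          ∀ A : Fock.Space n t X →L[ℂ] Fock.Space n t X,
            (∀ g ∈ D, (A g : (Fin n → ℂ) → ℂ) = Fock.toeplitz t f g) →
            ∀ z : Fin n → ℂ, ∃ τ : ℂ,
              Fock.HasNuclearTrace (Fock.opT0 n t X s ∘L Fock.shift (-z) A) τ ∧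
              Fock.berezin s f z = (((t / s) ^ n : ℝ) : ℂ) * τ) := by
  have ht : 0 < t := Fact.out
  refine ⟨fun s h1 h2 => ?_, fun s hs =>
    ⟨Fock.isNuclear_opT0 hs, Fock.tendsto_nuclearNorm_opT0_sub hs⟩,
    fun s h1 h2 f hf D hD A hA z => Fock.exists_trace_formula h1 h2 hf hD hA z⟩
  obtain ⟨C, hC0, hC⟩ := Fock.exists_berezin_le n t X h1 h2
  exact ⟨C, hC0, fun f hf => ⟨hf.integrable_berezin ht (by linarith) h2, hC f hf⟩⟩
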